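/- Let $(M,\omega)$ be a compact symplectic manifold of dimension $2n$ (for instance a compact Kähler manifold). Let $\mathscr{J}$ be the space of smooth almost complex structures $J$ on $M$ compatible with $\omega$, i.e. $J^2=-1$, $\omega(J-,J-)=\omega$ and $\omega(v,Jv)>0$ for $v\neq 0$. It is a Fréchet manifold, whose tangent space at $J$ is $$T_J\mathscr{J}=\{A\in\Gamma(\mathrm{End}\,TM)\ :\ AJ+JA=0,\ \omega(A-,J-)+\omega(J-,A-)=0\}.$$ Equip $\mathscr{J}$ with the almost complex structure $\mathbb{J}A=JA$ and the Donaldson–Fujiki metric $\mathbb{G}(A,B)=\frac12\int_M\mathrm{Tr}(AB)\,\frac{\omega^n}{n!}$. Then: 1. $(\mathscr{J},\mathbb{G},\mathbb{J})$ is formally Kähler: $\mathbb{G}$ is a smooth Riemannian metric, $\mathbb{J}$ is $\mathbb{G}$-orthogonal with vanishing Nijenhuis tensor, and the 2-form $\mathbb{G}(\mathbb{J}-,-)$ is closed. If $n\ge 1$ and $M\neq\emptyset$, then $T_J\mathscr{J}$ is infinite-dimensional for every $J\in\mathscr{J}$. 2. Every $A\in T_J\mathscr{J}$ is the value at $J$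 of a smooth vector field on $\mathscr{J}$, and $\mathbb{G}$ has a unique Levi-Civita connection $\nabla$ (a torsion-free metric connection on the smooth vector fields of $\mathscr{J}$). 3. The curvature $R(X,Y)Z=\nabla_X\nabla_YZ-\nabla_Y\nabla_XZ-\nabla_{[X,Y]}Z$ is given by $R_J(A,B)C=-\frac14[[A,B],C]$ for $J\in\mathscr{J}$ and $A,B,C\in T_J\mathscr{J}$, with commutators taken in $\mathrm{End}(TM)$. 4. The complex structure and the curvature tensor are covariantly constant, $\nabla\mathbb{J}=0$ and $\nabla R=0$; that is, $\mathscr{J}$ is a formally symmetric infinite-dimensional Kähler manifold. -/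

import Mathlib

open Bundle Manifold
open scoped ContDiff

noncomputable section

namespace CompatibleACS

/-! ### Symplectic manifolds and their volume -/

/-- The model space `ℝ²ⁿ`. -/
abbrev Model (n : ℕ) : Type := EuclideanSpace ℝ (Fin (2 * n))

section Manifold

variable (n : ℕ) (M : Type*) [TopologicalSpace M] [ChartedSpace (Model n) M]

/-- The tangent space `T_x M`. -/
abbrev Tan {M : Type*} [TopologicalSpace M] [ChartedSpace (Model n) M] (x : M) : Type :=
  TangentSpace 𝓘(ℝ, Model n) x

/-- Fields of endomorphisms of `TM`, not necessarily continuous; a ring under fibrewise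
composition. -/
abbrev EndField : Type _ := ∀ x : M, Tan n x →L[ℝ] Tan n x

/-- A field of bilinear forms on `M`, in the chart at `c`: the pulled back form
`(φ⁻¹)^* b` at the point `y` of the target of the chart `φ`. -/
def localForm {n : ℕ} {M : Type*} [TopologicalSpace M] [ChartedSpace (Model n) M]
    (b : ∀ x : M, Tan n x →L[ℝ] Tan n x →L[ℝ] ℝ) (c : M) (y u v : Model n) : ℝ :=
  b ((chartAt (Model n) c).symm y)
    (mfderiv 𝓘(ℝ, Model n) 𝓘(ℝ, Model n) (chartAt (Model n) c).symm y u)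
    (mfderiv 𝓘(ℝ, Model n) 𝓘(ℝ, Model n) (chartAt (Model n) c).symm y v)

variable [IsManifold 𝓘(ℝ, Model n) ∞ M]

/-- A symplectic form: a smooth, alternating, nondegenerate and closed `2`-form. Closedness is
`u ω(v,w) + v ω(w,u) + w ω(u,v) = 0` for constant vector fields `u, v, w` in each chart. -/
structure SymplecticForm where
  form : ∀ x : M, Tan n x →L[ℝ] Tan n x →L[ℝ] ℝ
  smooth : ContMDiff 𝓘(ℝ, Model n) (𝓘(ℝ, Model n).prod 𝓘(ℝ, Model n →L[ℝ] Model n →L[ℝ] ℝ)) ∞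
    (fun x : M ↦ TotalSpace.mk' (Model n →L[ℝ] Model n →L[ℝ] ℝ)
      (E := fun x : M ↦ (Tan n x →L[ℝ] Tan n x →L[ℝ] ℝ)) x (form x))
  alternating : ∀ x v, form x v v = 0
  nondegenerate : ∀ x v, (∀ w, form x v w = 0) → v = 0
  closed : ∀ c : M, ∀ y ∈ (chartAt (Model n) c).target, ∀ u v w : Model n,
    fderiv ℝ (fun z ↦ localForm form c z v w) y u + fderiv ℝ (fun z ↦ localForm form c z w u) y v
      + fderiv ℝ (fun z ↦ localForm form c z u v) y w = 0

variable {n M}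

/-- The coefficient of the volume form `ωⁿ/n!` in the chart at `c`, with respect to Lebesgue
measure: the absolute value `√det (ω_ij)` of the Pfaffian of the matrix of `ω`. -/
def volumeDensity (Ω : SymplecticForm n M) (c : M) (y : Model n) : ℝ :=
  Real.sqrt (Matrix.det (Matrix.of fun i j : Fin (2 * n) ↦
    localForm Ω.form c y (EuclideanSpace.single i 1) (EuclideanSpace.single j 1)))

variable (n M) in
/-- A partition of unity subordinate to the preferred charts of `M`. -/
def chartPartition [T2Space M] [CompactSpace M] :
    SmoothPartitionOfUnity M 𝓘(ℝ, Model n) M Set.univ :=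
  (SmoothPartitionOfUnity.exists_isSubordinate_chartAt_source 𝓘(ℝ, Model n) M).choose

/-- The integral `∫_M f ωⁿ/n!`, where `M` is oriented by `ωⁿ`. -/
def liouvilleIntegral [T2Space M] [CompactSpace M] (Ω : SymplecticForm n M) (f : M → ℝ) : ℝ :=
  ∑ᶠ c : M, ∫ y in (chartAt (Model n) c).target,
    chartPartition n M c ((chartAt (Model n) c).symm y) * f ((chartAt (Model n) c).symm y) *
      volumeDensity Ω c y

/-! ### Smooth families of endomorphism fields -/

/-- Smoothness of an endomorphism field of `TM` along a map `b : N → M`. -/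
def SmoothAlong {F H N : Type*} [NormedAddCommGroup F] [NormedSpace ℝ F] [TopologicalSpace H]
    (I : ModelWithCorners ℝ F H) [TopologicalSpace N] [ChartedSpace H N]
    (b : N → M) (s : ∀ p, Tan n (b p) →L[ℝ] Tan n (b p)) : Prop :=
  ContMDiff I (𝓘(ℝ, Model n).prod 𝓘(ℝ, Model n →L[ℝ] Model n)) ∞
    (fun p : N ↦ TotalSpace.mk' (Model n →L[ℝ] Model n)
      (E := fun x : M ↦ (Tan n x →L[ℝ] Tan n x)) (b p) (s p))

/-- Smooth sections of `End(TM)`. -/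
def IsSmoothField (A : EndField n M) : Prop := SmoothAlong 𝓘(ℝ, Model n) (fun x : M ↦ x) A

/-- A family of sections of `End(TM)` with parameter in a vector space `F` is smooth if
`(u, x) ↦ P u x` is smooth on `F × M`. -/
def IsSmoothFamily {F : Type*} [NormedAddCommGroup F] [NormedSpace ℝ F]
    (P : F → EndField n M) : Prop :=
  SmoothAlong (𝓘(ℝ, F).prod 𝓘(ℝ, Model n)) (fun p : F × M ↦ p.2) (fun p ↦ P p.1 p.2)

section lemmas

variable {F H N : Type*} [NormedAddCommGroup F] [NormedSpace ℝ F] [TopologicalSpace H]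
    {I : ModelWithCorners ℝ F H} [TopologicalSpace N] [ChartedSpace H N]
    {b : N → M} {s t : ∀ p, Tan n (b p) →L[ℝ] Tan n (b p)}

lemma SmoothAlong.add (hs : SmoothAlong I b s) (ht : SmoothAlong I b t) :
    SmoothAlong I b (fun p ↦ s p + t p) := by
  intro p
  have h1 := (contMDiffAt_hom_bundle _).1 (hs p)
  have h2 := (contMDiffAt_hom_bundle _).1 (ht p)
  refine (contMDiffAt_hom_bundle _).2 ⟨h1.1, ?_⟩
  refine (h1.2.add h2.2).congr_of_eventuallyEq (Filter.Eventually.of_forall fun q ↦ ?_)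
  simp [ContinuousLinearMap.inCoordinates]

lemma SmoothAlong.smul (hs : SmoothAlong I b s) {f : N → ℝ} (hf : ContMDiff I 𝓘(ℝ, ℝ) ∞ f) :
    SmoothAlong I b (fun p ↦ f p • s p) := by
  intro p
  have h1 := (contMDiffAt_hom_bundle _).1 (hs p)
  refine (contMDiffAt_hom_bundle _).2 ⟨h1.1, ?_⟩
  refine ((hf p).smul h1.2).congr_of_eventuallyEq (Filter.Eventually.of_forall fun q ↦ ?_)
  simp [ContinuousLinearMap.inCoordinates]

lemma SmoothAlong.mul (hs : SmoothAlong I b s) (ht : SmoothAlong I b t) :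
    SmoothAlong I b (fun p ↦ s p * t p) := by
  intro p
  have h1 := (contMDiffAt_hom_bundle _).1 (hs p)
  have h2 := (contMDiffAt_hom_bundle _).1 (ht p)
  refine (contMDiffAt_hom_bundle _).2 ⟨h1.1, ?_⟩
  refine (h1.2.clm_comp h2.2).congr_of_eventuallyEq ?_
  have hU := h1.1.continuousAt.preimage_mem_nhds
    ((trivializationAt (Model n) (TangentSpace 𝓘(ℝ, Model n)) (b p)).open_baseSet.mem_nhds
      (FiberBundle.mem_baseSet_trivializationAt' (b p)))
  filter_upwards [hU] with q hq
  ext v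
  simp only [ContinuousLinearMap.inCoordinates, ContinuousLinearMap.comp_apply,
    ContinuousLinearMap.mul_apply]
  rw [Trivialization.symmL_continuousLinearMapAt _ hq]

end lemmas

/-! ### The space of compatible almost complex structures -/

/-- The smooth almost complex structures `J` compatible with `Ω`: `J² = -1`,
`Ω(J-, J-) = Ω` and `Ω(-, J-) > 0`. -/
def ACS (Ω : SymplecticForm n M) : Type _ :=
  {J : EndField n M // IsSmoothField J ∧ J * J = -1 ∧
    (∀ x v w, Ω.form x (J x v) (J x w) = Ω.form x v w) ∧
    ∀ x v, v ≠ 0 → 0 < Ω.form x v (J x v)}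

variable {Ω : SymplecticForm n M}

/-- The tangent space of `ACS Ω` at `J`: the smooth `A` with `AJ + JA = 0` and
`Ω(A-, J-) + Ω(J-, A-) = 0`. -/
def tangentAt (J : ACS Ω) : Submodule ℝ (EndField n M) where
  carrier := {A | IsSmoothField A ∧ A * J.1 + J.1 * A = 0 ∧
    ∀ x v w, Ω.form x (A x v) (J.1 x w) + Ω.form x (J.1 x v) (A x w) = 0}
  zero_mem' := by
    refine ⟨?_, by simp, by simp⟩
    have h := J.2.1.smul (f := fun _ : M ↦ (0 : ℝ)) contMDiff_const
    simp only [zero_smul] at h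
    exact h
  add_mem' := by
    rintro A B ⟨hA, hA1, hA2⟩ ⟨hB, hB1, hB2⟩
    refine ⟨hA.add hB, ?_, fun x v w ↦ ?_⟩
    · rw [add_mul, mul_add, add_add_add_comm, hA1, hB1, add_zero]
    · have h1 := hA2 x v w
      have h2 := hB2 x v w
      simp only [Pi.add_apply, map_add, ContinuousLinearMap.add_apply]
      linarith
  smul_mem' := by
    rintro r A ⟨hA, hA1, hA2⟩
    refine ⟨hA.smul (f := fun _ : M ↦ r) contMDiff_const, ?_, fun x v w ↦ ?_⟩
    · rw [smul_mul_assoc, mul_smul_comm, ← smul_add, hA1, smul_zero]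
    · have h1 := hA2 x v w
      simp only [Pi.smul_apply, map_smul, ContinuousLinearMap.smul_apply, smul_eq_mul]
      rw [← mul_add, h1, mul_zero]

lemma mul_mem_tangentAt (J : ACS Ω) {A : EndField n M} (hA : A ∈ tangentAt J) :
    J.1 * A ∈ tangentAt J := by
  obtain ⟨h0, h1, h2⟩ := hA
  obtain ⟨hJ, hJ1, hJ2, -⟩ := J.2
  have hJJ : ∀ x v, J.1 x (J.1 x v) = -v := fun x v ↦ by
    have := congrArg (fun B : EndField n M ↦ B x v) hJ1
    simpa using this
  refine ⟨hJ.mul h0, ?_, fun x v w ↦ ?_⟩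
  · rw [mul_assoc, ← mul_add, h1, mul_zero]
  · have h3 := h2 x v (J.1 x w)
    rw [hJJ, ← hJ2 x (J.1 x v), hJJ] at h3
    have h4 : A x (J.1 x w) = - J.1 x (A x w) := by
      have := congrArg (fun B : EndField n M ↦ B x w) h1
      exact eq_neg_of_add_eq_zero_left (by simpa using this)
    rw [h4] at h3
    simp only [map_neg, ContinuousLinearMap.neg_apply, hJJ, neg_neg] at h3
    have h5 := hJ2 x (A x v) w
    have h6 := hJ2 x v (A x w)
    simp only [Pi.mul_apply, ContinuousLinearMap.mul_apply]
    rw [h5, h6]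
    linarith

/-! The smooth structure of the Fréchet manifold `ACS Ω` is encoded by its smooth
finite-dimensional families (plots): smooth maps from `ℝᵏ` to the space of sections are smooth
sections over `ℝᵏ × M`, and a map on a Fréchet manifold is smooth if and only if it sends
smooth families to smooth families. -/

/-- Smooth functions on `ACS Ω`. -/
def IsSmoothFunction (f : ACS Ω → ℝ) : Prop :=
  ∀ (k : ℕ) (P : EuclideanSpace ℝ (Fin k) → ACS Ω),
    IsSmoothFamily (fun u ↦ (P u).1) → ContDiff ℝ ∞ (f ∘ P)

variable (Ω) in
/-- Smooth vector fields on `ACS Ω`. -/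
def vectorFields : Submodule ℝ (ACS Ω → EndField n M) where
  carrier := {X | (∀ J, X J ∈ tangentAt J) ∧
    ∀ (k : ℕ) (P : EuclideanSpace ℝ (Fin k) → ACS Ω),
      IsSmoothFamily (fun u ↦ (P u).1) → IsSmoothFamily (fun u ↦ X (P u))}
  zero_mem' := by
    refine ⟨fun J ↦ zero_mem _, fun k P hP ↦ ?_⟩
    have h := SmoothAlong.smul hP (f := fun _ ↦ (0 : ℝ)) contMDiff_const
    simp only [zero_smul] at h
    exact h
  add_mem' := fun hX hY ↦ ⟨fun J ↦ add_mem (hX.1 J) (hY.1 J),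
    fun k P hP ↦ SmoothAlong.add (hX.2 k P hP) (hY.2 k P hP)⟩
  smul_mem' := fun r _ hX ↦ ⟨fun J ↦ Submodule.smul_mem _ r (hX.1 J),
    fun k P hP ↦ SmoothAlong.smul (hX.2 k P hP) (f := fun _ ↦ r) contMDiff_const⟩

variable (Ω) in
/-- Smooth vector fields on `ACS Ω`. -/
abbrev VectorField : Type _ := vectorFields Ω

/-- The vector field `f X`. -/
def funSMul (f : ACS Ω → ℝ) (hf : IsSmoothFunction f) (X : VectorField Ω) : VectorField Ω :=
  ⟨fun J ↦ f J • X.1 J, fun J ↦ Submodule.smul_mem _ _ (X.2.1 J), fun k P hP ↦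
    SmoothAlong.smul (X.2.2 k P hP) (f := fun p ↦ f (P p.1))
      ((hf k P hP).contMDiff.comp contMDiff_fst)⟩

/-- The almost complex structure `𝕁 A = J A` of `ACS Ω`, acting on vector fields. -/
def complexStructure (X : VectorField Ω) : VectorField Ω :=
  ⟨fun J ↦ J.1 * X.1 J, fun J ↦ mul_mem_tangentAt J (X.2.1 J), fun k P hP ↦
    SmoothAlong.mul hP (X.2.2 k P hP)⟩

/-- `c` is a smooth curve in `ACS Ω` with `c(0) = J` and `c'(0) = A`. -/
def IsCurveThrough (c : ℝ → ACS Ω) (J : ACS Ω) (A : EndField n M) : Prop :=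
  IsSmoothFamily (fun t ↦ (c t).1) ∧ c 0 = J ∧ ∀ x, HasDerivAt (fun t ↦ (c t).1 x) (A x) 0

/-- `f` has derivative `l` at `J` in the direction `A`, computed along any smooth curve. -/
def HasDirDeriv {V : Type*} [AddCommGroup V] [Module ℝ V] [TopologicalSpace V]
    [ContinuousSMul ℝ V] (f : ACS Ω → V) (J : ACS Ω) (A : EndField n M) (l : V) : Prop :=
  (∃ c, IsCurveThrough c J A) ∧
    ∀ c, IsCurveThrough c J A → HasDerivAt (fun t ↦ f (c t)) l 0

/-- `[X, Y] = Z`, that is `Z = D_X Y - D_Y X`, where `D` is the directional derivative of maps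
with values in sections of `End(TM)`. -/
def IsLieBracket (X Y Z : VectorField Ω) : Prop :=
  ∀ J, ∃ B C : EndField n M,
    (∀ x, HasDirDeriv (fun J' ↦ Y.1 J' x) J (X.1 J) (B x)) ∧
    (∀ x, HasDirDeriv (fun J' ↦ X.1 J' x) J (Y.1 J) (C x)) ∧ Z.1 J = B - C

open Classical in
/-- The Lie bracket of vector fields (which always exists, see `IsFormallyKahler.bracket`). -/
def lieBracket (X Y : VectorField Ω) : VectorField Ω :=
  if h : ∃ Z, IsLieBracket X Y Z then h.choose else 0

section Metric

variable [T2Space M] [CompactSpace M]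

variable (Ω) in
/-- The metric `𝔾(A, B) = ½ ∫_M Tr(AB) ωⁿ/n!`. -/
def metric (A B : EndField n M) : ℝ :=
  (1 / 2) * liouvilleIntegral Ω
    (fun x ↦ LinearMap.trace ℝ (Tan n x) ((A x * B x : Tan n x →L[ℝ] Tan n x) : _ →ₗ[ℝ] _))

/-- The `2`-form `𝔾(𝕁A, B)`. -/
def kahlerForm (J : ACS Ω) (A B : EndField n M) : ℝ := metric Ω (J.1 * A) B

variable (Ω) in
/-- `(ACS Ω, 𝔾, 𝕁)` is a formal Kähler manifold: `𝔾` is a smooth Riemannian metric, `𝕁` is a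
`𝔾`-orthogonal almost complex structure with vanishing Nijenhuis tensor, and the `2`-form
`𝔾(𝕁-, -)` is closed. -/
structure IsFormallyKahler : Prop where
  bracket : ∀ X Y : VectorField Ω, IsLieBracket X Y (lieBracket X Y)
  metric_add : ∀ J : ACS Ω, ∀ A ∈ tangentAt J, ∀ B ∈ tangentAt J, ∀ C ∈ tangentAt J,
    metric Ω (A + B) C = metric Ω A C + metric Ω B C
  metric_smul : ∀ J : ACS Ω, ∀ A ∈ tangentAt J, ∀ B ∈ tangentAt J, ∀ r : ℝ,
    metric Ω (r • A) B = r * metric Ω A B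
  metric_symm : ∀ J : ACS Ω, ∀ A ∈ tangentAt J, ∀ B ∈ tangentAt J, metric Ω A B = metric Ω B A
  metric_pos : ∀ J : ACS Ω, ∀ A ∈ tangentAt J, A ≠ 0 → 0 < metric Ω A A
  metric_smooth : ∀ X Y : VectorField Ω, IsSmoothFunction fun J ↦ metric Ω (X.1 J) (Y.1 J)
  complex_sq : ∀ X : VectorField Ω, complexStructure (complexStructure X) = -X
  metric_complex : ∀ J : ACS Ω, ∀ A ∈ tangentAt J, ∀ B ∈ tangentAt J,
    metric Ω (J.1 * A) (J.1 * B) = metric Ω A B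
  nijenhuis : ∀ X Y : VectorField Ω,
    lieBracket (complexStructure X) (complexStructure Y) =
      lieBracket X Y + complexStructure (lieBracket (complexStructure X) Y) +
        complexStructure (lieBracket X (complexStructure Y))
  closed : ∀ (X Y Z : VectorField Ω) (J : ACS Ω), ∃ a b c : ℝ,
    HasDirDeriv (fun J' ↦ kahlerForm J' (Y.1 J') (Z.1 J')) J (X.1 J) a ∧
    HasDirDeriv (fun J' ↦ kahlerForm J' (Z.1 J') (X.1 J')) J (Y.1 J) b ∧
    HasDirDeriv (fun J' ↦ kahlerForm J' (X.1 J') (Y.1 J')) J (Z.1 J) c ∧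
    a + b + c - kahlerForm J ((lieBracket X Y).1 J) (Z.1 J)
      - kahlerForm J ((lieBracket Y Z).1 J) (X.1 J)
      - kahlerForm J ((lieBracket Z X).1 J) (Y.1 J) = 0

end Metric

/-- Affine connections on `ACS Ω`, `D X Y = ∇_X Y`. -/
structure IsConnection (D : VectorField Ω → VectorField Ω → VectorField Ω) : Prop where
  add_left : ∀ X X' Y, D (X + X') Y = D X Y + D X' Y
  smul_left : ∀ f hf X Y, D (funSMul f hf X) Y = funSMul f hf (D X Y)
  add_right : ∀ X Y Y', D X (Y + Y') = D X Y + D X Y'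
  leibniz : ∀ f hf X Y J, ∃ d : ℝ, HasDirDeriv f J (X.1 J) d ∧
    (D X (funSMul f hf Y)).1 J = f J • (D X Y).1 J + d • Y.1 J

/-- Levi-Civita connections of `𝔾`: torsion-free metric connections. -/
structure IsLeviCivita [T2Space M] [CompactSpace M]
    (D : VectorField Ω → VectorField Ω → VectorField Ω) : Prop extends IsConnection D where
  torsion_free : ∀ X Y, IsLieBracket X Y (D X Y - D Y X)
  metric : ∀ (X Y Z : VectorField Ω) (J : ACS Ω),
    HasDirDeriv (fun J' ↦ metric Ω (Y.1 J') (Z.1 J')) J (X.1 J)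
      (metric Ω ((D X Y).1 J) (Z.1 J) + metric Ω (Y.1 J) ((D X Z).1 J))

/-- The curvature `R(X, Y)Z = ∇_X ∇_Y Z - ∇_Y ∇_X Z - ∇_[X,Y] Z`. -/
def curvature (D : VectorField Ω → VectorField Ω → VectorField Ω) (X Y Z : VectorField Ω) :
    VectorField Ω :=
  D X (D Y Z) - D Y (D X Z) - D (lieBracket X Y) Z

end Manifold

end CompatibleACS

end

noncomputable section

namespace CompatibleACS

section ParametricIntegral

open MeasureTheory Set

variable {E G : Type} [NormedAddCommGroup E] [NormedSpace ℝ E]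
  [NormedAddCommGroup G] [NormedSpace ℝ G] {V : Set E} {U : Set G}

/-- The partial derivative of `f` in the first variable. -/
def partialFDeriv {H : Type} [NormedAddCommGroup H] [NormedSpace ℝ H] (f : E × G → H)
    (p : E × G) : E →L[ℝ] H :=
  (fderiv ℝ f p).comp (ContinuousLinearMap.inl ℝ E G)

lemma contDiffOn_partialFDeriv {H : Type} [NormedAddCommGroup H] [NormedSpace ℝ H]
    {f : E × G → H} {m k : ℕ∞ω} (hV : IsOpen V) (hU : IsOpen U)
    (hf : ContDiffOn ℝ m f (V ×ˢ U)) (hk : k + 1 ≤ m) :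
    ContDiffOn ℝ k (partialFDeriv f) (V ×ˢ U) :=
  (hf.fderiv_of_isOpen (hV.prod hU) hk).clm_comp contDiffOn_const

lemma hasFDerivAt_partial {H : Type} [NormedAddCommGroup H] [NormedSpace ℝ H]
    {f : E × G → H} {u : E} {y : G} (hf : DifferentiableAt ℝ f (u, y)) :
    HasFDerivAt (fun v ↦ f (v, y)) (partialFDeriv f (u, y)) u :=
  hf.hasFDerivAt.comp u (hasFDerivAt_prodMk_left u y)

variable [FiniteDimensional ℝ E] [MeasurableSpace G] [BorelSpace G]
  {μ : Measure G} [IsFiniteMeasureOnCompacts μ] {K : Set G} {w : G → ℝ}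

lemma hasFDerivAt_setIntegral {H : Type} [NormedAddCommGroup H] [NormedSpace ℝ H]
    {f : E × G → H} (hV : IsOpen V) (hU : IsOpen U) (hK : IsCompact K) (hKU : K ⊆ U)
    (hw : ContinuousOn w K) (hf : ContDiffOn ℝ 1 f (V ×ˢ U)) {u : E} (hu : u ∈ V) :
    HasFDerivAt (fun u ↦ ∫ y in K, w y • f (u, y) ∂μ)
      (∫ y in K, w y • partialFDeriv f (u, y) ∂μ) u := by
  have hprop : ProperSpace E := FiniteDimensional.proper ℝ E
  have hD : ContinuousOn (partialFDeriv f) (V ×ˢ U) :=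
    (contDiffOn_partialFDeriv (k := 0) hV hU hf (by simp)).continuousOn
  have hcf : ∀ v ∈ V, ContinuousOn (fun y ↦ w y • f (v, y)) K := fun v hv ↦
    hw.smul (hf.continuousOn.comp (by fun_prop) fun y hy ↦ ⟨hv, hKU hy⟩)
  obtain ⟨ε, hε, hball⟩ := Metric.nhds_basis_closedBall.mem_iff.1 (hV.mem_nhds hu)
  have hcpt : IsCompact (Metric.closedBall u ε ×ˢ K) := (isCompact_closedBall u ε).prod hK
  have hsub : Metric.closedBall u ε ×ˢ K ⊆ V ×ˢ U := prod_mono hball hKU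
  obtain ⟨C, hC⟩ := hcpt.exists_bound_of_continuousOn
    (f := fun p : E × G ↦ w p.2 • partialFDeriv f p)
    ((hw.comp continuousOn_snd fun p hp ↦ hp.2).smul (hD.mono hsub))
  refine hasFDerivAt_integral_of_dominated_of_fderiv_le (bound := fun _ ↦ C)
    (F' := fun v y ↦ w y • partialFDeriv f (v, y)) (Metric.closedBall_mem_nhds u hε) ?_ ?_ ?_ ?_ ?_
    ?_
  · filter_upwards [hV.mem_nhds hu] with v hv
    exact ((hcf v hv).integrableOn_compact hK).aestronglyMeasurable
  · exact (hcf u hu).integrableOn_compact hK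
  · exact ((hw.smul (hD.comp (by fun_prop) fun y hy ↦ ⟨hu, hKU hy⟩)).integrableOn_compact
      (f := fun y ↦ w y • partialFDeriv f (u, y)) hK).aestronglyMeasurable
  · filter_upwards [ae_restrict_mem hK.measurableSet] with y hy v hv
    exact hC (v, y) ⟨hv, hy⟩
  · exact integrableOn_const hK.measure_lt_top.ne
  · filter_upwards [ae_restrict_mem hK.measurableSet] with y hy v hv
    refine (hasFDerivAt_partial ?_).const_smul (w y)
    exact (hf.contDiffAt ((hV.prod hU).mem_nhds (hsub ⟨hv, hy⟩))).differentiableAt (by simp)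

lemma contDiffOn_setIntegral_nat (hV : IsOpen V) (hU : IsOpen U) (hK : IsCompact K) (hKU : K ⊆ U)
    (hw : ContinuousOn w K) (m : ℕ) : ∀ {H : Type} [NormedAddCommGroup H] [NormedSpace ℝ H]
    {f : E × G → H}, ContDiffOn ℝ (m + 1) f (V ×ˢ U) →
    ContDiffOn ℝ m (fun u ↦ ∫ y in K, w y • f (u, y) ∂μ) V := by
  induction m with
  | zero =>
    intro H _ _ f hf
    refine contDiffOn_zero.2 fun u hu ↦ ?_
    exact (hasFDerivAt_setIntegral hV hU hK hKU hw (by simpa using hf)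
      hu).continuousAt.continuousWithinAt
  | succ m ih =>
    intro H _ _ f hf
    have hD : ∀ u ∈ V, HasFDerivAt (fun u ↦ ∫ y in K, w y • f (u, y) ∂μ)
      (∫ y in K, w y • partialFDeriv f (u, y) ∂μ) u := fun u hu ↦
        hasFDerivAt_setIntegral hV hU hK hKU hw (hf.of_le (by simp)) hu
    push_cast
    refine (contDiffOn_succ_iff_fderiv_of_isOpen hV).2 ⟨fun u hu ↦
      (hD u hu).differentiableAt.differentiableWithinAt, by simp, ?_⟩
    exact (ih (contDiffOn_partialFDeriv hV hU hf (by push_cast; exact le_rfl))).congr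
      fun u hu ↦ (hD u hu).fderiv

lemma contDiffOn_setIntegral {H : Type} [NormedAddCommGroup H] [NormedSpace ℝ H]
    {f : E × G → H} (hV : IsOpen V) (hU : IsOpen U) (hK : IsCompact K) (hKU : K ⊆ U)
    (hw : ContinuousOn w K) (hf : ContDiffOn ℝ ∞ f (V ×ˢ U)) :
    ContDiffOn ℝ ∞ (fun u ↦ ∫ y in K, w y • f (u, y) ∂μ) V :=
  contDiffOn_infty.2 fun m ↦
    contDiffOn_setIntegral_nat hV hU hK hKU hw m (hf.of_le (mod_cast le_top))

end ParametricIntegral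

section Hadamard

open MeasureTheory Set

variable {E H : Type} [NormedAddCommGroup E] [NormedSpace ℝ E] [FiniteDimensional ℝ E]
  [NormedAddCommGroup H] [NormedSpace ℝ H] [CompleteSpace H]

/-- Hadamard's lemma. -/
lemma contDiffOn_dslope {U : Set E} (hU : IsOpen U) {f : ℝ × E → H}
    (hf : ContDiffOn ℝ ∞ f (univ ×ˢ U)) :
    ContDiffOn ℝ ∞ (fun p : ℝ × E ↦ dslope (fun t ↦ f (t, p.2)) 0 p.1) (univ ×ˢ U) := by
  have hD : ContDiffOn ℝ ∞ (fun p : ℝ × E ↦ partialFDeriv f p 1) (univ ×ˢ U) :=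
    (contDiffOn_partialFDeriv isOpen_univ hU hf (by simp)).clm_apply contDiffOn_const
  have hd : ∀ (t : ℝ), ∀ y ∈ U, HasDerivAt (fun t ↦ f (t, y)) (partialFDeriv f (t, y) 1) t := by
    intro t y hy
    exact (hasFDerivAt_partial ((hf.contDiffAt ((isOpen_univ.prod hU).mem_nhds
      ⟨mem_univ _, hy⟩)).differentiableAt (by simp))).hasDerivAt
  have hI := contDiffOn_setIntegral (μ := volume) (V := univ ×ˢ U) (U := univ) (K := Icc (0 : ℝ) 1)
    (w := fun _ ↦ 1) (f := fun q : (ℝ × E) × ℝ ↦ partialFDeriv f (q.2 * q.1.1, q.1.2) 1)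
    (isOpen_univ.prod hU) isOpen_univ isCompact_Icc (subset_univ _) continuousOn_const
    (hD.comp (f := fun q : (ℝ × E) × ℝ ↦ (q.2 * q.1.1, q.1.2)) (by fun_prop)
      fun q hq ↦ ⟨mem_univ _, hq.1.2⟩)
  refine hI.congr fun p hp ↦ ?_
  obtain ⟨t, y⟩ := p
  have hy : y ∈ U := hp.2
  simp only [one_smul]
  rw [integral_Icc_eq_integral_Ioc, ← intervalIntegral.integral_of_le zero_le_one]
  rcases eq_or_ne t 0 with rfl | ht
  · simp [(hd 0 y hy).deriv]
  · rw [dslope_of_ne _ ht, slope_def_module]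
    have hc : Continuous fun s : ℝ ↦ partialFDeriv f (s, y) 1 := by
      rw [← continuousOn_univ]
      exact hD.continuousOn.comp (by fun_prop) fun s _ ↦ ⟨mem_univ _, hy⟩
    have h := intervalIntegral.integral_eq_sub_of_hasDerivAt (a := 0) (b := t)
      (fun s _ ↦ hd s y hy) (hc.intervalIntegrable _ _)
    rw [← h, intervalIntegral.integral_comp_mul_right (fun s ↦ partialFDeriv f (s, y) 1) ht]
    simp

end Hadamard

end CompatibleACS

namespace CompatibleACS

variable {n : ℕ} {M : Type*} [TopologicalSpace M] [ChartedSpace (Model n) M]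

/-- The model space `ℝ²ⁿ`, with all its structure coming from the norm. -/
def Coord (n : ℕ) : Type := Model n

instance : NormedAddCommGroup (Coord n) := inferInstanceAs (NormedAddCommGroup (Model n))
instance : NormedSpace ℝ (Coord n) := inferInstanceAs (NormedSpace ℝ (Model n))
instance : FiniteDimensional ℝ (Coord n) := inferInstanceAs (FiniteDimensional ℝ (Model n))
instance : CompleteSpace (Coord n) := FiniteDimensional.complete ℝ _

/-- Endomorphisms of the model space. -/
abbrev EndModel (n : ℕ) : Type := Coord n →L[ℝ] Coord n

/-- The value at `x` of a field of endomorphisms, as an endomorphism of the model space. -/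
def ev (x : M) : EndField n M →ₗ[ℝ] EndModel n where
  toFun A := A x
  map_add' _ _ := rfl
  map_smul' _ _ := rfl

lemma ev_mul (x : M) (A B : EndField n M) : ev x (A * B) = ev x A * ev x B := rfl

lemma ev_one (x : M) : ev x (1 : EndField n M) = 1 := rfl

/-- A field of endomorphisms with given values. -/
def ofEv (f : M → EndModel n) : EndField n M := fun x ↦ f x

lemma ev_ofEv (f : M → EndModel n) (x : M) : ev x (ofEv f) = f x := rfl

lemma ext_ev {A B : EndField n M} (h : ∀ x, ev x A = ev x B) : A = B := funext h

/-- The derivative of a curve of fields of endomorphisms. -/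
def velocity (P : ℝ → EndField n M) (t : ℝ) : EndField n M :=
  ofEv fun x ↦ deriv (fun s ↦ ev x (P s)) t

lemma ev_velocity (P : ℝ → EndField n M) (t : ℝ) (x : M) :
    ev x (velocity P t) = deriv (fun s ↦ ev x (P s)) t := rfl

lemma velocity_eq {P : ℝ → EndField n M} {A : EndField n M} {t : ℝ}
    (h : ∀ x, HasDerivAt (fun s ↦ ev x (P s)) (ev x A) t) : velocity P t = A :=
  ext_ev fun x ↦ (h x).deriv

variable [IsManifold 𝓘(ℝ, Model n) ∞ M]

/-- The coordinates on `T_z M` given by the chart at `c`. -/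
def toCoord (c z : M) : EndModel n :=
  ((trivializationAt (Model n) (TangentSpace 𝓘(ℝ, Model n)) c).continuousLinearMapAt ℝ z :
    Tan n z →L[ℝ] Model n)

/-- The inverse of `toCoord`. -/
def ofCoord (c z : M) : EndModel n :=
  ((trivializationAt (Model n) (TangentSpace 𝓘(ℝ, Model n)) c).symmL ℝ z :
    Model n →L[ℝ] Tan n z)

lemma toCoord_mul_ofCoord {c z : M} (hz : z ∈ (chartAt (Model n) c).source) :
    toCoord c z * ofCoord c z = (1 : EndModel n) := by
  ext1 v
  exact (trivializationAt (Model n) (TangentSpace 𝓘(ℝ, Model n)) c).continuousLinearMapAt_symmL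
    (R := ℝ) hz v

lemma ofCoord_mul_toCoord {c z : M} (hz : z ∈ (chartAt (Model n) c).source) :
    ofCoord c z * toCoord c z = (1 : EndModel n) := by
  ext1 v
  exact (trivializationAt (Model n) (TangentSpace 𝓘(ℝ, Model n)) c).symmL_continuousLinearMapAt
    (R := ℝ) hz v

/-- The field `A` at the point with coordinates `y` in the chart at `c`. -/
def loc (c : M) (y : Model n) : EndField n M →ₗ[ℝ] EndModel n where
  toFun A := toCoord c ((chartAt (Model n) c).symm y) * (ev ((chartAt (Model n) c).symm y) A *
    ofCoord c ((chartAt (Model n) c).symm y))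
  map_add' A B := by simp [add_mul, mul_add]
  map_smul' r A := by simp

lemma loc_apply (c : M) (y : Model n) (A : EndField n M) :
    loc c y A = toCoord c ((chartAt (Model n) c).symm y) * (ev ((chartAt (Model n) c).symm y) A *
      ofCoord c ((chartAt (Model n) c).symm y)) := rfl

lemma loc_mul {c : M} {y : Model n} (hy : y ∈ (chartAt (Model n) c).target) (A B : EndField n M) :
    loc c y (A * B) = loc c y A * loc c y B := by
  have h := ofCoord_mul_toCoord ((chartAt (Model n) c).map_target hy)
  simp only [loc_apply, ev_mul]
  simp only [mul_assoc]
  rw [← mul_assoc (ofCoord _ _) (toCoord _ _), h, one_mul]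

lemma loc_one {c : M} {y : Model n} (hy : y ∈ (chartAt (Model n) c).target) :
    loc c y (1 : EndField n M) = 1 := by
  have h := toCoord_mul_ofCoord ((chartAt (Model n) c).map_target hy)
  rw [loc_apply, ev_one, one_mul, h]

/-- `loc` with values in endomorphisms of `Model n`. -/
def locModel (c : M) (y : Model n) (A : EndField n M) : Model n →L[ℝ] Model n := loc c y A

lemma inCoordinates_eq_loc (c z : M) (hz : z ∈ (chartAt (Model n) c).source) (A : EndField n M) :
    ContinuousLinearMap.inCoordinates (Model n) (TangentSpace 𝓘(ℝ, Model n)) (Model n)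
      (TangentSpace 𝓘(ℝ, Model n)) c z c z (A z) = locModel c (chartAt (Model n) c z) A := by
  rw [locModel, loc_apply, (chartAt (Model n) c).left_inv hz]
  rfl

lemma isSmoothFamily_iff_locModel {F : Type*} [NormedAddCommGroup F] [NormedSpace ℝ F]
    {P : F → EndField n M} : IsSmoothFamily P ↔ ∀ c : M, ContDiffOn ℝ ∞
      (fun p : F × Model n ↦ locModel c p.2 (P p.1)) (Set.univ ×ˢ (chartAt (Model n) c).target) := by
  constructor
  · intro h c
    have h1 : ContMDiffOn (𝓘(ℝ, F).prod 𝓘(ℝ, Model n)) 𝓘(ℝ, Model n →L[ℝ] Model n) ∞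
        (fun p : F × M ↦ locModel c (chartAt (Model n) c p.2) (P p.1))
        (Set.univ ×ˢ (chartAt (Model n) c).source) := by
      have h2 := ContMDiff.contMDiffOn (s := Set.univ ×ˢ (chartAt (Model n) c).source) h
      have h3 := ((trivializationAt (Model n →L[ℝ] Model n)
        (fun x : M ↦ (Tan n x →L[ℝ] Tan n x)) c).contMDiffOn_iff ?_).1 h2
      · refine h3.2.congr fun p hp ↦ ?_
        rw [hom_trivializationAt_apply]
        exact (inCoordinates_eq_loc c p.2 hp.2 (P p.1)).symm
      · intro p hp
        rw [hom_trivializationAt_source]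
        exact ⟨hp.2, hp.2⟩
    have h2 : ContMDiffOn 𝓘(ℝ, F × Model n) (𝓘(ℝ, F).prod 𝓘(ℝ, Model n)) ∞
        (fun p : F × Model n ↦ (p.1, (chartAt (Model n) c).symm p.2))
        (Set.univ ×ˢ (chartAt (Model n) c).target) := by
      rw [modelWithCornersSelf_prod, ← chartedSpaceSelf_prod]
      exact contMDiffOn_fst.prodMk ((contMDiffOn_chart_symm (x := c)).comp contMDiffOn_snd
        fun p hp ↦ hp.2)
    have h3 := h1.comp h2 fun p hp ↦ ⟨hp.1, (chartAt (Model n) c).map_target hp.2⟩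
    refine (contMDiffOn_iff_contDiffOn.1 h3).congr fun p hp ↦ ?_
    simp only [Function.comp]
    rw [(chartAt (Model n) c).right_inv hp.2]
  · intro h p
    refine (contMDiffAt_hom_bundle _).2 ⟨contMDiffAt_snd, ?_⟩
    have h1 := contMDiffOn_iff_contDiffOn.2 (h p.2)
    have h2 : ContMDiffOn (𝓘(ℝ, F).prod 𝓘(ℝ, Model n)) 𝓘(ℝ, F × Model n) ∞
        (fun q : F × M ↦ (q.1, chartAt (Model n) p.2 q.2))
        (Set.univ ×ˢ (chartAt (Model n) p.2).source) := by
      rw [modelWithCornersSelf_prod, ← chartedSpaceSelf_prod]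
      exact contMDiffOn_fst.prodMk ((contMDiffOn_chart (x := p.2)).comp contMDiffOn_snd
        fun q hq ↦ hq.2)
    have h3 := h1.comp h2 fun q hq ↦ ⟨hq.1, (chartAt (Model n) p.2).map_source hq.2⟩
    have hn : (Set.univ ×ˢ (chartAt (Model n) p.2).source : Set (F × M)) ∈ nhds p :=
      (isOpen_univ.prod (chartAt (Model n) p.2).open_source).mem_nhds
        ⟨Set.mem_univ _, mem_chart_source _ _⟩
    refine (h3.contMDiffAt hn).congr_of_eventuallyEq ?_
    filter_upwards [hn] with q hq
    exact inCoordinates_eq_loc p.2 q.2 hq.2 (P q.1)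

lemma isSmoothFamily_iff {F : Type*} [NormedAddCommGroup F] [NormedSpace ℝ F]
    {P : F → EndField n M} : IsSmoothFamily P ↔ ∀ c : M, ContDiffOn ℝ ∞
      (fun p : F × Model n ↦ loc c p.2 (P p.1)) (Set.univ ×ˢ (chartAt (Model n) c).target) :=
  isSmoothFamily_iff_locModel

section families

variable {F F' : Type*} [NormedAddCommGroup F] [NormedSpace ℝ F] [NormedAddCommGroup F']
  [NormedSpace ℝ F'] {P Q : F → EndField n M}

lemma ev_eq_loc (x : M) (A : EndField n M) :
    ev x A = ofCoord x x * loc x (chartAt (Model n) x x) A * toCoord x x := by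
  have h := ofCoord_mul_toCoord (mem_chart_source (Model n) x)
  rw [loc_apply, (chartAt (Model n) x).left_inv (mem_chart_source (Model n) x), ← mul_assoc, h,
    one_mul, mul_assoc, h, mul_one]

lemma IsSmoothFamily.contDiff_ev (hP : IsSmoothFamily P) (x : M) :
    ContDiff ℝ ∞ (fun u ↦ ev x (P u)) := by
  simp only [ev_eq_loc x]
  refine (contDiff_const.mul ?_).mul contDiff_const
  rw [← contDiffOn_univ]
  exact (isSmoothFamily_iff.1 hP x).comp (f := fun u ↦ (u, chartAt (Model n) x x)) (by fun_prop)
    fun u _ ↦ ⟨Set.mem_univ _, mem_chart_target (Model n) x⟩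

lemma IsSmoothFamily.comp (hP : IsSmoothFamily P) {φ : F' → F} (hφ : ContDiff ℝ ∞ φ) :
    IsSmoothFamily (fun u ↦ P (φ u)) :=
  isSmoothFamily_iff.2 fun c ↦ (isSmoothFamily_iff.1 hP c).comp
    (f := fun q : F' × Model n ↦ (φ q.1, q.2)) (by fun_prop) fun q hq ↦ ⟨Set.mem_univ _, hq.2⟩

lemma isSmoothFamily_const {A : EndField n M} (hA : IsSmoothField A) :
    IsSmoothFamily (fun _ : F ↦ A) :=
  ContMDiff.comp (g := fun x : M ↦ TotalSpace.mk' (Model n →L[ℝ] Model n)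
      (E := fun x : M ↦ (Tan n x →L[ℝ] Tan n x)) x (A x)) hA contMDiff_snd

lemma IsSmoothFamily.isSmoothField (hP : IsSmoothFamily P) (u : F) : IsSmoothField (P u) :=
  ContMDiff.comp (g := fun p : F × M ↦ TotalSpace.mk' (Model n →L[ℝ] Model n)
      (E := fun x : M ↦ (Tan n x →L[ℝ] Tan n x)) p.2 (P p.1 p.2)) hP
    (contMDiff_const.prodMk contMDiff_id)

lemma IsSmoothFamily.add (hP : IsSmoothFamily P) (hQ : IsSmoothFamily Q) :
    IsSmoothFamily (fun u ↦ P u + Q u) := SmoothAlong.add hP hQ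

lemma IsSmoothFamily.mul (hP : IsSmoothFamily P) (hQ : IsSmoothFamily Q) :
    IsSmoothFamily (fun u ↦ P u * Q u) := SmoothAlong.mul hP hQ

lemma IsSmoothFamily.smul (hP : IsSmoothFamily P) {f : F → ℝ} (hf : ContDiff ℝ ∞ f) :
    IsSmoothFamily (fun u ↦ f u • P u) :=
  SmoothAlong.smul (f := fun p : F × M ↦ f p.1) hP (hf.contMDiff.comp contMDiff_fst)

lemma IsSmoothFamily.const_smul (hP : IsSmoothFamily P) (r : ℝ) :
    IsSmoothFamily (fun u ↦ r • P u) := hP.smul contDiff_const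

lemma IsSmoothFamily.neg (hP : IsSmoothFamily P) : IsSmoothFamily (fun u ↦ - P u) := by
  simpa using hP.const_smul (-1)

lemma IsSmoothFamily.sub (hP : IsSmoothFamily P) (hQ : IsSmoothFamily Q) :
    IsSmoothFamily (fun u ↦ P u - Q u) := by
  simpa [sub_eq_add_neg] using hP.add hQ.neg

lemma isSmoothFamily_one : IsSmoothFamily (fun _ : F ↦ (1 : EndField n M)) := by
  refine isSmoothFamily_iff.2 fun c ↦ ContDiffOn.congr (f := fun _ ↦ (1 : EndModel n))
    contDiffOn_const fun p hp ↦ loc_one hp.2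

lemma IsSmoothFamily.inverse (hP : IsSmoothFamily P) (h1 : ∀ u, P u * Q u = 1)
    (h2 : ∀ u, Q u * P u = 1) : IsSmoothFamily Q := by
  refine isSmoothFamily_iff.2 fun c ↦ ?_
  have key : ∀ p ∈ (Set.univ ×ˢ (chartAt (Model n) c).target : Set (F × Model n)),
      ∃ a : (EndModel n)ˣ, a = loc c p.2 (P p.1) ∧ ↑a⁻¹ = loc c p.2 (Q p.1) := fun p hp ↦
    ⟨⟨loc c p.2 (P p.1), loc c p.2 (Q p.1), by rw [← loc_mul hp.2, h1, loc_one hp.2],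
      by rw [← loc_mul hp.2, h2, loc_one hp.2]⟩, rfl, rfl⟩
  refine ContDiffOn.congr (f := fun p ↦ Ring.inverse (loc c p.2 (P p.1))) (fun p hp ↦ ?_)
    fun p hp ↦ ?_
  · obtain ⟨a, ha, -⟩ := key p hp
    have h := contDiffAt_ringInverse ℝ (n := ∞) a
    rw [ha] at h
    exact h.comp_contDiffWithinAt (g := Ring.inverse) p (isSmoothFamily_iff.1 hP c p hp)
  · obtain ⟨a, ha, ha'⟩ := key p hp
    rw [← ha, ← ha', Ring.inverse_unit]

variable {A B : EndField n M}

lemma IsSmoothField.add (hA : IsSmoothField A) (hB : IsSmoothField B) : IsSmoothField (A + B) :=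
  SmoothAlong.add hA hB

lemma IsSmoothField.mul (hA : IsSmoothField A) (hB : IsSmoothField B) : IsSmoothField (A * B) :=
  SmoothAlong.mul hA hB

lemma IsSmoothField.sub (hA : IsSmoothField A) (hB : IsSmoothField B) : IsSmoothField (A - B) :=
  ((isSmoothFamily_const (F := ℝ) hA).sub (isSmoothFamily_const hB)).isSmoothField 0

lemma IsSmoothField.const_smul (hA : IsSmoothField A) (r : ℝ) : IsSmoothField (r • A) :=
  ((isSmoothFamily_const (F := ℝ) hA).const_smul r).isSmoothField 0

lemma isSmoothField_one : IsSmoothField (1 : EndField n M) :=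
  (isSmoothFamily_one (F := ℝ)).isSmoothField 0

end families

section derivative

variable {F : Type} [NormedAddCommGroup F] [NormedSpace ℝ F]

lemma IsSmoothFamily.hasDerivAt {P : ℝ → EndField n M} (hP : IsSmoothFamily P) (t : ℝ) (x : M) :
    HasDerivAt (fun s ↦ ev x (P s)) (ev x (velocity P t)) t :=
  ((hP.contDiff_ev x).differentiable (by simp) t).hasDerivAt

/-- Conjugation to the coordinates at `z` given by the chart at `c`. -/
def conjCoord (c z : M) : EndModel n →L[ℝ] EndModel n :=
  (ContinuousLinearMap.mul ℝ (EndModel n) (toCoord c z)).comp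
    ((ContinuousLinearMap.mul ℝ (EndModel n)).flip (ofCoord c z))

lemma loc_eq_conjCoord (c : M) (y : Model n) (A : EndField n M) :
    loc c y A = conjCoord c ((chartAt (Model n) c).symm y) (ev ((chartAt (Model n) c).symm y) A) :=
  rfl

lemma IsSmoothFamily.velocity_prod {P : ℝ × F → EndField n M} (hP : IsSmoothFamily P) :
    IsSmoothFamily (fun u : F ↦ velocity (fun s ↦ P (s, u)) 0) := by
  refine isSmoothFamily_iff.2 fun c ↦ ?_
  have hO := (chartAt (Model n) c).open_target
  have h := isSmoothFamily_iff.1 hP c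
  have hd := h.fderiv_of_isOpen (m := ∞) (isOpen_univ.prod hO) (by simp)
  have h1 : ContDiffOn ℝ ∞ (fun q : F × Model n ↦
      fderiv ℝ (fun p : (ℝ × F) × Model n ↦ loc c p.2 (P p.1)) ((0, q.1), q.2) ((1, 0), 0))
      (Set.univ ×ˢ (chartAt (Model n) c).target) :=
    (hd.comp (f := fun q : F × Model n ↦ (((0 : ℝ), q.1), q.2)) (by fun_prop)
      fun q hq ↦ ⟨Set.mem_univ _, hq.2⟩).clm_apply contDiffOn_const
  refine h1.congr fun q hq ↦ ?_
  have h2 : HasDerivAt (fun s : ℝ ↦ loc c q.2 (P (s, q.1)))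
      (fderiv ℝ (fun p : (ℝ × F) × Model n ↦ loc c p.2 (P p.1)) ((0, q.1), q.2) ((1, 0), 0)) 0 := by
    have h3 : HasDerivAt (fun s : ℝ ↦ ((s, q.1), q.2)) (((1 : ℝ), (0 : F)), (0 : Model n)) 0 :=
      ((hasDerivAt_id _).prodMk (hasDerivAt_const _ _)).prodMk (hasDerivAt_const _ _)
    exact (((h.contDiffAt ((isOpen_univ.prod hO).mem_nhds
      ⟨Set.mem_univ ((0 : ℝ), q.1), hq.2⟩)).differentiableAt
        (by simp)).hasFDerivAt).comp_hasDerivAt (0 : ℝ) h3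
  have h4 : IsSmoothFamily fun s : ℝ ↦ P (s, q.1) :=
    hP.comp (φ := fun s : ℝ ↦ (s, q.1)) (by fun_prop)
  refine HasDerivAt.unique ?_ h2
  simp only [loc_eq_conjCoord]
  exact (conjCoord _ _).hasFDerivAt.comp_hasDerivAt _ (h4.hasDerivAt 0 _)

/-- Hadamard's lemma for curves of fields of endomorphisms. -/
lemma IsSmoothFamily.exists_eq_smul {P : ℝ → EndField n M} (hP : IsSmoothFamily P)
    (h0 : P 0 = 0) : ∃ R : ℝ → EndField n M, IsSmoothFamily R ∧ (∀ t, P t = t • R t) ∧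
      R 0 = velocity P 0 := by
  refine ⟨fun t ↦ ofEv fun x ↦ dslope (fun s ↦ ev x (P s)) 0 t, isSmoothFamily_iff.2 fun c ↦ ?_,
    fun t ↦ ext_ev fun x ↦ ?_, ext_ev fun x ↦ ?_⟩
  · refine (contDiffOn_dslope (chartAt (Model n) c).open_target (isSmoothFamily_iff.1 hP c)).congr
      fun p hp ↦ ?_
    simp only [loc_eq_conjCoord, ev_ofEv]
    rcases eq_or_ne p.1 0 with h | h
    · rw [h, dslope_same, dslope_same]
      exact (((conjCoord _ _).hasFDerivAt.comp_hasDerivAt _ (hP.hasDerivAt 0 _)).deriv).symm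
    · simp [dslope_of_ne _ h, slope_def_module]
  · rw [map_smul, ev_ofEv]
    have h := sub_smul_dslope (fun s ↦ ev x (P s)) 0 t
    simp only [sub_zero, h0, map_zero] at h
    exact h.symm
  · rw [ev_ofEv, dslope_same, ev_velocity]

end derivative

end CompatibleACS

namespace CompatibleACS

section ring

variable {R : Type*} [Ring R] {x y p q j c b : R}

lemma mul_one_add_comm (hxy : x * y = y * x) : x * (1 + y * y) = (1 + y * y) * x :=
  ((Commute.one_right x).add_right (Commute.mul_right hxy hxy)).eq

lemma one_add_mul_comm (hxy : x * y = y * x) :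
    (1 + x * x) * (x * (1 + y * y)) = x * (1 + y * y) * (1 + x * x) := by
  have h1 : Commute (x * (1 + y * y)) x :=
    (Commute.refl x).mul_left (mul_one_add_comm hxy).symm
  exact ((Commute.one_right _).add_right (h1.mul_right h1)).eq.symm

lemma one_add_mul_of_anticomm (h : x * j = -(j * x)) : (1 + x * x) * j = j * (1 + x * x) := by
  rw [add_mul, mul_assoc, h, mul_neg, ← mul_assoc, h]
  noncomm_ring

lemma mul_one_add_mul_of_anticomm (h : x * j = -(j * x)) (h' : y * j = -(j * y)) :
    x * (1 + y * y) * j = -(j * (x * (1 + y * y))) := by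
  rw [mul_assoc, one_add_mul_of_anticomm h', ← mul_assoc, h]
  noncomm_ring

lemma add_mul_sub_comm (h : p * q = q * p) : (p + q) * (p - q) = (p - q) * (p + q) := by
  simp only [mul_sub, add_mul, sub_mul, mul_add, h]
  abel

lemma cayleyInv_mul_aux (hj : j * j = -1) (hc : c * c = -1) (h1 : (j + c) * b = 1)
    (h2 : b * (j + c) = 1) : b * (j - c) * j = -(j * (b * (j - c))) := by
  have e1 : c * (j + c) = (j + c) * j := by rw [mul_add, add_mul, hc, hj, add_comm]
  have e2 : (j - c) * j = -(c * (j - c)) := by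
    rw [mul_sub, sub_mul, hc, hj]
    abel
  have e3 : b * c = j * b := by
    calc b * c = b * (c * (j + c)) * b := by rw [mul_assoc, mul_assoc, h1, mul_one]
      _ = j * b := by rw [e1, ← mul_assoc, h2, one_mul]
  rw [mul_assoc, e2, mul_neg, ← mul_assoc, e3, mul_assoc]

lemma conj_mul_cancel (h : b * p = 1) : p * j * b * p = p * j := by rw [mul_assoc, h, mul_one]

lemma conj_mul_self (hj : j * j = -1) (h : p * b = 1) (h' : b * p = 1) :
    p * j * b * (p * j * b) = -1 := by
  rw [← mul_assoc, ← mul_assoc, conj_mul_cancel h', mul_assoc p, hj, mul_neg_one, neg_mul, h]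

lemma eq_mul_of_mul_eq (h : p * b = 1) (hc : c * p = q) : c = q * b := by
  rw [← hc, mul_assoc, h, mul_one]

lemma add_mul_eq_mul_sub (hp : p * j = j * p) (hq : q * j = -(j * q)) :
    (p + q) * j = j * (p - q) := by
  rw [add_mul, hp, hq, mul_sub, sub_eq_add_neg]

lemma mul_mul_cancel_left (h : j * b = 1) : j * (b * c) = c := by rw [← mul_assoc, h, one_mul]

lemma mul_one_add_eq (h : (j + c) * x = j - c) : c * (1 + x) = j * (1 - x) := by
  rw [add_mul] at h
  rw [mul_add, mul_sub, mul_one, mul_one, eq_sub_of_add_eq' h]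
  abel

lemma add_mul_one_add_eq (h : (j + c) * x = j - c) : (j + c) * (1 + x) = j + j := by
  rw [mul_add, h, mul_one]
  abel

lemma neg_adj_aux (h : x * (1 + y * y) = (1 + y * y) * x) :
    (1 + y * y) * -x = -(x * (1 + y * y)) := by rw [mul_neg, h]

end ring

variable {n : ℕ} {M : Type*} [TopologicalSpace M] [ChartedSpace (Model n) M]

lemma exists_inverse {A : EndField n M} (h : ∀ x v, A x v = 0 → v = 0) :
    ∃ B : EndField n M, A * B = 1 ∧ B * A = 1 := by
  have key : ∀ x, ∃ b : EndModel n, ev x A * b = 1 ∧ b * ev x A = 1 := fun x ↦ by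
    have hinj : Function.Injective (ev x A : EndModel n).toLinearMap :=
      (injective_iff_map_eq_zero _).2 (h x)
    have hbij : Function.Bijective (ev x A : EndModel n) :=
      ⟨hinj, LinearMap.injective_iff_surjective.1 hinj⟩
    obtain ⟨a, ha⟩ := ContinuousLinearMap.isUnit_iff_bijective.2 hbij
    exact ⟨↑a⁻¹, by rw [← ha, a.mul_inv], by rw [← ha, a.inv_mul]⟩
  choose b hb1 hb2 using key
  exact ⟨ofEv b, ext_ev hb1, ext_ev hb2⟩

variable [IsManifold 𝓘(ℝ, Model n) ∞ M] {Ω : SymplecticForm n M}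

section adjoint

variable (Ω) in
/-- `B` is the adjoint of `A` with respect to `Ω`. -/
def IsAdj (A B : EndField n M) : Prop :=
  ∀ x v w, Ω.form x (A x v) w = Ω.form x v (B x w)

variable {A A' B B' : EndField n M}

lemma IsAdj.mul (h : IsAdj Ω A A') (h' : IsAdj Ω B B') : IsAdj Ω (A * B) (B' * A') :=
  fun x v w ↦ (h x (B x v) w).trans (h' x v (A' x w))

lemma IsAdj.add (h : IsAdj Ω A A') (h' : IsAdj Ω B B') : IsAdj Ω (A + B) (A' + B') :=
  fun x v w ↦ by
    have h1 := h x v w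
    have h2 := h' x v w
    simp only [Pi.add_apply, _root_.add_apply, map_add, h1, h2]

lemma IsAdj.smul (h : IsAdj Ω A A') (r : ℝ) : IsAdj Ω (r • A) (r • A') :=
  fun x v w ↦ by
    have h1 := h x v w
    simp only [Pi.smul_apply, _root_.smul_apply, map_smul, h1]

lemma IsAdj.neg (h : IsAdj Ω A A') : IsAdj Ω (-A) (-A') := by simpa using h.smul (-1)

lemma IsAdj.sub (h : IsAdj Ω A A') (h' : IsAdj Ω B B') : IsAdj Ω (A - B) (A' - B') := by
  simpa [sub_eq_add_neg] using h.add h'.neg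

variable (Ω) in
lemma isAdj_one : IsAdj Ω (1 : EndField n M) 1 := fun _ _ _ ↦ rfl

lemma SymplecticForm.skew (Ω : SymplecticForm n M) (x : M) (v w : Tan n x) :
    Ω.form x v w = - Ω.form x w v := by
  have h := Ω.alternating x (v + w)
  simp only [map_add, _root_.add_apply, Ω.alternating, zero_add, add_zero] at h
  linarith

lemma ACS.mul_self (J : ACS Ω) : J.1 * J.1 = -1 := J.2.2.1

lemma ACS.mul_mul (J : ACS Ω) (A : EndField n M) : J.1 * (J.1 * A) = -A := by
   rw [← mul_assoc, J.mul_self, neg_one_mul]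

lemma ACS.apply_apply (J : ACS Ω) (x : M) (v : Tan n x) : J.1 x (J.1 x v) = -v :=
  congrArg (fun B : EndField n M ↦ B x v) J.mul_self

lemma ACS.isAdj (J : ACS Ω) : IsAdj Ω J.1 (-J.1) := fun x v w ↦ by
  have h := J.2.2.2.1 x v (J.1 x w)
  rw [J.apply_apply] at h
  simp only [Pi.neg_apply, _root_.neg_apply, map_neg] at h ⊢
  linarith

lemma mem_tangentAt_iff {J : ACS Ω} {A : EndField n M} :
    A ∈ tangentAt J ↔ IsSmoothField A ∧ A * J.1 = -(J.1 * A) ∧ IsAdj Ω A (-A) := by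
  have key : A * J.1 + J.1 * A = 0 → ∀ x v w, Ω.form x (J.1 x v) (A x (J.1 x w)) =
      - Ω.form x v (A x w) := fun h x v w ↦ by
    have h1 : A x (J.1 x w) = - J.1 x (A x w) :=
      congrArg (fun B : EndField n M ↦ B x w) (eq_neg_of_add_eq_zero_left h)
    rw [h1, map_neg, J.2.2.2.1 x]
  constructor
  · rintro ⟨h0, h1, h2⟩
    refine ⟨h0, eq_neg_of_add_eq_zero_left h1, fun x v w ↦ ?_⟩
    have h3 := h2 x v (J.1 x w)
    have h4 := key h1 x v w
    rw [J.apply_apply] at h3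
    simp only [Pi.neg_apply, _root_.neg_apply, map_neg] at h3 ⊢
    linarith
  · rintro ⟨h0, h1, h2⟩
    have h1' : A * J.1 + J.1 * A = 0 := by rw [h1, neg_add_cancel]
    refine ⟨h0, h1', fun x v w ↦ ?_⟩
    have h4 := key h1' x v (J.1 x w)
    have h5 := h2 x v (J.1 x w)
    rw [J.apply_apply] at h4
    simp only [Pi.neg_apply, _root_.neg_apply, map_neg] at h4 h5 ⊢
    linarith

end adjoint

section inner

/-- The metric `Ω(-, J-)` on `T_x M`. -/
def inn (J : ACS Ω) (x : M) (v w : Tan n x) : ℝ := Ω.form x v (J.1 x w)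

variable (J : ACS Ω) (x : M)

lemma inn_comm (v w : Tan n x) : inn J x v w = inn J x w v := by
  have h := J.isAdj x w v
  have h' := Ω.skew x v (J.1 x w)
  simp only [Pi.neg_apply, _root_.neg_apply, map_neg] at h
  simp only [inn]
  linarith

lemma inn_add_left (u v w : Tan n x) : inn J x (u + v) w = inn J x u w + inn J x v w := by
  simp [inn]

lemma inn_add_right (u v w : Tan n x) : inn J x u (v + w) = inn J x u v + inn J x u w := by
  simp [inn]

lemma inn_sub_left (u v w : Tan n x) : inn J x (u - v) w = inn J x u w - inn J x v w := by
  simp [inn]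

lemma inn_sub_right (u v w : Tan n x) : inn J x u (v - w) = inn J x u v - inn J x u w := by
  simp [inn]

lemma inn_self_pos {v : Tan n x} (hv : v ≠ 0) : 0 < inn J x v v := J.2.2.2.2 x v hv

lemma inn_zero_left (v : Tan n x) : inn J x 0 v = 0 := by simp [inn]

lemma inn_self_nonneg (v : Tan n x) : 0 ≤ inn J x v v := by
  rcases eq_or_ne v 0 with rfl | hv
  · rw [inn_zero_left]
  · exact (inn_self_pos J x hv).le

variable {J} in
lemma inn_apply_left {A : EndField n M} (h : A * J.1 = -(J.1 * A)) (h' : IsAdj Ω A (-A))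
    (v w : Tan n x) : inn J x (A x v) w = inn J x v (A x w) := by
  have h1 : A x (J.1 x w) = - J.1 x (A x w) := congrArg (fun B : EndField n M ↦ B x w) h
  have h2 := h' x v (J.1 x w)
  simp only [Pi.neg_apply, _root_.neg_apply, h1, neg_neg] at h2
  exact h2

end inner

section inverse

lemma IsSmoothField.inverse {A B : EndField n M} (hA : IsSmoothField A) (h1 : A * B = 1)
    (h2 : B * A = 1) : IsSmoothField B :=
  ((isSmoothFamily_const (F := ℝ) hA).inverse (Q := fun _ ↦ B) (fun _ ↦ h1)
    fun _ ↦ h2).isSmoothField 0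

end inverse

section cayley

/-- The conditions under which `(p + q) J (p + q)⁻¹` is a compatible almost complex structure. -/
structure CayleyData (J : ACS Ω) (p q : EndField n M) : Prop where
  smooth_p : IsSmoothField p
  smooth_q : IsSmoothField q
  comm : p * q = q * p
  p_mul : p * J.1 = J.1 * p
  q_mul : q * J.1 = -(J.1 * q)
  adj_p : IsAdj Ω p p
  adj_q : IsAdj Ω q (-q)
  lt : ∀ x v, v ≠ 0 → inn J x (q x v) (q x v) < inn J x (p x v) (p x v)

variable {J : ACS Ω} {p q : EndField n M}

lemma CayleyData.exists_inverse (h : CayleyData J p q) :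
    ∃ B : EndField n M, (p + q) * B = 1 ∧ B * (p + q) = 1 := by
  refine CompatibleACS.exists_inverse fun x v hv ↦ ?_
  by_contra hne
  have h1 : p x v + q x v = 0 := hv
  have h2 := h.lt x v hne
  have h3 := inn_sub_left J x (p x v) (-q x v) (p x v)
  have h4 := inn_sub_right J x (-q x v) (p x v) (-q x v)
  rw [eq_neg_of_add_eq_zero_left h1] at h2
  simp [inn] at h2

lemma CayleyData.exists_acs (h : CayleyData J p q) :
    ∃ c : ACS Ω, c.1 * (p + q) = (p + q) * J.1 := by
  obtain ⟨B, h1, h2⟩ := h.exists_inverse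
  have hN : IsSmoothField (p + q) := h.smooth_p.add h.smooth_q
  have hNJ : (p + q) * J.1 = J.1 * (p - q) := add_mul_eq_mul_sub h.p_mul h.q_mul
  have hc : ((p + q) * J.1 * B) * (p + q) = (p + q) * J.1 :=
    conj_mul_cancel h2
  have hB : ∀ x (v : Tan n x), (p + q) x (B x v) = v := fun x v ↦
    congrArg (fun C : EndField n M ↦ C x v) h1
  have hcN : ∀ x v, ((p + q) * J.1 * B) x ((p + q) x v) = J.1 x ((p - q) x v) := fun x v ↦
    congrArg (fun C : EndField n M ↦ C x v) (hc.trans hNJ)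
  have adjN : IsAdj Ω (p + q) (p - q) := by simpa [sub_eq_add_neg] using h.adj_p.add h.adj_q
  have adjM : IsAdj Ω (p - q) (p + q) := by simpa [sub_eq_add_neg] using h.adj_p.sub h.adj_q
  have hMN : (p + q) * (p - q) = (p - q) * (p + q) := add_mul_sub_comm h.comm
  refine ⟨⟨(p + q) * J.1 * B, ?_, ?_, ?_, ?_⟩, hc⟩
  · exact (hN.mul J.2.1).mul (IsSmoothField.inverse hN h1 h2)
  · exact conj_mul_self J.mul_self h1 h2
  · intro x v w
    rw [← hB x v, ← hB x w, hcN, hcN, J.2.2.2.1, adjN x, adjM x]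
    exact congrArg (fun C : EndField n M ↦ Ω.form x (B x v) (C x (B x w))) hMN
  · intro x v hv
    have hne : B x v ≠ 0 := fun h0 ↦ hv (by rw [← hB x v, h0, map_zero])
    rw [← hB x v, hcN]
    change 0 < inn J x (p x (B x v) + q x (B x v)) (p x (B x v) - q x (B x v))
    have h3 := h.lt x _ hne
    rw [inn_sub_right, inn_add_left, inn_add_left, inn_comm J x (q x (B x v)) (p x (B x v))]
    linarith

open Classical in
/-- The compatible almost complex structure `(p + q) J (p + q)⁻¹`. -/
def cayley (J : ACS Ω) (p q : EndField n M) : ACS Ω :=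
  if h : CayleyData J p q then h.exists_acs.choose else J

lemma cayley_mul (h : CayleyData J p q) : (cayley J p q).1 * (p + q) = (p + q) * J.1 := by
  rw [cayley, dif_pos h]
  exact h.exists_acs.choose_spec

lemma cayley_eq (h : CayleyData J p q) {c : ACS Ω} (hc : c.1 * (p + q) = (p + q) * J.1) :
    cayley J p q = c := by
  obtain ⟨B, h1, -⟩ := h.exists_inverse
  exact Subtype.ext ((eq_mul_of_mul_eq h1 (cayley_mul h)).trans (eq_mul_of_mul_eq h1 hc).symm)

lemma isSmoothFamily_cayley {F : Type*} [NormedAddCommGroup F] [NormedSpace ℝ F]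
    {J : F → ACS Ω} {p q : F → EndField n M} (h : ∀ u, CayleyData (J u) (p u) (q u))
    (hJ : IsSmoothFamily fun u ↦ (J u).1) (hp : IsSmoothFamily p) (hq : IsSmoothFamily q) :
    IsSmoothFamily fun u ↦ (cayley (J u) (p u) (q u)).1 := by
  choose B h1 h2 using fun u ↦ (h u).exists_inverse
  have hB := (hp.add hq).inverse h1 h2
  convert ((hp.add hq).mul hJ).mul hB using 2 with u
  exact eq_mul_of_mul_eq (h1 u) (cayley_mul (h u))

lemma cayleyData_of_commute {x y : EndField n M} (hx : x ∈ tangentAt J) (hy : y ∈ tangentAt J)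
    (hxy : x * y = y * x) (hlt : ∀ m v, v ≠ 0 → inn J m (y m v) (y m v) < inn J m v v) :
    CayleyData J (1 + x * x) (x * (1 + y * y)) := by
  obtain ⟨x0, x1, x2⟩ := mem_tangentAt_iff.1 hx
  obtain ⟨y0, y1, y2⟩ := mem_tangentAt_iff.1 hy
  have hcomm : x * (1 + y * y) = (1 + y * y) * x := mul_one_add_comm hxy
  refine ⟨isSmoothField_one.add (x0.mul x0), x0.mul (isSmoothField_one.add (y0.mul y0)),
    one_add_mul_comm hxy, one_add_mul_of_anticomm x1, mul_one_add_mul_of_anticomm x1 y1, ?_, ?_, ?_⟩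
  · simpa using (isAdj_one Ω).add (x2.mul x2)
  · have h3 := x2.mul ((isAdj_one Ω).add (y2.mul y2))
    rw [neg_mul_neg] at h3
    exact (neg_adj_aux hcomm) ▸ h3
  · intro m v hv
    rw [hcomm]
    have ex : ∀ v, (1 + x * x) m v = v + x m (x m v) := fun v ↦ rfl
    have ey : ((1 + y * y) * x) m v = x m v + y m (y m (x m v)) := rfl
    rw [ex, ey]
    have s1 : inn J m v (x m (x m v)) = inn J m (x m v) (x m v) :=
      (inn_apply_left m x1 x2 v (x m v)).symm
    have s2 : inn J m (x m v) (y m (y m (x m v))) = inn J m (y m (x m v)) (y m (x m v)) :=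
      (inn_apply_left m y1 y2 (x m v) (y m (x m v))).symm
    have n1 := inn_self_nonneg J m (v - x m (x m v))
    simp only [inn_sub_left, inn_sub_right, inn_add_left, inn_add_right,
      inn_comm J m (x m (x m v)) v, inn_comm J m (y m (y m (x m v))) (x m v), s1, s2] at n1 ⊢
    rcases eq_or_ne (x m v) 0 with h0 | h0
    · have := inn_self_pos J m hv
      simpa [h0, inn_zero_left] using this
    · have h3 := hlt m _ h0
      have h4 : inn J m (y m (y m (x m v))) (y m (y m (x m v))) ≤
          inn J m (y m (x m v)) (y m (x m v)) := by
        rcases eq_or_ne (y m (x m v)) 0 with h5 | h5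
        · simp [h5, inn_zero_left]
        · exact (hlt m _ h5).le
      linarith

end cayley

section logarithm

variable (J : ACS Ω) (c : ACS Ω)

lemma exists_cayley_inverse : ∃ B : EndField n M, (J.1 + c.1) * B = 1 ∧ B * (J.1 + c.1) = 1 := by
  refine exists_inverse fun x v hv ↦ ?_
  by_contra hne
  have h1 := J.2.2.2.2 x v hne
  have h2 := c.2.2.2.2 x v hne
  have h3 : J.1 x v + c.1 x v = 0 := hv
  rw [eq_neg_of_add_eq_zero_left h3, map_neg] at h1
  linarith

/-- The inverse of the Cayley transform. -/
def cayleyInv : EndField n M := (exists_cayley_inverse J c).choose * (J.1 - c.1)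

lemma cayleyInv_spec : (J.1 + c.1) * cayleyInv J c = J.1 - c.1 :=
  mul_mul_cancel_left (exists_cayley_inverse J c).choose_spec.1

lemma mul_cayleyInv : c.1 * (1 + cayleyInv J c) = J.1 * (1 - cayleyInv J c) :=
  mul_one_add_eq (cayleyInv_spec J c)

lemma cayleyInv_mul : cayleyInv J c * J.1 = -(J.1 * cayleyInv J c) := by
  obtain ⟨h1, h2⟩ := (exists_cayley_inverse J c).choose_spec
  exact cayleyInv_mul_aux J.mul_self c.mul_self h1 h2

lemma one_add_cayleyInv_injective (x : M) (v : Tan n x) (hv : (1 + cayleyInv J c) x v = 0) :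
    v = 0 := by
  have h : (J.1 + c.1) * (1 + cayleyInv J c) = J.1 + J.1 :=
    add_mul_one_add_eq (cayleyInv_spec J c)
  have h1 : (J.1 + c.1) x ((1 + cayleyInv J c) x v) = J.1 x v + J.1 x v :=
    congrArg (fun C : EndField n M ↦ C x v) h
  rw [hv, map_zero] at h1
  have h2 : (2 : ℝ) • J.1 x v = 0 := by rw [two_smul, ← h1]
  have h3 := (smul_eq_zero.1 h2).resolve_left two_ne_zero
  have h4 := J.apply_apply x v
  rw [h3, map_zero] at h4
  exact neg_eq_zero.1 h4.symm

lemma cayleyInv_mem_tangentAt : cayleyInv J c ∈ tangentAt J := by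
  obtain ⟨h1, h2⟩ := (exists_cayley_inverse J c).choose_spec
  refine mem_tangentAt_iff.2 ⟨?_, cayleyInv_mul J c, fun x v w ↦ ?_⟩
  · exact (IsSmoothField.inverse (J.2.1.add c.2.1) h1 h2).mul (IsSmoothField.sub J.2.1 c.2.1)
  · have e : ∀ v : Tan n x, c.1 x (v + cayleyInv J c x v) = J.1 x (v - cayleyInv J c x v) :=
      fun v ↦ congrArg (fun C : EndField n M ↦ C x v) (mul_cayleyInv J c)
    have h3 := c.2.2.2.1 x (v + cayleyInv J c x v) (w + cayleyInv J c x w)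
    rw [e, e, J.2.2.2.1] at h3
    simp only [map_add, map_sub, _root_.add_apply, _root_.sub_apply] at h3
    simp only [Pi.neg_apply, _root_.neg_apply, map_neg]
    linarith

lemma inn_cayleyInv_lt (x : M) (v : Tan n x) (hv : v ≠ 0) :
    inn J x (cayleyInv J c x v) (cayleyInv J c x v) < inn J x v v := by
  have e : c.1 x (v + cayleyInv J c x v) = J.1 x (v - cayleyInv J c x v) :=
    congrArg (fun C : EndField n M ↦ C x v) (mul_cayleyInv J c)
  have h1 := c.2.2.2.2 x (v + cayleyInv J c x v) fun h ↦ hv (one_add_cayleyInv_injective J c x v h)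
  rw [e] at h1
  change 0 < inn J x _ _ at h1
  rw [inn_sub_right, inn_add_left, inn_add_left, inn_comm J x (cayleyInv J c x v) v] at h1
  linarith

lemma cayleyInv_self : cayleyInv J J = 0 := by rw [cayleyInv, sub_self, mul_zero]

lemma isSmoothFamily_cayleyInv {F : Type*} [NormedAddCommGroup F] [NormedSpace ℝ F]
    {c : F → ACS Ω} (hc : IsSmoothFamily fun u ↦ (c u).1) :
    IsSmoothFamily fun u ↦ cayleyInv J (c u) := by
  have hJ := isSmoothFamily_const (F := F) J.2.1
  exact ((hJ.add hc).inverse (fun u ↦ (exists_cayley_inverse J (c u)).choose_spec.1)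
    fun u ↦ (exists_cayley_inverse J (c u)).choose_spec.2).mul (hJ.sub hc)

end logarithm

end CompatibleACS

namespace CompatibleACS

section ring

variable {R : Type*} [Ring R] {x y j c b a : R}

lemma conj_deriv_aux (h : a + j * x = x * j) (hx : x * j = -(j * x)) (hj : j * j = -1) :
    j * a = x + x := by
  have h1 : a = -(j * x) - j * x := by rw [← hx, ← h, add_sub_cancel_right]
  rw [h1, mul_sub, mul_neg, ← mul_assoc, hj]
  noncomm_ring

lemma one_add_mul_swap (h : c * (1 + x) = j * (1 - x)) (hx : x * j = -(j * x)) :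
    c * (1 + x) = (1 + x) * j := by
  rw [h, add_mul, hx]
  noncomm_ring

lemma cayley_diag_aux (h : c * (1 + x) = j * (1 - x)) (hx : x * j = -(j * x)) :
    c * (1 + x * x + x * (1 + x * x)) = (1 + x * x + x * (1 + x * x)) * j := by
  have h1 : 1 + x * x + x * (1 + x * x) = (1 + x) * (1 + x * x) := by noncomm_ring
  rw [h1, ← mul_assoc, one_add_mul_swap h hx, mul_assoc, mul_assoc, one_add_mul_of_anticomm hx]

lemma cayley_zero_aux (y : R) : c * (1 + 0 * 0 + 0 * (1 + y)) = (1 + 0 * 0 + 0 * (1 + y)) * c := by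
  simp

end ring

variable {n : ℕ} {M : Type*} [TopologicalSpace M] [ChartedSpace (Model n) M]
  [IsManifold 𝓘(ℝ, Model n) ∞ M] {Ω : SymplecticForm n M}

section retract

variable {J : ACS Ω} {A : EndField n M}

lemma tangentAt_anticomm (hA : A ∈ tangentAt J) : A * J.1 = -(J.1 * A) :=
  (mem_tangentAt_iff.1 hA).2.1

/-- Fields of endomorphisms with the field `½ J A`. -/
def halfMul (J : ACS Ω) (A : EndField n M) : EndField n M := (1 / 2 : ℝ) • (J.1 * A)

lemma halfMul_mem (hA : A ∈ tangentAt J) : halfMul J A ∈ tangentAt J :=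
  Submodule.smul_mem _ _ (mul_mem_tangentAt J hA)

lemma halfMul_smul (r : ℝ) (J : ACS Ω) (A : EndField n M) :
    halfMul J (r • A) = r • halfMul J A := by
  rw [halfMul, halfMul, mul_smul_comm, smul_comm]

/-- A compatible almost complex structure near `J` in the direction `A`. -/
def retract (J : ACS Ω) (A : EndField n M) : ACS Ω :=
  cayley J (1 + halfMul J A * halfMul J A) (halfMul J A * (1 + 0 * 0))

lemma retract_data (hA : A ∈ tangentAt J) :
    CayleyData J (1 + halfMul J A * halfMul J A) (halfMul J A * (1 + 0 * 0)) :=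
  cayleyData_of_commute (halfMul_mem hA) (zero_mem _) (by rw [mul_zero, zero_mul])
    fun m v hv ↦ (inn_zero_left J m 0).trans_lt (inn_self_pos J m hv)

lemma cayley_zero {y : EndField n M} (h : CayleyData J (1 + 0 * 0) (0 * (1 + y))) :
    cayley J (1 + 0 * 0) (0 * (1 + y)) = J :=
  cayley_eq h (cayley_zero_aux y)

lemma retract_zero (J : ACS Ω) : retract J 0 = J := by
  have h := retract_data (zero_mem (tangentAt J))
  have h0 : halfMul J 0 = 0 := by rw [halfMul, mul_zero, smul_zero]
  rw [retract, h0]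
  rw [h0] at h
  exact cayley_zero h

lemma isSmoothFamily_retract {F : Type*} [NormedAddCommGroup F] [NormedSpace ℝ F]
    {J : F → ACS Ω} {A : F → EndField n M} (hA : ∀ u, A u ∈ tangentAt (J u))
    (hJ : IsSmoothFamily fun u ↦ (J u).1) (hA' : IsSmoothFamily A) :
    IsSmoothFamily fun u ↦ (retract (J u) (A u)).1 := by
  have h1 : IsSmoothFamily fun u ↦ halfMul (J u) (A u) := (hJ.mul hA').const_smul _
  have h0 : IsSmoothFamily fun _ : F ↦ (1 + 0 * 0 : EndField n M) := by
    rw [mul_zero, add_zero]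
    exact isSmoothFamily_one
  exact isSmoothFamily_cayley (fun u ↦ retract_data (hA u)) hJ
    (isSmoothFamily_one.add (h1.mul h1)) (h1.mul h0)

lemma velocity_of_conj {c : ℝ → ACS Ω} (hc : IsSmoothFamily fun t ↦ (c t).1) (h0 : c 0 = J)
    {N : ℝ → EndField n M} (hN : IsSmoothFamily N) (hN0 : N 0 = 1)
    (h : ∀ t, (c t).1 * N t = N t * J.1) :
    velocity (fun t ↦ (c t).1) 0 + J.1 * velocity N 0 = velocity N 0 * J.1 := by
  refine ext_ev fun x ↦ ?_
  have h1 := (hc.hasDerivAt 0 x).mul (hN.hasDerivAt 0 x)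
  have h2 := (hN.hasDerivAt 0 x).mul (hasDerivAt_const (0 : ℝ) (ev x J.1))
  have h3 : ((fun s ↦ ev x (c s).1) * fun s ↦ ev x (N s)) =
      ((fun s ↦ ev x (N s)) * fun _ ↦ ev x J.1) := funext fun t ↦ congrArg (ev x) (h t)
  rw [h3] at h1
  have h4 := h1.unique h2
  rw [h0, hN0, ev_one, mul_one, mul_zero, add_zero] at h4
  exact h4

lemma isSmoothFamily_retract_line {F : Type*} [NormedAddCommGroup F] [NormedSpace ℝ F]
    (hA : A ∈ tangentAt J) {f : F → ℝ} (hf : ContDiff ℝ ∞ f) :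
    IsSmoothFamily fun s ↦ (retract J (f s • A)).1 :=
  isSmoothFamily_retract (fun s ↦ Submodule.smul_mem _ (f s) hA) (isSmoothFamily_const J.2.1)
    ((isSmoothFamily_const (mem_tangentAt_iff.1 hA).1).smul hf)

lemma velocity_retract (hA : A ∈ tangentAt J) :
    velocity (fun s : ℝ ↦ (retract J (s • A)).1) 0 = A := by
  set X := halfMul J A with hX
  have hXs : IsSmoothField X := (mem_tangentAt_iff.1 (halfMul_mem hA)).1
  have hx : IsSmoothFamily fun s : ℝ ↦ s • X := (isSmoothFamily_const hXs).smul contDiff_id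
  set N : ℝ → EndField n M := fun s ↦ 1 + (s • X) * (s • X) + (s • X) * (1 + 0 * 0) with hN
  have hNs : IsSmoothFamily N := by
    have h0 : IsSmoothFamily fun _ : ℝ ↦ (1 + 0 * 0 : EndField n M) := by
      rw [mul_zero, add_zero]
      exact isSmoothFamily_one
    exact (isSmoothFamily_one.add (hx.mul hx)).add (hx.mul h0)
  have hN0 : N 0 = 1 := by
    rw [hN]
    simp only [zero_smul, zero_mul, add_zero]
  have hNv : velocity N 0 = X := velocity_eq fun x ↦ by
    have h1 : HasDerivAt (fun s : ℝ ↦ s • ev x X) (ev x X) 0 := by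
      simpa using (hasDerivAt_id (0 : ℝ)).smul_const (ev x X)
    have h2 := ((h1.mul h1).const_add 1).add (h1.mul_const (1 + 0 * 0))
    simp only [zero_smul, mul_zero, zero_mul, add_zero, mul_one, zero_add] at h2
    refine h2.congr_of_eventuallyEq (Filter.Eventually.of_forall fun s ↦ ?_)
    simp [hN, ev_mul, ev_one]
  have h := velocity_of_conj (J := J) (isSmoothFamily_retract_line hA contDiff_id)
    (by rw [id, zero_smul, retract_zero]) hNs hN0 fun s ↦ by
      rw [id, hN]
      simp only [hX]
      rw [← halfMul_smul]
      exact cayley_mul (retract_data (Submodule.smul_mem _ _ hA))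
  rw [hNv] at h
  have h1 := conj_deriv_aux h (tangentAt_anticomm (halfMul_mem hA)) J.mul_self
  have h2 : X + X = J.1 * A := by
    rw [hX, halfMul, ← add_smul]
    norm_num
  rw [h2] at h1
  have h3 := congrArg (fun B ↦ J.1 * B) h1
  simp only [J.mul_mul] at h3
  exact neg_injective h3

lemma isCurveThrough_retract (hA : A ∈ tangentAt J) :
    IsCurveThrough (fun s : ℝ ↦ retract J (s • A)) J A := by
  have hs := isSmoothFamily_retract_line hA (contDiff_id (𝕜 := ℝ) (n := ∞))
  refine ⟨hs, by simp only [zero_smul, retract_zero], fun x ↦ ?_⟩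
  have h := hs.hasDerivAt 0 x
  have h2 := velocity_retract hA
  simp only [id] at h
  rw [h2] at h
  exact h

lemma velocity_cayleyInv {c : ℝ → ACS Ω} (hc : IsCurveThrough c J A) :
    velocity (fun t ↦ cayleyInv J (c t)) 0 = halfMul J A := by
  have hS := isSmoothFamily_cayleyInv J hc.1
  have hN : IsSmoothFamily fun t ↦ 1 + cayleyInv J (c t) := isSmoothFamily_one.add hS
  have hv : velocity (fun t ↦ 1 + cayleyInv J (c t)) 0 = velocity (fun t ↦ cayleyInv J (c t)) 0 :=
    velocity_eq fun x ↦ (hS.hasDerivAt 0 x).const_add _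
  have h := velocity_of_conj hc.1 hc.2.1 hN (by rw [hc.2.1, cayleyInv_self, add_zero]) fun t ↦
    one_add_mul_swap (mul_cayleyInv J (c t)) (cayleyInv_mul J (c t))
  have hA : velocity (fun t ↦ (c t).1) 0 = A := velocity_eq hc.2.2
  rw [hv, hA] at h
  have hanti : velocity (fun t ↦ cayleyInv J (c t)) 0 * J.1 =
      -(J.1 * velocity (fun t ↦ cayleyInv J (c t)) 0) := by
    refine ext_ev fun x ↦ ?_
    have h1 := (hS.hasDerivAt 0 x).mul_const (ev x J.1)
    have h2 := ((hS.hasDerivAt 0 x).const_mul (ev x J.1)).neg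
    have h3 : (fun t ↦ ev x (cayleyInv J (c t)) * ev x J.1) =
        -(fun t ↦ ev x J.1 * ev x (cayleyInv J (c t))) :=
      funext fun t ↦ congrArg (ev x) (cayleyInv_mul J (c t))
    rw [h3] at h1
    exact h1.unique h2
  rw [halfMul, conj_deriv_aux h hanti J.mul_self, ← two_smul ℝ, smul_smul]
  norm_num

end retract

section chain

variable {V : Type*} [NormedAddCommGroup V] [NormedSpace ℝ V]

/-- Smooth maps from `ACS Ω` to a normed space. -/
def IsSmoothMap (f : ACS Ω → V) : Prop :=
  ∀ (k : ℕ) (P : EuclideanSpace ℝ (Fin k) → ACS Ω),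
    IsSmoothFamily (fun u ↦ (P u).1) → ContDiff ℝ ∞ (f ∘ P)

variable {F : Type*} [NormedAddCommGroup F] [NormedSpace ℝ F] [FiniteDimensional ℝ F]
  {f : ACS Ω → V} {J : ACS Ω} {A B : EndField n M}

lemma IsSmoothMap.contDiff (hf : IsSmoothMap f) {P : F → ACS Ω}
    (hP : IsSmoothFamily fun u ↦ (P u).1) : ContDiff ℝ ∞ fun u ↦ f (P u) := by
  have h := hf _ (fun u ↦ P ((toEuclidean (E := F)).symm u))
    (hP.comp (toEuclidean (E := F)).symm.contDiff)
  have h2 := h.comp (toEuclidean (E := F)).contDiff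
  simpa [Function.comp_def] using h2

/-- The derivative of `f` at `J` in the direction `A`. -/
def dirDeriv (f : ACS Ω → V) (J : ACS Ω) (A : EndField n M) : V :=
  deriv (fun s : ℝ ↦ f (retract J (s • A))) 0

lemma hasDerivAt_prod_line {g : ℝ × ℝ → V} (hg : ContDiff ℝ ∞ g) (p a : ℝ × ℝ) :
    HasDerivAt (fun t : ℝ ↦ g (p + t • a)) (fderiv ℝ g p a) 0 := by
  have h1 : HasDerivAt (fun t : ℝ ↦ p + t • a) a 0 := by
    simpa using ((hasDerivAt_id (0 : ℝ)).smul_const a).const_add p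
  have h2 : HasFDerivAt g (fderiv ℝ g p) (p + (0 : ℝ) • a) := by
    rw [zero_smul, add_zero]
    exact (hg.differentiable (by simp) p).hasFDerivAt
  exact h2.comp_hasDerivAt (0 : ℝ) h1

/-- The chain rule: derivatives along a curve depend only on its velocity. -/
lemma IsSmoothMap.hasDerivAt (hf : IsSmoothMap f) {c : ℝ → ACS Ω} (hc : IsCurveThrough c J A)
    (hA : A ∈ tangentAt J) : HasDerivAt (fun t ↦ f (c t)) (dirDeriv f J A) 0 := by
  obtain ⟨R, hR, hSR, hR0⟩ := (isSmoothFamily_cayleyInv J hc.1).exists_eq_smul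
    (by rw [hc.2.1, cayleyInv_self])
  rw [velocity_cayleyInv hc] at hR0
  have hRt : ∀ t, R t ∈ tangentAt J := fun t ↦ by
    rcases eq_or_ne t 0 with rfl | ht
    · rw [hR0]
      exact halfMul_mem hA
    · have h1 := Submodule.smul_mem _ t⁻¹ (cayleyInv_mem_tangentAt J (c t))
      rwa [hSR, inv_smul_smul₀ ht] at h1
  have hdata : ∀ p : ℝ × ℝ, CayleyData J (1 + (p.1 • R p.2) * (p.1 • R p.2))
      ((p.1 • R p.2) * (1 + cayleyInv J (c p.2) * cayleyInv J (c p.2))) := fun p ↦ by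
    refine cayleyData_of_commute (Submodule.smul_mem _ _ (hRt _)) (cayleyInv_mem_tangentAt J _)
      ?_ fun m v hv ↦ inn_cayleyInv_lt J (c p.2) m v hv
    rw [hSR, smul_mul_smul_comm, smul_mul_smul_comm, mul_comm p.1]
  have hx : IsSmoothFamily fun p : ℝ × ℝ ↦ p.1 • R p.2 := (hR.comp contDiff_snd).smul contDiff_fst
  have hy : IsSmoothFamily fun p : ℝ × ℝ ↦ cayleyInv J (c p.2) :=
    (isSmoothFamily_cayleyInv J hc.1).comp contDiff_snd
  have hP := isSmoothFamily_cayley hdata (isSmoothFamily_const J.2.1)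
    (isSmoothFamily_one.add (hx.mul hx)) (hx.mul (isSmoothFamily_one.add (hy.mul hy)))
  obtain ⟨P, hPdef⟩ : ∃ P : ℝ × ℝ → ACS Ω, ∀ p, P p =
      cayley J (1 + (p.1 • R p.2) * (p.1 • R p.2))
        ((p.1 • R p.2) * (1 + cayleyInv J (c p.2) * cayleyInv J (c p.2))) := ⟨_, fun _ ↦ rfl⟩
  simp only [← hPdef] at hP
  have hg := hf.contDiff hP
  have hdiag : ∀ t, P (t, t) = c t := fun t ↦ by
    rw [hPdef]
    refine cayley_eq (hdata (t, t)) ?_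
    simp only [← hSR t]
    exact cayley_diag_aux (mul_cayleyInv J (c t)) (cayleyInv_mul J (c t))
  have hzero : ∀ t, P (0, t) = J := fun t ↦ by
    have h := hdata (0, t)
    simp only [hPdef]
    simp only [zero_smul] at h ⊢
    exact cayley_zero h
  have hcan : ∀ s, P (s, 0) = retract J (s • A) := fun s ↦ by
    simp only [hPdef]
    rw [hR0, hc.2.1, cayleyInv_self, retract, halfMul_smul]
  have h1 := hasDerivAt_prod_line hg 0 (1, 1)
  have h2 := hasDerivAt_prod_line hg 0 (1, 0)
  have h3 := hasDerivAt_prod_line hg 0 (0, 1)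
  simp only [zero_add, Prod.smul_mk, smul_eq_mul, mul_one, mul_zero, hdiag, hcan, hzero] at h1 h2 h3
  have h4 := h3.unique (hasDerivAt_const _ _)
  have h5 : (1, 1) = ((1, 0) : ℝ × ℝ) + (0, 1) := by simp
  rw [h5, map_add, h4, add_zero] at h1
  rw [dirDeriv, h2.deriv]
  exact h1

lemma IsSmoothMap.hasDirDeriv (hf : IsSmoothMap f) (hA : A ∈ tangentAt J) :
    HasDirDeriv f J A (dirDeriv f J A) :=
  ⟨⟨_, isCurveThrough_retract hA⟩, fun _ hc ↦ hf.hasDerivAt hc hA⟩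

lemma HasDirDeriv.eq_dirDeriv (hA : A ∈ tangentAt J) {l : V} (h : HasDirDeriv f J A l) :
    dirDeriv f J A = l :=
  (h.2 _ (isCurveThrough_retract hA)).deriv

lemma IsSmoothMap.dirDeriv_add (hf : IsSmoothMap f) (hA : A ∈ tangentAt J)
    (hB : B ∈ tangentAt J) : dirDeriv f J (A + B) = dirDeriv f J A + dirDeriv f J B := by
  have hP : IsSmoothFamily fun p : ℝ × ℝ ↦ (retract J (p.1 • A + p.2 • B)).1 :=
    isSmoothFamily_retract (J := fun _ ↦ J)
      (fun p ↦ add_mem (Submodule.smul_mem _ _ hA) (Submodule.smul_mem _ _ hB))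
      (isSmoothFamily_const J.2.1)
      (((isSmoothFamily_const (mem_tangentAt_iff.1 hA).1).smul contDiff_fst).add
        ((isSmoothFamily_const (mem_tangentAt_iff.1 hB).1).smul contDiff_snd))
  have hg := hf.contDiff hP
  have h1 := hasDerivAt_prod_line hg 0 (1, 1)
  have h2 := hasDerivAt_prod_line hg 0 (1, 0)
  have h3 := hasDerivAt_prod_line hg 0 (0, 1)
  simp only [zero_add, Prod.smul_mk, smul_eq_mul, mul_one, mul_zero, zero_smul, add_zero,
    ← smul_add] at h1 h2 h3
  have h5 : (1, 1) = ((1, 0) : ℝ × ℝ) + (0, 1) := by simp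
  rw [dirDeriv, dirDeriv, dirDeriv, h1.deriv, h2.deriv, h3.deriv, ← map_add, ← h5]

lemma IsSmoothMap.dirDeriv_smul (hf : IsSmoothMap f) (hA : A ∈ tangentAt J) (r : ℝ) :
    dirDeriv f J (r • A) = r • dirDeriv f J A := by
  have h := hf.hasDerivAt (isCurveThrough_retract hA) hA
  have h2 : HasDerivAt (fun s : ℝ ↦ s * r) r 0 := by simpa using (hasDerivAt_id (0 : ℝ)).mul_const r
  have h3 : HasDerivAt (fun t : ℝ ↦ f (retract J (t • A))) (dirDeriv f J A) (0 * r) := by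
    rwa [zero_mul]
  have h4 := h3.scomp (0 : ℝ) h2
  rw [dirDeriv, ← h4.deriv]
  congr 1
  funext s
  rw [Function.comp_apply, smul_smul]

end chain

section fields

/-- Smooth maps from `ACS Ω` to the fields of endomorphisms. -/
def IsSmoothFieldMap (Y : ACS Ω → EndField n M) : Prop :=
  ∀ (k : ℕ) (P : EuclideanSpace ℝ (Fin k) → ACS Ω),
    IsSmoothFamily (fun u ↦ (P u).1) → IsSmoothFamily (fun u ↦ Y (P u))

variable {F : Type} [NormedAddCommGroup F] [NormedSpace ℝ F] [FiniteDimensional ℝ F]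
  {Y Z : ACS Ω → EndField n M} {J : ACS Ω} {A B : EndField n M}

lemma IsSmoothFieldMap.comp (hY : IsSmoothFieldMap Y) {P : F → ACS Ω}
    (hP : IsSmoothFamily fun u ↦ (P u).1) : IsSmoothFamily fun u ↦ Y (P u) := by
  have h := (hY _ (fun u ↦ P ((toEuclidean (E := F)).symm u))
    (hP.comp (toEuclidean (E := F)).symm.contDiff)).comp (toEuclidean (E := F)).contDiff
  simpa using h

lemma IsSmoothFieldMap.isSmoothMap (hY : IsSmoothFieldMap Y) (x : M) :
    IsSmoothMap fun J ↦ ev x (Y J) := fun k P hP ↦ (hY k P hP).contDiff_ev x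

/-- The derivative of `Y` at `J` in the direction `A`. -/
def dirField (Y : ACS Ω → EndField n M) (J : ACS Ω) (A : EndField n M) : EndField n M :=
  velocity (fun s : ℝ ↦ Y (retract J (s • A))) 0

lemma IsSmoothFieldMap.hasDerivAt (hY : IsSmoothFieldMap Y) {c : ℝ → ACS Ω}
    (hc : IsCurveThrough c J A) (hA : A ∈ tangentAt J) (x : M) :
    HasDerivAt (fun t ↦ ev x (Y (c t))) (ev x (dirField Y J A)) 0 :=
  (hY.isSmoothMap x).hasDerivAt hc hA

lemma dirField_eq (hA : A ∈ tangentAt J) {c : ℝ → ACS Ω} (hY : IsSmoothFieldMap Y)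
    (hc : IsCurveThrough c J A) (h : ∀ x, HasDerivAt (fun t ↦ ev x (Y (c t))) (ev x B) 0) :
    dirField Y J A = B :=
  ext_ev fun x ↦ (hY.hasDerivAt hc hA x).unique (h x)

lemma IsSmoothFieldMap.dirField_add (hY : IsSmoothFieldMap Y) (hA : A ∈ tangentAt J)
    (hB : B ∈ tangentAt J) : dirField Y J (A + B) = dirField Y J A + dirField Y J B :=
  ext_ev fun x ↦ (hY.isSmoothMap x).dirDeriv_add hA hB

lemma IsSmoothFieldMap.dirField_smul (hY : IsSmoothFieldMap Y) (hA : A ∈ tangentAt J) (r : ℝ) :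
    dirField Y J (r • A) = r • dirField Y J A :=
  ext_ev fun x ↦ (hY.isSmoothMap x).dirDeriv_smul hA r

lemma IsSmoothFieldMap.dirField_sub (hY : IsSmoothFieldMap Y) (hA : A ∈ tangentAt J)
    (hB : B ∈ tangentAt J) : dirField Y J (A - B) = dirField Y J A - dirField Y J B := by
  have h := hY.dirField_add (sub_mem hA hB) hB
  rw [sub_add_cancel] at h
  exact eq_sub_of_add_eq h.symm

lemma IsSmoothFieldMap.isSmoothFamily_dirField (hY : IsSmoothFieldMap Y) {J : F → ACS Ω}
    {A : F → EndField n M} (hA : ∀ u, A u ∈ tangentAt (J u)) (hJ : IsSmoothFamily fun u ↦ (J u).1)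
    (hA' : IsSmoothFamily A) : IsSmoothFamily fun u ↦ dirField Y (J u) (A u) := by
  have h : IsSmoothFamily fun p : ℝ × F ↦ (retract (J p.2) (p.1 • A p.2)).1 :=
    isSmoothFamily_retract (fun p ↦ Submodule.smul_mem _ _ (hA p.2)) (hJ.comp contDiff_snd)
      ((hA'.comp contDiff_snd).smul contDiff_fst)
  exact (hY.comp h).velocity_prod

end fields

end CompatibleACS

namespace CompatibleACS

section algebra

section

variable {R : Type*} [Ring R] {j x y : R}

lemma anticommutator_adj_aux (hx : x * j = -(j * x)) (hy : y * j = -(j * y)) :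
    (-y * -x + -x * -y) * -j = -(j * (x * y + y * x)) := by
  have hx' : ∀ w, x * (j * w) = -(j * (x * w)) := fun w ↦ by rw [← mul_assoc, hx, neg_mul, mul_assoc]
  have hy' : ∀ w, y * (j * w) = -(j * (y * w)) := fun w ↦ by rw [← mul_assoc, hy, neg_mul, mul_assoc]
  simp only [neg_mul, mul_neg, neg_neg, add_mul, mul_add, mul_assoc, hx, hy, hx', hy']
  abel

end

variable {R : Type*} [Ring R] [Algebra ℝ R] {j w x y z dx dy dz dxy dyx dxz dyz dxyz dyxz db : R}

lemma sub_half_anticomm (hj : j * j = -1) (hx : x * j = -(j * x)) (hy : y * j = -(j * y))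
    (h : dxy * j + y * x = -(x * y + j * dxy)) :
    (dxy - (1 / 2 : ℝ) • (j * (x * y + y * x))) * j =
      -(j * (dxy - (1 / 2 : ℝ) • (j * (x * y + y * x)))) := by
  have hj' : ∀ w, j * (j * w) = -w := fun w ↦ by rw [← mul_assoc, hj, neg_one_mul]
  have hx' : ∀ w, x * (j * w) = -(j * (x * w)) := fun w ↦ by rw [← mul_assoc, hx, neg_mul, mul_assoc]
  have hy' : ∀ w, y * (j * w) = -(j * (y * w)) := fun w ↦ by rw [← mul_assoc, hy, neg_mul, mul_assoc]
  rw [eq_sub_of_add_eq h |> fun e ↦ (sub_mul dxy _ j).trans (congrArg (· - _) e)]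
  simp only [mul_add, add_mul, mul_sub, smul_mul_assoc, mul_smul_comm, mul_assoc, hx, hy, hx', hy',
    hj', mul_neg, neg_neg]
  module

lemma sub_half_complex (hj : j * j = -1) (hx : x * j = -(j * x)) :
    x * y + j * dxy - (1 / 2 : ℝ) • (j * (x * (j * y) + j * y * x)) =
      j * (dxy - (1 / 2 : ℝ) • (j * (x * y + y * x))) := by
  have hj' : ∀ w, j * (j * w) = -w := fun w ↦ by rw [← mul_assoc, hj, neg_one_mul]
  have hx' : ∀ w, x * (j * w) = -(j * (x * w)) := fun w ↦ by rw [← mul_assoc, hx, neg_mul, mul_assoc]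
  simp only [mul_add, mul_sub, mul_smul_comm, mul_assoc, hx', hj', mul_neg, neg_neg]
  module

lemma curvature_aux (hj : j * j = -1) (hx : x * j = -(j * x)) (hy : y * j = -(j * y))
    (h : dxyz - dyxz = db) :
    (dxyz - (1 / 2 : ℝ) • (x * (y * z + z * y) +
        j * (dxy * z + y * dxz + (dxz * y + z * dxy))) -
      (1 / 2 : ℝ) • (j * (x * (dyz - (1 / 2 : ℝ) • (j * (y * z + z * y))) +
        (dyz - (1 / 2 : ℝ) • (j * (y * z + z * y))) * x))) -
    (dyxz - (1 / 2 : ℝ) • (y * (x * z + z * x) +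
        j * (dyx * z + x * dyz + (dyz * x + z * dyx))) -
      (1 / 2 : ℝ) • (j * (y * (dxz - (1 / 2 : ℝ) • (j * (x * z + z * x))) +
        (dxz - (1 / 2 : ℝ) • (j * (x * z + z * x))) * y))) -
    (db - (1 / 2 : ℝ) • (j * ((dxy - dyx) * z + z * (dxy - dyx)))) =
    (-(1 / 4) : ℝ) • ((x * y - y * x) * z - z * (x * y - y * x)) := by
  have hj' : ∀ w, j * (j * w) = -w := fun w ↦ by rw [← mul_assoc, hj, neg_one_mul]
  have hx' : ∀ w, x * (j * w) = -(j * (x * w)) := fun w ↦ by rw [← mul_assoc, hx, neg_mul, mul_assoc]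
  have hy' : ∀ w, y * (j * w) = -(j * (y * w)) := fun w ↦ by rw [← mul_assoc, hy, neg_mul, mul_assoc]
  rw [← h]
  simp only [mul_add, add_mul, mul_sub, sub_mul, smul_mul_assoc, mul_smul_comm, mul_assoc, hx', hy',
    hj', mul_neg, neg_neg]
  module

lemma parallel_curvature_aux (hx : x * j = -(j * x)) (hy : y * j = -(j * y))
    (hz : z * j = -(j * z)) :
    (-(1 / 4) : ℝ) • (((dx * y + x * dy - (dy * x + y * dx)) * z + (x * y - y * x) * dz) -
        (dz * (x * y - y * x) + z * (dx * y + x * dy - (dy * x + y * dx)))) -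
      (1 / 2 : ℝ) • (j * (w * ((-(1 / 4) : ℝ) • ((x * y - y * x) * z - z * (x * y - y * x))) +
        ((-(1 / 4) : ℝ) • ((x * y - y * x) * z - z * (x * y - y * x))) * w)) =
    (-(1 / 4) : ℝ) • (((dx - (1 / 2 : ℝ) • (j * (w * x + x * w))) * y -
        y * (dx - (1 / 2 : ℝ) • (j * (w * x + x * w)))) * z -
        z * ((dx - (1 / 2 : ℝ) • (j * (w * x + x * w))) * y -
        y * (dx - (1 / 2 : ℝ) • (j * (w * x + x * w))))) +
    (-(1 / 4) : ℝ) • ((x * (dy - (1 / 2 : ℝ) • (j * (w * y + y * w))) -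
        (dy - (1 / 2 : ℝ) • (j * (w * y + y * w))) * x) * z -
        z * (x * (dy - (1 / 2 : ℝ) • (j * (w * y + y * w))) -
        (dy - (1 / 2 : ℝ) • (j * (w * y + y * w))) * x)) +
    (-(1 / 4) : ℝ) • ((x * y - y * x) * (dz - (1 / 2 : ℝ) • (j * (w * z + z * w))) -
        (dz - (1 / 2 : ℝ) • (j * (w * z + z * w))) * (x * y - y * x)) := by
  have hx' : ∀ w, x * (j * w) = -(j * (x * w)) := fun w ↦ by rw [← mul_assoc, hx, neg_mul, mul_assoc]
  have hy' : ∀ w, y * (j * w) = -(j * (y * w)) := fun w ↦ by rw [← mul_assoc, hy, neg_mul, mul_assoc]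
  have hz' : ∀ w, z * (j * w) = -(j * (z * w)) := fun w ↦ by rw [← mul_assoc, hz, neg_mul, mul_assoc]
  simp only [mul_add, add_mul, mul_sub, sub_mul, smul_mul_assoc, mul_smul_comm, mul_assoc, hx', hy',
    hz', mul_neg, neg_mul, neg_neg]
  module

end algebra

variable {n : ℕ} {M : Type*} [TopologicalSpace M] [ChartedSpace (Model n) M]

lemma velocity_neg (P : ℝ → EndField n M) (t : ℝ) : velocity (fun t ↦ -P t) t = -velocity P t :=
  ext_ev fun x ↦ by
    rw [map_neg, ev_velocity, ev_velocity, ← deriv.fun_neg]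
    simp only [map_neg]

variable [IsManifold 𝓘(ℝ, Model n) ∞ M] {Ω : SymplecticForm n M}

section product

variable {Y Z : ACS Ω → EndField n M} {J : ACS Ω} {A : EndField n M}

lemma IsSmoothFieldMap.add (hY : IsSmoothFieldMap Y) (hZ : IsSmoothFieldMap Z) :
    IsSmoothFieldMap fun J ↦ Y J + Z J := fun k P hP ↦ (hY k P hP).add (hZ k P hP)

lemma IsSmoothFieldMap.sub (hY : IsSmoothFieldMap Y) (hZ : IsSmoothFieldMap Z) :
    IsSmoothFieldMap fun J ↦ Y J - Z J := fun k P hP ↦ (hY k P hP).sub (hZ k P hP)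

lemma IsSmoothFieldMap.mul (hY : IsSmoothFieldMap Y) (hZ : IsSmoothFieldMap Z) :
    IsSmoothFieldMap fun J ↦ Y J * Z J := fun k P hP ↦ (hY k P hP).mul (hZ k P hP)

lemma IsSmoothFieldMap.const_smul (hY : IsSmoothFieldMap Y) (r : ℝ) :
    IsSmoothFieldMap fun J ↦ r • Y J := fun k P hP ↦ (hY k P hP).const_smul r

lemma isSmoothFieldMap_val : IsSmoothFieldMap fun J : ACS Ω ↦ J.1 := fun _ _ hP ↦ hP

lemma dirField_fun_add (hY : IsSmoothFieldMap Y) (hZ : IsSmoothFieldMap Z)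
    (hA : A ∈ tangentAt J) :
    dirField (fun J ↦ Y J + Z J) J A = dirField Y J A + dirField Z J A :=
  dirField_eq hA (hY.add hZ) (isCurveThrough_retract hA) fun x ↦
    (hY.hasDerivAt (isCurveThrough_retract hA) hA x).add
      (hZ.hasDerivAt (isCurveThrough_retract hA) hA x)

lemma dirField_fun_sub (hY : IsSmoothFieldMap Y) (hZ : IsSmoothFieldMap Z)
    (hA : A ∈ tangentAt J) :
    dirField (fun J ↦ Y J - Z J) J A = dirField Y J A - dirField Z J A :=
  dirField_eq hA (hY.sub hZ) (isCurveThrough_retract hA) fun x ↦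
    (hY.hasDerivAt (isCurveThrough_retract hA) hA x).sub
      (hZ.hasDerivAt (isCurveThrough_retract hA) hA x)

lemma dirField_const_smul (hY : IsSmoothFieldMap Y) (hA : A ∈ tangentAt J) (r : ℝ) :
    dirField (fun J ↦ r • Y J) J A = r • dirField Y J A :=
  dirField_eq hA (hY.const_smul r) (isCurveThrough_retract hA) fun x ↦
    (hY.hasDerivAt (isCurveThrough_retract hA) hA x).const_smul r

lemma dirField_mul (hY : IsSmoothFieldMap Y) (hZ : IsSmoothFieldMap Z) (hA : A ∈ tangentAt J) :
    dirField (fun J ↦ Y J * Z J) J A = dirField Y J A * Z J + Y J * dirField Z J A :=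
  dirField_eq hA (hY.mul hZ) (isCurveThrough_retract hA) fun x ↦ by
    have h := (hY.hasDerivAt (isCurveThrough_retract hA) hA x).mul
      (hZ.hasDerivAt (isCurveThrough_retract hA) hA x)
    simp only [zero_smul, retract_zero] at h
    exact h

lemma dirField_val (hA : A ∈ tangentAt J) : dirField (fun J : ACS Ω ↦ J.1) J A = A :=
  dirField_eq hA isSmoothFieldMap_val (isCurveThrough_retract hA) (isCurveThrough_retract hA).2.2

lemma dirField_fun_smul {f : ACS Ω → ℝ} (hf : IsSmoothFunction f) (hY : IsSmoothFieldMap Y)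
    (hA : A ∈ tangentAt J) :
    dirField (fun J ↦ f J • Y J) J A = f J • dirField Y J A + dirDeriv f J A • Y J := by
  refine dirField_eq hA (fun k P hP ↦ (hY k P hP).smul (hf k P hP)) (isCurveThrough_retract hA)
    fun x ↦ ?_
  have h1 : HasDerivAt (fun s : ℝ ↦ f (retract J (s • A))) (dirDeriv f J A) 0 :=
    IsSmoothMap.hasDerivAt (f := f) hf (isCurveThrough_retract hA) hA
  have h := h1.smul (hY.hasDerivAt (isCurveThrough_retract hA) hA x)
  simp only [zero_smul, retract_zero] at h
  exact h

end product

section tangent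

lemma velocity_isAdj {P Q : ℝ → EndField n M} (hP : IsSmoothFamily P) (hQ : IsSmoothFamily Q)
    (h : ∀ t, IsAdj Ω (P t) (Q t)) (t : ℝ) : IsAdj Ω (velocity P t) (velocity Q t) := by
  intro x v w
  let Φ : Coord n →L[ℝ] Coord n →L[ℝ] ℝ := Ω.form x
  let v' : Coord n := v
  let w' : Coord n := w
  have h1 := (Φ.flip w').hasFDerivAt.comp_hasDerivAt t
    ((hP.hasDerivAt t x).clm_apply (hasDerivAt_const t v'))
  have h2 := (Φ v').hasFDerivAt.comp_hasDerivAt t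
    ((hQ.hasDerivAt t x).clm_apply (hasDerivAt_const t w'))
  have h3 : (Φ.flip w' ∘ fun s ↦ ev x (P s) v') = (Φ v' ∘ fun s ↦ ev x (Q s) w') :=
    funext fun s ↦ h s x v w
  rw [h3] at h1
  have h4 := h1.unique h2
  simp only [map_zero, add_zero] at h4
  exact h4

lemma isSmoothField_velocity {P : ℝ → EndField n M} (hP : IsSmoothFamily P) :
    IsSmoothField (velocity P 0) :=
  ((hP.comp (φ := fun p : ℝ × ℝ ↦ p.1) contDiff_fst).velocity_prod).isSmoothField 0

lemma velocity_mem_tangentAt {c : ℝ → ACS Ω} (hc : IsSmoothFamily fun t ↦ (c t).1) :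
    velocity (fun t ↦ (c t).1) 0 ∈ tangentAt (c 0) := by
  refine mem_tangentAt_iff.2 ⟨isSmoothField_velocity hc, ?_, ?_⟩
  · refine ext_ev fun x ↦ ?_
    have h1 := (hc.hasDerivAt 0 x).mul (hc.hasDerivAt 0 x)
    have h2 : ((fun s ↦ ev x (c s).1) * fun s ↦ ev x (c s).1) = fun _ ↦ -1 :=
      funext fun t ↦ congrArg (ev x) (c t).mul_self
    rw [h2] at h1
    exact eq_neg_of_add_eq_zero_left (h1.unique (hasDerivAt_const _ _))
  · have h := velocity_isAdj hc hc.neg (fun t ↦ (c t).isAdj) 0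
    rwa [velocity_neg] at h

end tangent

section connection

lemma VectorField.mem (X : VectorField Ω) (J : ACS Ω) : X.1 J ∈ tangentAt J := X.2.1 J

lemma VectorField.smooth (X : VectorField Ω) : IsSmoothFieldMap X.1 := X.2.2

lemma VectorField.anticomm (X : VectorField Ω) (J : ACS Ω) : X.1 J * J.1 = -(J.1 * X.1 J) :=
  tangentAt_anticomm (X.mem J)

lemma VectorField.isAdj (X : VectorField Ω) (J : ACS Ω) : IsAdj Ω (X.1 J) (-X.1 J) :=
  (mem_tangentAt_iff.1 (X.mem J)).2.2

lemma VectorField.ext {X Y : VectorField Ω} (h : ∀ J, X.1 J = Y.1 J) : X = Y :=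
  Subtype.ext (funext h)

/-- The directional derivative of `Y` along `X`. -/
def flat (X : VectorField Ω) (Y : ACS Ω → EndField n M) (J : ACS Ω) : EndField n M :=
  dirField Y J (X.1 J)

lemma isSmoothFieldMap_flat (X : VectorField Ω) {Y : ACS Ω → EndField n M}
    (hY : IsSmoothFieldMap Y) : IsSmoothFieldMap (flat X Y) :=
  fun k P hP ↦ hY.isSmoothFamily_dirField (fun u ↦ X.mem (P u)) hP (X.smooth k P hP)

lemma flat_anticomm (X Y : VectorField Ω) (J : ACS Ω) :
    flat X Y.1 J * J.1 + Y.1 J * X.1 J = -(X.1 J * Y.1 J + J.1 * flat X Y.1 J) := by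
  have h1 := dirField_mul Y.smooth isSmoothFieldMap_val (X.mem J)
  have h2 := dirField_mul isSmoothFieldMap_val Y.smooth (X.mem J)
  have h3 := dirField_const_smul (isSmoothFieldMap_val.mul Y.smooth) (X.mem J) (-1)
  rw [dirField_val (X.mem J)] at h1 h2
  rw [h2] at h3
  have h4 : (fun J : ACS Ω ↦ Y.1 J * J.1) = fun J ↦ (-1 : ℝ) • (J.1 * Y.1 J) :=
    funext fun J ↦ by rw [Y.anticomm J, neg_one_smul]
  rw [h4, h3, neg_one_smul] at h1
  exact h1.symm

lemma flat_isAdj (X Y : VectorField Ω) (J : ACS Ω) :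
    IsAdj Ω (flat X Y.1 J) (-flat X Y.1 J) := by
  have hs := Y.smooth.comp (isCurveThrough_retract (X.mem J)).1
  have h := velocity_isAdj hs hs.neg (fun t ↦ Y.isAdj _) 0
  rw [velocity_neg] at h
  exact h

lemma half_isAdj {J : ACS Ω} {A B : EndField n M} (hA : A ∈ tangentAt J) (hB : B ∈ tangentAt J) :
    IsAdj Ω (halfMul J (A * B + B * A)) (-halfMul J (A * B + B * A)) := by
  obtain ⟨-, a1, a2⟩ := mem_tangentAt_iff.1 hA
  obtain ⟨-, b1, b2⟩ := mem_tangentAt_iff.1 hB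
  have h := ((J.isAdj).mul ((a2.mul b2).add (b2.mul a2))).smul (1 / 2)
  have e : (-B * -A + -A * -B) * -J.1 = -(J.1 * (A * B + B * A)) :=
    anticommutator_adj_aux a1 b1
  rw [e, smul_neg] at h
  exact h

/-- The Levi-Civita connection. -/
def nabla (X Y : VectorField Ω) : VectorField Ω :=
  ⟨fun J ↦ flat X Y.1 J - halfMul J (X.1 J * Y.1 J + Y.1 J * X.1 J), fun J ↦ by
    have hs := isSmoothFieldMap_flat X Y.smooth
    refine mem_tangentAt_iff.2 ⟨?_, ?_, ?_⟩
    · refine IsSmoothField.sub ?_ ?_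
      · have h := hs 0 (fun _ ↦ J) (isSmoothFamily_const J.2.1)
        exact h.isSmoothField 0
      · have hX := (mem_tangentAt_iff.1 (X.mem J)).1
        have hY := (mem_tangentAt_iff.1 (Y.mem J)).1
        exact IsSmoothField.const_smul (IsSmoothField.mul J.2.1 ((hX.mul hY).add (hY.mul hX))) _
    · exact sub_half_anticomm J.mul_self (X.anticomm J) (Y.anticomm J) (flat_anticomm X Y J)
    · have h := (flat_isAdj X Y J).sub (half_isAdj (X.mem J) (Y.mem J))
      rw [neg_sub_neg] at h
      exact (neg_sub (flat X Y.1 J) _) ▸ h,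
  fun k P hP ↦ by
    have h1 := isSmoothFieldMap_flat X Y.smooth k P hP
    have hX := X.smooth k P hP
    have hY := Y.smooth k P hP
    exact h1.sub ((hP.mul ((hX.mul hY).add (hY.mul hX))).const_smul _)⟩

lemma nabla_apply (X Y : VectorField Ω) (J : ACS Ω) :
    (nabla X Y).1 J = flat X Y.1 J - (1 / 2 : ℝ) • (J.1 * (X.1 J * Y.1 J + Y.1 J * X.1 J)) := rfl

lemma nabla_sub_nabla (X Y : VectorField Ω) (J : ACS Ω) :
    (nabla X Y - nabla Y X).1 J = flat X Y.1 J - flat Y X.1 J := by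
  change (nabla X Y).1 J - (nabla Y X).1 J = _
  rw [nabla_apply, nabla_apply, add_comm (Y.1 J * X.1 J), sub_sub_sub_cancel_right]

lemma isLieBracket_nabla (X Y : VectorField Ω) : IsLieBracket X Y (nabla X Y - nabla Y X) :=
  fun J ↦ ⟨flat X Y.1 J, flat Y X.1 J, fun x ↦ (Y.smooth.isSmoothMap x).hasDirDeriv (X.mem J),
    fun x ↦ (X.smooth.isSmoothMap x).hasDirDeriv (Y.mem J), nabla_sub_nabla X Y J⟩

lemma IsLieBracket.eq {X Y Z : VectorField Ω} (h : IsLieBracket X Y Z) :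
    Z = nabla X Y - nabla Y X := by
  refine VectorField.ext fun J ↦ ?_
  obtain ⟨B, C, hB, hC, hZ⟩ := h J
  have h1 : flat X Y.1 J = B := ext_ev fun x ↦
    HasDirDeriv.eq_dirDeriv (V := EndModel n) (f := fun J ↦ ev x (Y.1 J)) (X.mem J) (hB x)
  have h2 : flat Y X.1 J = C := ext_ev fun x ↦
    HasDirDeriv.eq_dirDeriv (V := EndModel n) (f := fun J ↦ ev x (X.1 J)) (Y.mem J) (hC x)
  rw [nabla_sub_nabla, hZ, h1, h2]

lemma lieBracket_eq (X Y : VectorField Ω) : lieBracket X Y = nabla X Y - nabla Y X := by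
  have h : ∃ Z, IsLieBracket X Y Z := ⟨_, isLieBracket_nabla X Y⟩
  rw [lieBracket, dif_pos h]
  exact h.choose_spec.eq

lemma lieBracket_apply (X Y : VectorField Ω) (J : ACS Ω) :
    (lieBracket X Y).1 J = flat X Y.1 J - flat Y X.1 J := by
  rw [lieBracket_eq, nabla_sub_nabla]

lemma isConnection_nabla : IsConnection (Ω := Ω) nabla where
  add_left X X' Y := VectorField.ext fun J ↦ by
    change dirField Y.1 J (X.1 J + X'.1 J) -
      (1 / 2 : ℝ) • (J.1 * ((X.1 J + X'.1 J) * Y.1 J + Y.1 J * (X.1 J + X'.1 J))) =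
      (nabla X Y).1 J + (nabla X' Y).1 J
    rw [Y.smooth.dirField_add (X.mem J) (X'.mem J), nabla_apply, nabla_apply, flat, flat]
    simp only [add_mul, mul_add, smul_add]
    abel
  smul_left f hf X Y := VectorField.ext fun J ↦ by
    change dirField Y.1 J (f J • X.1 J) -
      (1 / 2 : ℝ) • (J.1 * ((f J • X.1 J) * Y.1 J + Y.1 J * (f J • X.1 J))) =
      f J • (nabla X Y).1 J
    rw [Y.smooth.dirField_smul (X.mem J), nabla_apply, flat]
    simp only [smul_mul_assoc, mul_smul_comm, ← smul_add, smul_sub, smul_comm (f J)]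
  add_right X Y Y' := VectorField.ext fun J ↦ by
    change dirField (fun J ↦ Y.1 J + Y'.1 J) J (X.1 J) -
      (1 / 2 : ℝ) • (J.1 * (X.1 J * (Y.1 J + Y'.1 J) + (Y.1 J + Y'.1 J) * X.1 J)) =
      (nabla X Y).1 J + (nabla X Y').1 J
    rw [dirField_fun_add Y.smooth Y'.smooth (X.mem J), nabla_apply, nabla_apply, flat, flat]
    simp only [add_mul, mul_add, smul_add]
    abel
  leibniz f hf X Y J := by
    refine ⟨dirDeriv f J (X.1 J), IsSmoothMap.hasDirDeriv (f := f) hf (X.mem J), ?_⟩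
    change dirField (fun J ↦ f J • Y.1 J) J (X.1 J) -
      (1 / 2 : ℝ) • (J.1 * (X.1 J * (f J • Y.1 J) + (f J • Y.1 J) * X.1 J)) = _
    rw [dirField_fun_smul hf Y.smooth (X.mem J), nabla_apply, flat]
    simp only [smul_mul_assoc, mul_smul_comm, ← smul_add, smul_sub, smul_comm (f J)]
    abel

lemma nabla_complexStructure (X Y : VectorField Ω) :
    nabla X (complexStructure Y) = complexStructure (nabla X Y) := VectorField.ext fun J ↦ by
  change dirField (fun J ↦ J.1 * Y.1 J) J (X.1 J) -
    (1 / 2 : ℝ) • (J.1 * (X.1 J * (J.1 * Y.1 J) + J.1 * Y.1 J * X.1 J)) = J.1 * (nabla X Y).1 J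
  rw [dirField_mul isSmoothFieldMap_val Y.smooth (X.mem J), dirField_val (X.mem J)]
  exact sub_half_complex J.mul_self (X.anticomm J)

end connection

end CompatibleACS

namespace CompatibleACS

section algebra

variable {R : Type*} [Ring R] [Algebra ℝ R] {j a : R}

lemma add_conj_anticomm (hj : j * j = -1) :
    (1 / 2 : ℝ) • (a + j * a * j) * j = -(j * (1 / 2 : ℝ) • (a + j * a * j)) := by
  have hj' : ∀ w, j * (j * w) = -w := fun w ↦ by rw [← mul_assoc, hj, neg_one_mul]
  rw [smul_mul_assoc, mul_smul_comm, ← smul_neg]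
  congr 1
  simp only [add_mul, mul_add, mul_assoc, hj, hj', mul_neg, mul_one]
  abel

lemma add_conj_adj_aux (j a : R) :
    (1 / 2 : ℝ) • (-a + -j * (-a * -j)) = -((1 / 2 : ℝ) • (a + j * a * j)) := by
  rw [← smul_neg, neg_mul_neg, neg_mul, mul_assoc, neg_add]

lemma half_add_conj (hj : j * j = -1) (ha : a * j = -(j * a)) :
    (1 / 2 : ℝ) • (a + j * a * j) = a := by
  rw [mul_assoc, ha, mul_neg, ← mul_assoc, hj, neg_one_mul, neg_neg, ← two_smul ℝ, smul_smul]
  norm_num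

end algebra

section mixed

variable {V : Type*} [NormedAddCommGroup V] [NormedSpace ℝ V]

lemma deriv_deriv_comm {g : ℝ × ℝ → V} (hg : ContDiff ℝ ∞ g) :
    deriv (fun t ↦ deriv (fun s ↦ g (t, s)) 0) 0 =
      deriv (fun s ↦ deriv (fun t ↦ g (t, s)) 0) 0 := by
  have hD : ContDiff ℝ ∞ (fderiv ℝ g) := hg.fderiv_right (by simp)
  have h1 : ∀ t, deriv (fun s ↦ g (t, s)) 0 = fderiv ℝ g (t, 0) (0, 1) := fun t ↦ by
    have h := hasDerivAt_prod_line hg (t, 0) (0, 1)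
    simpa using h.deriv
  have h2 : ∀ s, deriv (fun t ↦ g (t, s)) 0 = fderiv ℝ g (0, s) (1, 0) := fun s ↦ by
    have h := hasDerivAt_prod_line hg (0, s) (1, 0)
    simpa using h.deriv
  have h3 := (hasDerivAt_prod_line hD 0 (1, 0)).clm_apply
    (hasDerivAt_const (0 : ℝ) ((0, 1) : ℝ × ℝ))
  have h4 := (hasDerivAt_prod_line hD 0 (0, 1)).clm_apply
    (hasDerivAt_const (0 : ℝ) ((1, 0) : ℝ × ℝ))
  simp only [zero_add, Prod.smul_mk, smul_eq_mul, mul_one, mul_zero, map_zero, add_zero] at h3 h4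
  simp only [h1, h2, h3.deriv, h4.deriv]
  exact ((hg.contDiffAt (x := 0)).isSymmSndFDerivAt
    (by rw [minSmoothness_of_isRCLikeNormedField]; exact WithTop.coe_le_coe.2 (le_top : (2 : ℕ∞) ≤ ⊤))) _ _

end mixed

variable {n : ℕ} {M : Type*} [TopologicalSpace M] [ChartedSpace (Model n) M]
  [IsManifold 𝓘(ℝ, Model n) ∞ M] {Ω : SymplecticForm n M}

lemma velocity_velocity_comm {P : ℝ × ℝ → EndField n M} (hP : IsSmoothFamily P) :
    velocity (fun t ↦ velocity (fun s ↦ P (t, s)) 0) 0 =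
      velocity (fun s ↦ velocity (fun t ↦ P (t, s)) 0) 0 :=
  ext_ev fun x ↦ deriv_deriv_comm (hP.contDiff_ev x)

lemma velocity_sub {P Q : ℝ → EndField n M} (hP : IsSmoothFamily P) (hQ : IsSmoothFamily Q) :
    velocity (fun t ↦ P t - Q t) 0 = velocity P 0 - velocity Q 0 :=
  velocity_eq fun x ↦ (hP.hasDerivAt 0 x).sub (hQ.hasDerivAt 0 x)

lemma velocity_smul {P : ℝ → EndField n M} (hP : IsSmoothFamily P) :
    velocity (fun t ↦ t • P t) 0 = P 0 :=
  velocity_eq fun x ↦ by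
    have h := (hasDerivAt_id (0 : ℝ)).smul (hP.hasDerivAt 0 x)
    simp only [id, zero_smul, one_smul, zero_add] at h
    exact h

lemma dirField_velocity {c : ℝ → ACS Ω} (hc : IsSmoothFamily fun t ↦ (c t).1)
    {Z : ACS Ω → EndField n M} (hZ : IsSmoothFieldMap Z) :
    dirField Z (c 0) (velocity (fun t ↦ (c t).1) 0) = velocity (fun t ↦ Z (c t)) 0 :=
  (velocity_eq fun x ↦ hZ.hasDerivAt ⟨hc, rfl, hc.hasDerivAt 0⟩ (velocity_mem_tangentAt hc) x).symm

lemma velocity_dirField_sub {Q : ℝ × ℝ → ACS Ω} (hQ : IsSmoothFamily fun p ↦ (Q p).1)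
    {X : VectorField Ω} {Z : ACS Ω → EndField n M} (hZ : IsSmoothFieldMap Z)
    {V : ℝ → EndField n M} (hV : ∀ s, V s = velocity (fun t ↦ (Q (t, s)).1) 0)
    (h0 : V 0 = X.1 (Q (0, 0))) {C : EndField n M} (hC : C ∈ tangentAt (Q (0, 0)))
    (hVC : velocity V 0 - dirField X.1 (Q (0, 0)) (velocity (fun s ↦ (Q (0, s)).1) 0) = C) :
    velocity (fun s ↦ velocity (fun t ↦ Z (Q (t, s))) 0) 0 -
      velocity (fun s ↦ dirField Z (Q (0, s)) (X.1 (Q (0, s)))) 0 =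
        dirField Z (Q (0, 0)) C := by
  have hQt : ∀ s, IsSmoothFamily fun t ↦ (Q (t, s)).1 := fun s ↦
    hQ.comp (φ := fun t : ℝ ↦ (t, s)) (by fun_prop)
  have hd : IsSmoothFamily fun s ↦ (Q (0, s)).1 :=
    hQ.comp (φ := fun s : ℝ ↦ ((0 : ℝ), s)) (by fun_prop)
  have hVs : IsSmoothFamily V := by
    rw [funext hV]
    exact hQ.velocity_prod
  have hVm : ∀ s, V s ∈ tangentAt (Q (0, s)) := fun s ↦ by
    rw [hV]
    exact velocity_mem_tangentAt (c := fun t ↦ Q (t, s)) (hQt s)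
  have hX : IsSmoothFamily fun s ↦ X.1 (Q (0, s)) := X.smooth.comp hd
  have h1 : ∀ s, velocity (fun t ↦ Z (Q (t, s))) 0 = dirField Z (Q (0, s)) (V s) := fun s ↦ by
    rw [hV]
    exact (dirField_velocity (c := fun t ↦ Q (t, s)) (hQt s) hZ).symm
  obtain ⟨R, hR, hWR, hR0⟩ := (hVs.sub hX).exists_eq_smul (sub_eq_zero.2 h0)
  rw [velocity_sub hVs hX, ← dirField_velocity (c := fun s ↦ Q (0, s)) hd X.smooth, hVC] at hR0
  have hRm : ∀ s, R s ∈ tangentAt (Q (0, s)) := fun s ↦ by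
    rcases eq_or_ne s 0 with rfl | hs
    · rwa [hR0]
    · have h := Submodule.smul_mem _ s⁻¹ (sub_mem (hVm s) (X.mem (Q (0, s))))
      rwa [hWR, inv_smul_smul₀ hs] at h
  have h5 : ∀ s, dirField Z (Q (0, s)) (V s) - dirField Z (Q (0, s)) (X.1 (Q (0, s))) =
      s • dirField Z (Q (0, s)) (R s) := fun s ↦ by
    rw [← hZ.dirField_sub (hVm s) (X.mem _), hWR, hZ.dirField_smul (hRm s)]
  have h6 := velocity_sub (hZ.isSmoothFamily_dirField hVm hd hVs)
    (hZ.isSmoothFamily_dirField (fun s ↦ X.mem _) hd hX)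
  simp only [h5] at h6
  simp only [h1]
  rw [← h6, velocity_smul (hZ.isSmoothFamily_dirField hRm hd hR), hR0]

lemma flat_flat_sub (X Y : VectorField Ω) {Z : ACS Ω → EndField n M} (hZ : IsSmoothFieldMap Z)
    (J : ACS Ω) : flat X (flat Y Z) J - flat Y (flat X Z) J =
      flat (lieBracket X Y) Z J := by
  obtain ⟨hc, hc0, hcA⟩ := isCurveThrough_retract (X.mem J)
  obtain ⟨c, hcdef⟩ : ∃ c : ℝ → ACS Ω, ∀ t, c t = retract J (t • X.1 J) := ⟨_, fun _ ↦ rfl⟩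
  simp only [← hcdef] at hc hc0 hcA
  obtain ⟨Q, hQdef⟩ : ∃ Q : ℝ × ℝ → ACS Ω, ∀ p, Q p = retract (c p.1) (p.2 • Y.1 (c p.1)) :=
    ⟨_, fun _ ↦ rfl⟩
  have hQ : IsSmoothFamily fun p ↦ (Q p).1 := by
    simp only [hQdef]
    exact isSmoothFamily_retract (fun p ↦ Submodule.smul_mem _ _ (Y.mem _)) (hc.comp contDiff_fst)
      (((Y.smooth.comp hc).comp contDiff_fst).smul contDiff_snd)
  have hQt0 : ∀ t, Q (t, 0) = c t := fun t ↦ by simp only [hQdef, zero_smul, retract_zero]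
  have hQ0s : ∀ s, Q (0, s) = retract J (s • Y.1 J) := fun s ↦ by simp only [hQdef, hc0]
  have hQ00 : Q (0, 0) = J := by rw [hQt0, hc0]
  have h := velocity_dirField_sub hQ (X := X) hZ (V := fun s ↦ velocity (fun t ↦ (Q (t, s)).1) 0)
    (fun _ ↦ rfl) ?_ (hQ00.symm ▸ (lieBracket X Y).mem J) ?_
  · rw [hQ00] at h
    refine Eq.trans (congrArg₂ _ ?_ ?_) h
    · rw [← velocity_velocity_comm (hZ.comp hQ)]
      simp only [hQdef, hcdef]
      rfl
    · simp only [hQ0s]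
      rfl
  · simp only [hQt0, hc0]
    exact velocity_eq hcA
  · rw [← velocity_velocity_comm hQ, hQ00, lieBracket_apply]
    have h1 : ∀ t, velocity (fun s ↦ (Q (t, s)).1) 0 = Y.1 (c t) := fun t ↦ by
      simp only [hQdef]
      exact velocity_retract (Y.mem (c t))
    simp only [h1, hcdef, zero_smul, retract_zero]
    rfl

lemma flat_nabla (X Y Z : VectorField Ω) (J : ACS Ω) :
    flat X (nabla Y Z).1 J = flat X (flat Y Z.1) J - (1 / 2 : ℝ) • (X.1 J *
      (Y.1 J * Z.1 J + Z.1 J * Y.1 J) + J.1 * (flat X Y.1 J * Z.1 J + Y.1 J * flat X Z.1 J +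
        (flat X Z.1 J * Y.1 J + Z.1 J * flat X Y.1 J))) := by
  have hX := X.mem J
  have h1 := Y.smooth.mul Z.smooth
  have h2 := Z.smooth.mul Y.smooth
  have h3 := isSmoothFieldMap_val.mul (h1.add h2)
  change dirField (fun J ↦ flat Y Z.1 J -
    (1 / 2 : ℝ) • (J.1 * (Y.1 J * Z.1 J + Z.1 J * Y.1 J))) J (X.1 J) = _
  rw [dirField_fun_sub (isSmoothFieldMap_flat Y Z.smooth) (h3.const_smul _) hX,
    dirField_const_smul h3 hX, dirField_mul isSmoothFieldMap_val (h1.add h2) hX, dirField_val hX,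
    dirField_fun_add h1 h2 hX, dirField_mul Y.smooth Z.smooth hX, dirField_mul Z.smooth Y.smooth hX]
  rfl

lemma curvature_nabla (X Y Z : VectorField Ω) (J : ACS Ω) :
    (curvature nabla X Y Z).1 J = (-(1 / 4) : ℝ) • ⁅⁅X.1 J, Y.1 J⁆, Z.1 J⁆ := by
  change (nabla X (nabla Y Z)).1 J - (nabla Y (nabla X Z)).1 J -
    (nabla (lieBracket X Y) Z).1 J = _
  rw [nabla_apply X, nabla_apply Y (nabla X Z), nabla_apply (lieBracket X Y), flat_nabla,
    flat_nabla, nabla_apply, nabla_apply, lieBracket_apply]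
  exact curvature_aux J.mul_self (X.anticomm J) (Y.anticomm J) (flat_flat_sub X Y Z.smooth J)

lemma nabla_curvature (W X Y Z : VectorField Ω) :
    nabla W (curvature nabla X Y Z) = curvature nabla (nabla W X) Y Z +
      curvature nabla X (nabla W Y) Z + curvature nabla X Y (nabla W Z) :=
  VectorField.ext fun J ↦ by
  have hW := W.mem J
  have hXY := X.smooth.mul Y.smooth
  have hYX := Y.smooth.mul X.smooth
  have hC := hXY.sub hYX
  have h1 := hC.mul Z.smooth
  have h2 := Z.smooth.mul hC
  have e : flat W (curvature nabla X Y Z).1 J = (-(1 / 4) : ℝ) •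
      (((flat W X.1 J * Y.1 J + X.1 J * flat W Y.1 J -
        (flat W Y.1 J * X.1 J + Y.1 J * flat W X.1 J)) * Z.1 J +
        (X.1 J * Y.1 J - Y.1 J * X.1 J) * flat W Z.1 J) -
      (flat W Z.1 J * (X.1 J * Y.1 J - Y.1 J * X.1 J) +
        Z.1 J * (flat W X.1 J * Y.1 J + X.1 J * flat W Y.1 J -
        (flat W Y.1 J * X.1 J + Y.1 J * flat W X.1 J)))) := by
    have e0 : (curvature nabla X Y Z).1 = fun J ↦ (-(1 / 4) : ℝ) •
        ((X.1 J * Y.1 J - Y.1 J * X.1 J) * Z.1 J - Z.1 J * (X.1 J * Y.1 J - Y.1 J * X.1 J)) :=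
      funext fun J ↦ curvature_nabla X Y Z J
    rw [flat, e0, dirField_const_smul (h1.sub h2) hW, dirField_fun_sub h1 h2 hW,
      dirField_mul hC Z.smooth hW, dirField_mul Z.smooth hC hW, dirField_fun_sub hXY hYX hW,
      dirField_mul X.smooth Y.smooth hW, dirField_mul Y.smooth X.smooth hW]
    rfl
  change _ = (curvature nabla (nabla W X) Y Z).1 J + (curvature nabla X (nabla W Y) Z).1 J +
    (curvature nabla X Y (nabla W Z)).1 J
  rw [nabla_apply, e]
  simp only [curvature_nabla, nabla_apply]
  exact parallel_curvature_aux (X.anticomm J) (Y.anticomm J) (Z.anticomm J)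

lemma complexStructure_complexStructure (X : VectorField Ω) :
    complexStructure (complexStructure X) = -X :=
  VectorField.ext fun J ↦ J.mul_mul (X.1 J)

lemma complexStructure_sub (X Y : VectorField Ω) :
    complexStructure (X - Y) = complexStructure X - complexStructure Y :=
  VectorField.ext fun J ↦ mul_sub J.1 (X.1 J) (Y.1 J)

lemma nijenhuis_eq_zero (X Y : VectorField Ω) :
    lieBracket (complexStructure X) (complexStructure Y) =
      lieBracket X Y + complexStructure (lieBracket (complexStructure X) Y) +
        complexStructure (lieBracket X (complexStructure Y)) := by
  simp only [lieBracket_eq, nabla_complexStructure, complexStructure_sub,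
    complexStructure_complexStructure]
  abel

/-- The projection of a fixed field of endomorphisms to the tangent spaces. -/
def extend {J : ACS Ω} {A : EndField n M} (hA : A ∈ tangentAt J) : VectorField Ω :=
  ⟨fun J' ↦ (1 / 2 : ℝ) • (A + J'.1 * A * J'.1), fun J' ↦ by
    obtain ⟨h0, -, h2⟩ := mem_tangentAt_iff.1 hA
    refine mem_tangentAt_iff.2 ⟨?_, ?_, ?_⟩
    · exact (IsSmoothField.add h0 (IsSmoothField.mul (IsSmoothField.mul J'.2.1 h0)
        J'.2.1)).const_smul _
    · exact add_conj_anticomm J'.mul_self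
    · have h3 := (h2.add ((J'.isAdj.mul h2).mul J'.isAdj)).smul (1 / 2)
      exact add_conj_adj_aux (R := EndField n M) J'.1 A ▸ h3,
  fun k P hP ↦ by
    have h := isSmoothFamily_const (F := EuclideanSpace ℝ (Fin k)) (mem_tangentAt_iff.1 hA).1
    exact (h.add ((hP.mul h).mul hP)).const_smul _⟩

lemma extend_apply {J : ACS Ω} {A : EndField n M} (hA : A ∈ tangentAt J) :
    (extend hA).1 J = A :=
  half_add_conj J.mul_self (tangentAt_anticomm hA)

end CompatibleACS

namespace CompatibleACS

open MeasureTheory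

lemma det_pos_of_skew {m : Type*} [Fintype m] [DecidableEq m] {W : Matrix m m ℝ}
    (hW : W.transpose = -W) (h0 : ∀ v, W.mulVec v = 0 → v = 0) : 0 < W.det := by
  have hskew : ∀ v : m → ℝ, v ⬝ᵥ W.mulVec v = 0 := fun v ↦ by
    have h1 : v ⬝ᵥ W.mulVec v = v ⬝ᵥ W.transpose.mulVec v := by
      rw [Matrix.mulVec_transpose, dotProduct_comm v (Matrix.vecMul v W), Matrix.dotProduct_mulVec]
    rw [hW, Matrix.neg_mulVec, dotProduct_neg] at h1
    linarith
  have hne : ∀ t ∈ Set.Icc (0 : ℝ) 1, ((1 - t) • (1 : Matrix m m ℝ) + t • W).det ≠ 0 := by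
    intro t ht hdet
    obtain ⟨v, hv, hv0⟩ := Matrix.exists_mulVec_eq_zero_iff.2 hdet
    have h1 := congrArg (fun u ↦ v ⬝ᵥ u) hv0
    simp only [Matrix.add_mulVec, Matrix.smul_mulVec, Matrix.one_mulVec, dotProduct_add,
      dotProduct_smul, hskew, mul_zero, add_zero, dotProduct_zero, smul_eq_mul] at h1
    have h2 : v ⬝ᵥ v ≠ 0 := fun h ↦ hv (dotProduct_self_eq_zero.1 h)
    have h3 : t = 1 := by linarith [(mul_eq_zero.1 h1).resolve_right h2]
    subst h3
    simp only [sub_self, zero_smul, one_smul, zero_add] at hv0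
    exact hv (h0 v hv0)
  have hcont : ContinuousOn (fun t : ℝ ↦ ((1 - t) • (1 : Matrix m m ℝ) + t • W).det)
      (Set.Icc 0 1) := Continuous.continuousOn (by fun_prop)
  by_contra hneg
  have hmem : (0 : ℝ) ∈ Set.Icc ((1 - 1 : ℝ) • (1 : Matrix m m ℝ) + (1 : ℝ) • W).det
      ((1 - 0 : ℝ) • (1 : Matrix m m ℝ) + (0 : ℝ) • W).det := by
    constructor
    · simpa using hneg
    · simp
  obtain ⟨t, ht, h⟩ := intermediate_value_Icc' zero_le_one hcont hmem
  exact hne t ht h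

variable {n : ℕ} {M : Type*} [TopologicalSpace M] [ChartedSpace (Model n) M]

section trace

/-- The trace of an endomorphism of the model space. -/
def traceModel (n : ℕ) : EndModel n →L[ℝ] ℝ :=
  LinearMap.toContinuousLinearMap
    ((LinearMap.trace ℝ (Coord n)).comp (ContinuousLinearMap.coeLM ℝ))

lemma traceModel_mul_comm (a b : EndModel n) :
    traceModel n (a * b) = traceModel n (b * a) :=
  LinearMap.trace_mul_comm ℝ (a : Coord n →ₗ[ℝ] Coord n) (b : Coord n →ₗ[ℝ] Coord n)

lemma traceModel_mul_eq_zero {j e z : EndModel n} (hj : j * j = -1) (he : e * j = j * e)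
    (hz : z * j = -(j * z)) : traceModel n (e * z) = 0 := by
  have h1 : e * z = j * (e * z * j) := by
    rw [mul_assoc e, hz, mul_neg, mul_neg, ← mul_assoc e, he, ← mul_assoc, ← mul_assoc, hj,
      neg_mul, neg_mul, one_mul, neg_neg]
  have h2 : traceModel n (j * (e * z * j)) = -traceModel n (e * z) := by
    rw [traceModel_mul_comm, mul_assoc, hj, mul_neg, mul_one, map_neg]
  rw [← h1] at h2
  linarith

end trace

section symplectic

variable [IsManifold 𝓘(ℝ, Model n) ∞ M]

lemma mfderiv_chartAt_symm {c : M} {y : Model n} (hy : y ∈ (chartAt (Model n) c).target) :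
    mfderiv 𝓘(ℝ, Model n) 𝓘(ℝ, Model n) (chartAt (Model n) c).symm y =
      ofCoord c ((chartAt (Model n) c).symm y) := by
  have : IsManifold 𝓘(ℝ, Model n) 1 M := .of_le (n := ∞) (by simp)
  have h := TangentBundle.symmL_trivializationAt (I := 𝓘(ℝ, Model n))
    ((chartAt (Model n) c).map_target hy)
  simp only [mfld_simps, mfderivWithin_univ] at h
  rw [(chartAt (Model n) c).right_inv hy] at h
  exact h.symm

lemma localForm_eq (b : ∀ x : M, Tan n x →L[ℝ] Tan n x →L[ℝ] ℝ) {c : M} {y : Model n}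
    (hy : y ∈ (chartAt (Model n) c).target) (u v : Model n) :
    localForm b c y u v = b ((chartAt (Model n) c).symm y)
      (ofCoord c ((chartAt (Model n) c).symm y) u) (ofCoord c ((chartAt (Model n) c).symm y) v) := by
  rw [localForm, mfderiv_chartAt_symm hy]
  rfl

lemma contMDiffOn_ofCoord (c : M) (u : Model n) :
    ContMDiffOn 𝓘(ℝ, Model n) (𝓘(ℝ, Model n).prod 𝓘(ℝ, Model n)) ∞
      (fun z : M ↦ TotalSpace.mk' (Model n) (E := fun x : M ↦ Tan n x) z (ofCoord c z u))
      (chartAt (Model n) c).source := by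
  refine ((trivializationAt (Model n) (TangentSpace 𝓘(ℝ, Model n)) c).contMDiffOn_iff ?_).2
    ⟨contMDiffOn_id, (contMDiffOn_const (c := u)).congr fun z hz ↦ ?_⟩
  · intro z hz
    rw [Trivialization.mem_source]
    exact hz
  · have h1 := (trivializationAt (Model n) (TangentSpace 𝓘(ℝ, Model n)) c).apply_mk_symm hz u
    rw [← Trivialization.symmL_apply (R := ℝ) _ hz] at h1
    exact congrArg Prod.snd h1

variable {Ω : SymplecticForm n M}

lemma contDiffOn_localForm (c : M) (u v : Model n) :
    ContDiffOn ℝ ∞ (fun y ↦ localForm Ω.form c y u v) (chartAt (Model n) c).target := by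
  have h1 := (Ω.smooth.contMDiffOn (s := (chartAt (Model n) c).source)).clm_bundle_apply₂
    (F₃ := ℝ) (E₃ := Bundle.Trivial M ℝ) (contMDiffOn_ofCoord c u) (contMDiffOn_ofCoord c v)
  have h2 : ContMDiffOn 𝓘(ℝ, Model n) 𝓘(ℝ, ℝ) ∞
      (fun z ↦ Ω.form z (ofCoord c z u) (ofCoord c z v)) (chartAt (Model n) c).source :=
    fun z hz ↦ contMDiffWithinAt_section.1 (h1 z hz)
  have h3 := h2.comp (contMDiffOn_chart_symm (x := c)) (fun y hy ↦
    (chartAt (Model n) c).map_target hy)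
  exact (contMDiffOn_iff_contDiffOn.1 h3).congr fun y hy ↦ localForm_eq Ω.form hy u v

lemma continuousOn_volumeDensity (c : M) :
    ContinuousOn (volumeDensity Ω c) (chartAt (Model n) c).target := by
  refine ContinuousOn.sqrt ?_
  simp only [Matrix.det_apply]
  refine continuousOn_finsetSum _ fun σ _ ↦ ContinuousOn.const_smul
    (continuousOn_finsetProd _ fun i _ ↦ ?_) _
  exact (contDiffOn_localForm c _ _).continuousOn

lemma localForm_sum_right {c : M} {y : Model n} (u : Model n) (v : Fin (2 * n) → ℝ) :
    localForm Ω.form c y u (WithLp.toLp 2 v) =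
      ∑ j, localForm Ω.form c y u (EuclideanSpace.single j 1) * v j := by
  have h : (WithLp.toLp 2 v : Model n) = ∑ j, v j • EuclideanSpace.single j (1 : ℝ) := by
    ext i
    simp [Finset.sum_apply, Pi.single_apply]
  let D : EndModel n := mfderiv 𝓘(ℝ, Model n) 𝓘(ℝ, Model n) (chartAt (Model n) c).symm y
  let L : Coord n →L[ℝ] ℝ :=
    ContinuousLinearMap.comp (Ω.form ((chartAt (Model n) c).symm y) (D u) : Coord n →L[ℝ] ℝ) D
  rw [h]
  refine (map_sum L _ _).trans (Finset.sum_congr rfl fun j _ ↦ ?_)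
  exact (map_smul L _ _).trans (mul_comm _ _)

lemma volumeDensity_pos {c : M} {y : Model n} (hy : y ∈ (chartAt (Model n) c).target) :
    0 < volumeDensity Ω c y := by
  refine Real.sqrt_pos.2 (det_pos_of_skew ?_ fun v hv ↦ ?_)
  · ext i j
    exact Ω.skew _ _ _
  · have hz := (chartAt (Model n) c).map_target hy
    have h1 : ∀ i, localForm Ω.form c y (EuclideanSpace.single i 1) (WithLp.toLp 2 v) = 0 :=
      fun i ↦ by
        rw [localForm_sum_right]
        exact congrFun hv i
    have h2 : ∀ u : Fin (2 * n) → ℝ,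
        localForm Ω.form c y (WithLp.toLp 2 v) (WithLp.toLp 2 u) = 0 := fun u ↦ by
      rw [localForm_sum_right]
      refine Finset.sum_eq_zero fun i _ ↦ ?_
      have h3 : localForm Ω.form c y (WithLp.toLp 2 v) (EuclideanSpace.single i 1) =
        - localForm Ω.form c y (EuclideanSpace.single i 1) (WithLp.toLp 2 v) := Ω.skew _ _ _
      rw [h3, h1, neg_zero, zero_mul]
    have h4 := Ω.nondegenerate ((chartAt (Model n) c).symm y)
      (ofCoord c ((chartAt (Model n) c).symm y) (WithLp.toLp 2 v)) fun w ↦ by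
        have h5 := h2 (WithLp.ofLp (toCoord c ((chartAt (Model n) c).symm y) w : Model n))
        rw [localForm_eq _ hy] at h5
        have h6 : ofCoord c ((chartAt (Model n) c).symm y)
            (toCoord c ((chartAt (Model n) c).symm y) w) = w :=
          congrArg (fun a : EndModel n ↦ a w) (ofCoord_mul_toCoord hz)
        exact h6 ▸ h5
    have h7 : toCoord c ((chartAt (Model n) c).symm y)
        (ofCoord c ((chartAt (Model n) c).symm y) (WithLp.toLp 2 v : Model n)) =
          (WithLp.toLp 2 v : Model n) :=
      congrArg (fun a : EndModel n ↦ a (WithLp.toLp 2 v : Model n)) (toCoord_mul_ofCoord hz)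
    have h8 : (WithLp.toLp 2 v : Model n) = 0 := by
      rw [← h7]
      exact (congrArg _ h4).trans (map_zero _)
    simpa using h8

end symplectic

end CompatibleACS

namespace CompatibleACS

open MeasureTheory

section trace

variable {V : Type*} [AddCommGroup V] [Module ℝ V] [FiniteDimensional ℝ V]

lemma trace_mul_self_of_isSymm {B : LinearMap.BilinForm ℝ V} (hB : LinearMap.IsSymm B)
    (hpos : ∀ v, v ≠ 0 → 0 < B v v) {a : V →ₗ[ℝ] V} (ha : ∀ v w, B (a v) w = B v (a w)) :
    0 ≤ LinearMap.trace ℝ V (a * a) ∧ (a ≠ 0 → 0 < LinearMap.trace ℝ V (a * a)) := by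
  obtain ⟨b, hb⟩ := LinearMap.BilinForm.exists_orthogonal_basis (K := ℝ) (V := V) (B := B) hB
  have hbpos : ∀ i, 0 < B (b i) (b i) := fun i ↦ hpos _ (b.ne_zero i)
  have hrepr : ∀ u i, b.repr u i = B (b i) u / B (b i) (b i) := fun u i ↦ by
    rw [eq_div_iff (hbpos i).ne']
    conv_rhs => rw [← b.sum_repr u]
    rw [map_sum, Finset.sum_eq_single i]
    · rw [map_smul, smul_eq_mul]
    · intro j _ hj
      rw [map_smul, show B (b i) (b j) = 0 from hb hj.symm, smul_zero]
    · exact fun h ↦ absurd (Finset.mem_univ i) h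
  have htr : LinearMap.trace ℝ V (a * a) = ∑ i, B (a (b i)) (a (b i)) / B (b i) (b i) := by
    rw [LinearMap.trace_eq_matrix_trace ℝ b, Matrix.trace]
    refine Finset.sum_congr rfl fun i _ ↦ ?_
    rw [Matrix.diag_apply, LinearMap.toMatrix_apply, hrepr, Module.End.mul_apply, ← ha]
  have hnn : ∀ v, 0 ≤ B v v := fun v ↦ by
    rcases eq_or_ne v 0 with rfl | hv
    · simp
    · exact (hpos v hv).le
  rw [htr]
  refine ⟨Finset.sum_nonneg fun i _ ↦ div_nonneg (hnn _) (hnn _), fun h ↦ ?_⟩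
  obtain ⟨i, hi⟩ : ∃ i, a (b i) ≠ 0 := by
    by_contra! h'
    exact h (b.ext fun i ↦ by rw [h', LinearMap.zero_apply])
  exact Finset.sum_pos' (fun i _ ↦ div_nonneg (hnn _) (hnn _))
    ⟨i, Finset.mem_univ i, div_pos (hpos _ hi) (hbpos i)⟩

end trace

variable {n : ℕ} {M : Type*} [TopologicalSpace M] [ChartedSpace (Model n) M]
  [IsManifold 𝓘(ℝ, Model n) ∞ M]

lemma traceModel_loc {c : M} {y : Model n} (hy : y ∈ (chartAt (Model n) c).target)
    (A : EndField n M) :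
    traceModel n (loc c y A) = traceModel n (ev ((chartAt (Model n) c).symm y) A) := by
  rw [loc_apply, traceModel_mul_comm, mul_assoc,
    ofCoord_mul_toCoord ((chartAt (Model n) c).map_target hy), mul_one]

lemma continuousOn_traceModel_loc {A : EndField n M} (hA : IsSmoothField A) (c : M) :
    ContinuousOn (fun y ↦ traceModel n (loc c y A)) (chartAt (Model n) c).target := by
  have h := (isSmoothFamily_iff.1 (isSmoothFamily_const (F := ℝ) hA) c).continuousOn
  exact (traceModel n).continuous.comp_continuousOn
    (h.comp (f := fun y : Model n ↦ ((0 : ℝ), y)) (by fun_prop) fun y hy ↦ ⟨Set.mem_univ _, hy⟩)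

section integral

variable [T2Space M] [CompactSpace M]

/-- The image in the chart at `c` of the support of the partition function at `c`. -/
def chartSupport (c : M) : Set (Model n) :=
  chartAt (Model n) c '' tsupport (chartPartition n M c)

lemma tsupport_subset_source (c : M) :
    tsupport (chartPartition n M c) ⊆ (chartAt (Model n) c).source :=
  (SmoothPartitionOfUnity.exists_isSubordinate_chartAt_source 𝓘(ℝ, Model n) M).choose_spec c

lemma isCompact_chartSupport (c : M) : IsCompact (chartSupport c : Set (Model n)) :=
  (isClosed_tsupport _).isCompact.image_of_continuousOn
    ((chartAt (Model n) c).continuousOn.mono (tsupport_subset_source c))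

lemma chartSupport_subset (c : M) : (chartSupport c : Set (Model n)) ⊆ (chartAt (Model n) c).target := by
  rintro _ ⟨x, hx, rfl⟩
  exact (chartAt (Model n) c).map_source (tsupport_subset_source c hx)

lemma mem_chartSupport {c : M} {y : Model n} (hy : y ∈ (chartAt (Model n) c).target)
    (h : chartPartition n M c ((chartAt (Model n) c).symm y) ≠ 0) : y ∈ chartSupport c :=
  ⟨_, subset_tsupport _ h, (chartAt (Model n) c).right_inv hy⟩

variable (n M) in
lemma finite_chartPartition_ne_zero :
    {c : M | (Function.support (chartPartition n M c)).Nonempty}.Finite :=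
  (chartPartition n M).locallyFinite.finite_nonempty_of_compact

/-- The weight of the chart at `c` in the Liouville integral. -/
def chartWeight (Ω : SymplecticForm n M) (c : M) (y : Model n) : ℝ :=
  chartPartition n M c ((chartAt (Model n) c).symm y) * volumeDensity Ω c y

variable (Ω : SymplecticForm n M)

lemma continuousOn_chartWeight (c : M) :
    ContinuousOn (chartWeight Ω c) (chartAt (Model n) c).target :=
  ((chartPartition n M c).contMDiff.continuous.comp_continuousOn
    (chartAt (Model n) c).continuousOn_symm).mul (continuousOn_volumeDensity c)

lemma chartWeight_nonneg {c : M} {y : Model n} : 0 ≤ chartWeight Ω c y :=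
  mul_nonneg ((chartPartition n M).nonneg _ _) (Real.sqrt_nonneg _)

lemma liouvilleIntegral_eq (f : M → ℝ) :
    liouvilleIntegral Ω f = ∑ c ∈ (finite_chartPartition_ne_zero n M).toFinset,
      ∫ y in chartSupport c, chartWeight Ω c y • f ((chartAt (Model n) c).symm y) := by
  have h1 : ∀ c : M, ∫ y in (chartAt (Model n) c).target,
      chartPartition n M c ((chartAt (Model n) c).symm y) * f ((chartAt (Model n) c).symm y) *
        volumeDensity Ω c y =
      ∫ y in chartSupport c, chartWeight Ω c y • f ((chartAt (Model n) c).symm y) := fun c ↦ by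
    have h2 : ∀ y, chartPartition n M c ((chartAt (Model n) c).symm y) *
        f ((chartAt (Model n) c).symm y) * volumeDensity Ω c y =
        chartWeight Ω c y • f ((chartAt (Model n) c).symm y) := fun y ↦ by
      rw [chartWeight, smul_eq_mul]
      ring
    simp only [h2]
    refine setIntegral_eq_of_subset_of_forall_sdiff_eq_zero
      (chartAt (Model n) c).open_target.measurableSet (chartSupport_subset c) fun y hy ↦ ?_
    have h3 : chartPartition n M c ((chartAt (Model n) c).symm y) = 0 := by
      by_contra h
      exact hy.2 (mem_chartSupport hy.1 h)
    rw [chartWeight, h3, zero_mul, zero_smul]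
  rw [liouvilleIntegral, finsum_eq_sum_of_support_subset _ (fun c hc ↦ ?_)]
  · exact Finset.sum_congr rfl fun c _ ↦ h1 c
  · rw [Set.Finite.coe_toFinset]
    by_contra h
    have h4 : ∀ x, chartPartition n M c x = 0 := fun x ↦ by
      by_contra h'
      exact h ⟨x, h'⟩
    refine hc ?_
    simp only [h4, zero_mul, integral_zero]

/-- The integral of the trace of `A`. -/
def traceIntegral (A : EndField n M) : ℝ :=
  liouvilleIntegral Ω fun x ↦ traceModel n (ev x A)

lemma metric_eq (A B : EndField n M) : metric Ω A B = (1 / 2) * traceIntegral Ω (A * B) := rfl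

lemma traceIntegral_eq (A : EndField n M) :
    traceIntegral Ω A = ∑ c ∈ (finite_chartPartition_ne_zero n M).toFinset,
      ∫ y in chartSupport c, chartWeight Ω c y • traceModel n (loc c y A) := by
  rw [traceIntegral, liouvilleIntegral_eq]
  refine Finset.sum_congr rfl fun c _ ↦ ?_
  refine setIntegral_congr_fun (isCompact_chartSupport c).measurableSet fun y hy ↦ ?_
  simp only [traceModel_loc (chartSupport_subset c hy)]

variable {Ω}

lemma continuousOn_chartWeight_smul {A : EndField n M} (hA : IsSmoothField A) (c : M) :
    ContinuousOn (fun y ↦ chartWeight Ω c y • traceModel n (loc c y A))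
      (chartAt (Model n) c).target :=
  (continuousOn_chartWeight Ω c).smul (continuousOn_traceModel_loc hA c)

lemma integrableOn_chartWeight_smul {A : EndField n M} (hA : IsSmoothField A) (c : M) :
    IntegrableOn (fun y ↦ chartWeight Ω c y • traceModel n (loc c y A)) (chartSupport c) :=
  ((continuousOn_chartWeight_smul hA c).mono (chartSupport_subset c)).integrableOn_compact
    (isCompact_chartSupport c)

lemma traceIntegral_add {A B : EndField n M} (hA : IsSmoothField A) (hB : IsSmoothField B) :
    traceIntegral Ω (A + B) = traceIntegral Ω A + traceIntegral Ω B := by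
  simp only [traceIntegral_eq, ← Finset.sum_add_distrib]
  refine Finset.sum_congr rfl fun c _ ↦ ?_
  rw [← integral_add (integrableOn_chartWeight_smul hA c) (integrableOn_chartWeight_smul hB c)]
  simp only [map_add, smul_add]

lemma traceIntegral_smul (A : EndField n M) (r : ℝ) :
    traceIntegral Ω (r • A) = r * traceIntegral Ω A := by
  simp only [traceIntegral_eq, Finset.mul_sum]
  refine Finset.sum_congr rfl fun c _ ↦ ?_
  rw [← integral_const_mul]
  simp only [map_smul, smul_eq_mul, mul_left_comm]

lemma traceIntegral_congr {A B : EndField n M}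
    (h : ∀ x, traceModel n (ev x A) = traceModel n (ev x B)) :
    traceIntegral Ω A = traceIntegral Ω B := by
  simp only [traceIntegral, h]

lemma traceIntegral_sub {A B : EndField n M} (hA : IsSmoothField A) (hB : IsSmoothField B) :
    traceIntegral Ω (A - B) = traceIntegral Ω A - traceIntegral Ω B := by
  have h := traceIntegral_add (Ω := Ω) hA (hB.const_smul (-1))
  rw [traceIntegral_smul, neg_one_smul, ← sub_eq_add_neg] at h
  rw [h]
  ring

lemma contDiff_traceIntegral {F : Type} [NormedAddCommGroup F] [NormedSpace ℝ F]
    [FiniteDimensional ℝ F] {P : F → EndField n M} (hP : IsSmoothFamily P) :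
    ContDiff ℝ ∞ fun u ↦ traceIntegral Ω (P u) := by
  simp only [traceIntegral_eq]
  refine ContDiff.sum fun c _ ↦ contDiffOn_univ.1 ?_
  exact contDiffOn_setIntegral (f := fun p : F × Model n ↦ traceModel n (loc c p.2 (P p.1)))
    isOpen_univ (chartAt (Model n) c).open_target (isCompact_chartSupport c)
    (chartSupport_subset c) ((continuousOn_chartWeight Ω c).mono (chartSupport_subset c))
    ((traceModel n).contDiff.comp_contDiffOn (isSmoothFamily_iff.1 hP c))

lemma hasDerivAt_traceIntegral {P : ℝ → EndField n M} (hP : IsSmoothFamily P) :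
    HasDerivAt (fun t ↦ traceIntegral Ω (P t)) (traceIntegral Ω (velocity P 0)) 0 := by
  have h0 := isSmoothFamily_const (F := ℝ) (hP.isSmoothField 0)
  obtain ⟨R, hR, hPR, hR0⟩ := (hP.sub h0).exists_eq_smul (sub_self _)
  have h1 : velocity (fun _ : ℝ ↦ P 0) 0 = 0 := velocity_eq fun x ↦ hasDerivAt_const _ _
  rw [velocity_sub hP h0, h1, sub_zero] at hR0
  have h2 : ∀ t, traceIntegral Ω (P t) = traceIntegral Ω (P 0) + t * traceIntegral Ω (R t) :=
    fun t ↦ by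
      rw [← traceIntegral_smul, ← hPR, traceIntegral_sub (hP.isSmoothField t) (hP.isSmoothField 0)]
      ring
  have h3 := ((contDiff_traceIntegral (Ω := Ω) hR).differentiable (by simp) 0).hasDerivAt
  have h4 := ((hasDerivAt_id (0 : ℝ)).mul h3).const_add (traceIntegral Ω (P 0))
  simp only [id, one_mul, zero_mul, add_zero, hR0] at h4
  exact h4.congr_of_eventuallyEq (Filter.Eventually.of_forall h2)

lemma traceIntegral_pos {A : EndField n M} (hA : IsSmoothField A)
    (h0 : ∀ x, 0 ≤ traceModel n (ev x A)) {x : M} (hx : 0 < traceModel n (ev x A)) :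
    0 < traceIntegral Ω A := by
  have hnn : ∀ c : M, ∀ y ∈ (chartSupport c : Set (Model n)),
      0 ≤ chartWeight Ω c y • traceModel n (loc c y A) := fun c y hy ↦ by
    rw [traceModel_loc (chartSupport_subset c hy)]
    exact mul_nonneg (chartWeight_nonneg Ω) (h0 _)
  obtain ⟨c, hc⟩ : ∃ c, 0 < chartPartition n M c x := by
    by_contra! h
    have h1 : ∀ c, chartPartition n M c x = 0 := fun c ↦
      le_antisymm (h c) ((chartPartition n M).nonneg c x)
    have h2 := (chartPartition n M).sum_eq_one (Set.mem_univ x)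
    simp [h1] at h2
  rw [traceIntegral_eq]
  refine Finset.sum_pos' (fun c _ ↦ setIntegral_nonneg (isCompact_chartSupport c).measurableSet
    (hnn c)) ⟨c, (Set.Finite.mem_toFinset _).2 ⟨x, hc.ne'⟩, ?_⟩
  have hxs : x ∈ (chartAt (Model n) c).source :=
    tsupport_subset_source c (subset_tsupport _ hc.ne')
  have hyt := (chartAt (Model n) c).map_source hxs
  rw [setIntegral_pos_iff_support_of_nonneg_ae
    ((ae_restrict_mem (isCompact_chartSupport c).measurableSet).mono fun y hy ↦ hnn c y hy)
    (integrableOn_chartWeight_smul hA c)]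
  have hO := (continuousOn_chartWeight_smul (Ω := Ω) hA c).isOpen_inter_preimage
    (chartAt (Model n) c).open_target isOpen_Ioi (t := Set.Ioi 0)
  refine (hO.measure_pos volume ⟨chartAt (Model n) c x, hyt, ?_⟩).trans_le (measure_mono ?_)
  · rw [Set.mem_preimage, Set.mem_Ioi, traceModel_loc hyt, chartWeight,
      (chartAt (Model n) c).left_inv hxs]
    exact mul_pos (mul_pos hc (volumeDensity_pos hyt)) hx
  · rintro y ⟨hy, hy'⟩
    have h3 : chartWeight Ω c y • traceModel n (loc c y A) ≠ 0 := ne_of_gt hy'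
    refine ⟨h3, mem_chartSupport hy fun h4 ↦ h3 ?_⟩
    rw [chartWeight, h4, zero_mul, zero_smul]

end integral

section positivity

variable {Ω : SymplecticForm n M}

lemma inn_smul_left (J : ACS Ω) (x : M) (r : ℝ) (v w : Tan n x) :
    inn J x (r • v) w = r * inn J x v w := by
  simp only [inn, map_smul, _root_.smul_apply, smul_eq_mul]

lemma inn_smul_right (J : ACS Ω) (x : M) (r : ℝ) (v w : Tan n x) :
    inn J x v (r • w) = r * inn J x v w := by
  simp only [inn, map_smul, smul_eq_mul]

/-- The inner product on the tangent space at `x` given by `J`. -/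
def innForm (J : ACS Ω) (x : M) : LinearMap.BilinForm ℝ (Coord n) :=
  LinearMap.mk₂ ℝ (fun v w : Coord n ↦ inn J x v w) (fun _ _ _ ↦ inn_add_left J x _ _ _)
    (fun _ _ _ ↦ inn_smul_left J x _ _ _) (fun _ _ _ ↦ inn_add_right J x _ _ _)
    (fun _ _ _ ↦ inn_smul_right J x _ _ _)

lemma traceModel_mul_self (J : ACS Ω) {A : EndField n M} (hA : A ∈ tangentAt J) (x : M) :
    0 ≤ traceModel n (ev x (A * A)) ∧ (ev x A ≠ 0 → 0 < traceModel n (ev x (A * A))) := by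
  have h := trace_mul_self_of_isSymm (B := innForm J x) (a := (ev x A : Coord n →ₗ[ℝ] Coord n))
    ⟨fun v w ↦ inn_comm J x v w⟩ (fun v hv ↦ inn_self_pos J x hv)
    (inn_apply_left x (tangentAt_anticomm hA) (mem_tangentAt_iff.1 hA).2.2)
  refine ⟨h.1, fun h0 ↦ h.2 fun h1 ↦ h0 ?_⟩
  exact ContinuousLinearMap.coe_injective h1

lemma traceIntegral_mul_self_pos [T2Space M] [CompactSpace M] {J : ACS Ω} {A : EndField n M}
    (hA : A ∈ tangentAt J) (h0 : A ≠ 0) : 0 < traceIntegral Ω (A * A) := by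
  obtain ⟨x, hx⟩ : ∃ x, ev x A ≠ 0 := by
    by_contra! h
    exact h0 (ext_ev h)
  exact traceIntegral_pos (IsSmoothField.mul hA.1 hA.1) (fun x ↦ (traceModel_mul_self J hA x).1)
    ((traceModel_mul_self J hA x).2 hx)

end positivity

end CompatibleACS

namespace CompatibleACS

section algebra

variable {R : Type*} [Ring R] [Algebra ℝ R] {j x y : R}

lemma half_mul_comm (hj : j * j = -1) (hx : x * j = -(j * x)) (hy : y * j = -(j * y)) :
    ((1 / 2 : ℝ) • (j * (x * y + y * x))) * j = j * ((1 / 2 : ℝ) • (j * (x * y + y * x))) := by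
  have hj' : ∀ w, j * (j * w) = -w := fun w ↦ by rw [← mul_assoc, hj, neg_one_mul]
  have hx' : ∀ w, x * (j * w) = -(j * (x * w)) := fun w ↦ by rw [← mul_assoc, hx, neg_mul, mul_assoc]
  have hy' : ∀ w, y * (j * w) = -(j * (y * w)) := fun w ↦ by rw [← mul_assoc, hy, neg_mul, mul_assoc]
  simp only [smul_mul_assoc, mul_smul_comm, add_mul, mul_add, mul_assoc, hx, hy, hx', hy', hj',
    mul_neg, neg_neg]

end algebra

variable {n : ℕ} {M : Type*} [TopologicalSpace M] [ChartedSpace (Model n) M]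
  [IsManifold 𝓘(ℝ, Model n) ∞ M] [T2Space M] [CompactSpace M] {Ω : SymplecticForm n M}

lemma traceIntegral_mul_comm (A B : EndField n M) :
    traceIntegral Ω (A * B) = traceIntegral Ω (B * A) :=
  traceIntegral_congr fun x ↦ by rw [ev_mul, ev_mul, traceModel_mul_comm]

lemma metric_comm (A B : EndField n M) : metric Ω A B = metric Ω B A := by
  rw [metric_eq, metric_eq, traceIntegral_mul_comm]

lemma metric_add_left {A B C : EndField n M} (hA : IsSmoothField A) (hB : IsSmoothField B)
    (hC : IsSmoothField C) : metric Ω (A + B) C = metric Ω A C + metric Ω B C := by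
  rw [metric_eq, metric_eq, metric_eq, add_mul,
    traceIntegral_add (IsSmoothField.mul hA hC) (IsSmoothField.mul hB hC), mul_add]

lemma metric_sub_left {A B C : EndField n M} (hA : IsSmoothField A) (hB : IsSmoothField B)
    (hC : IsSmoothField C) : metric Ω (A - B) C = metric Ω A C - metric Ω B C := by
  rw [metric_eq, metric_eq, metric_eq, sub_mul,
    traceIntegral_sub (IsSmoothField.mul hA hC) (IsSmoothField.mul hB hC), mul_sub]

lemma metric_smul_left (r : ℝ) (A B : EndField n M) :
    metric Ω (r • A) B = r * metric Ω A B := by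
  rw [metric_eq, metric_eq, smul_mul_assoc, traceIntegral_smul, mul_left_comm]

lemma metric_self_pos {J : ACS Ω} {A : EndField n M} (hA : A ∈ tangentAt J) (h0 : A ≠ 0) :
    0 < metric Ω A A := by
  rw [metric_eq]
  exact mul_pos one_half_pos (traceIntegral_mul_self_pos hA h0)

lemma metric_eq_zero {J : ACS Ω} {A B : EndField n M} (hA : A * J.1 = J.1 * A)
    (hB : B * J.1 = -(J.1 * B)) : metric Ω A B = 0 := by
  have h : ∀ x, traceModel n (ev x (A * B)) = traceModel n (ev x ((0 : ℝ) • (1 : EndField n M))) :=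
    fun x ↦ by
    rw [map_smul, zero_smul, map_zero, ev_mul]
    exact traceModel_mul_eq_zero (congrArg (ev x) J.mul_self) (congrArg (ev x) hA)
      (congrArg (ev x) hB)
  rw [metric_eq, traceIntegral_congr h, traceIntegral_smul, zero_mul, mul_zero]

lemma metric_mul_mul {J : ACS Ω} {A : EndField n M} (hA : A ∈ tangentAt J) (B : EndField n M) :
    metric Ω (J.1 * A) (J.1 * B) = metric Ω A B := by
  have h : J.1 * A * (J.1 * B) = A * B := by
    have h1 : A * J.1 = -(J.1 * A) := tangentAt_anticomm hA
    have h2 := J.mul_self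
    generalize J.1 = j at h1 h2 ⊢
    rw [mul_assoc, ← mul_assoc A, h1, neg_mul, mul_neg, mul_assoc, ← mul_assoc j, h2, neg_one_mul,
      neg_neg]
  rw [metric_eq, metric_eq, h]

lemma kahlerForm_swap {J : ACS Ω} {A : EndField n M} (hA : A ∈ tangentAt J) (B : EndField n M) :
    kahlerForm J B A = -kahlerForm J A B := by
  have h : A * (J.1 * B) = (-1 : ℝ) • (J.1 * A * B) := by
    rw [← mul_assoc, tangentAt_anticomm hA, neg_mul, neg_one_smul]
  rw [kahlerForm, kahlerForm, metric_comm, metric_eq, metric_eq, h, traceIntegral_smul]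
  ring

lemma isSmoothFunction_metric (X Y : VectorField Ω) :
    IsSmoothFunction fun J ↦ metric Ω (X.1 J) (Y.1 J) := fun k P hP ↦
  contDiff_const.mul (contDiff_traceIntegral ((X.smooth k P hP).mul (Y.smooth k P hP)))

lemma hasDirDeriv_metric (X Y Z : VectorField Ω) (J : ACS Ω) :
    HasDirDeriv (fun J' ↦ metric Ω (Y.1 J') (Z.1 J')) J (X.1 J)
      (metric Ω (flat X Y.1 J) (Z.1 J) + metric Ω (Y.1 J) (flat X Z.1 J)) := by
  refine ⟨⟨_, isCurveThrough_retract (X.mem J)⟩, fun c hc ↦ ?_⟩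
  have hs : ∀ W : VectorField Ω, IsSmoothField (flat X W.1 J) := fun W ↦
    (isSmoothFieldMap_flat X W.smooth 0 (fun _ ↦ J) (isSmoothFamily_const J.2.1)).isSmoothField 0
  have h := (hasDerivAt_traceIntegral (Ω := Ω)
    ((Y.smooth.comp hc.1).mul (Z.smooth.comp hc.1))).const_mul (1 / 2)
  have hv : velocity (fun t ↦ Y.1 (c t) * Z.1 (c t)) 0 =
      flat X Y.1 J * Z.1 J + Y.1 J * flat X Z.1 J := velocity_eq fun x ↦ by
    have h1 := (Y.smooth.hasDerivAt hc (X.mem J) x).mul (Z.smooth.hasDerivAt hc (X.mem J) x)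
    simp only [hc.2.1] at h1
    exact h1
  rw [hv, traceIntegral_add (IsSmoothField.mul (hs Y) (Z.mem J).1)
    (IsSmoothField.mul (Y.mem J).1 (hs Z)), mul_add] at h
  exact h

lemma hasDirDeriv_metric_nabla (X Y Z : VectorField Ω) (J : ACS Ω) :
    HasDirDeriv (fun J' ↦ metric Ω (Y.1 J') (Z.1 J')) J (X.1 J)
      (metric Ω ((nabla X Y).1 J) (Z.1 J) + metric Ω (Y.1 J) ((nabla X Z).1 J)) := by
  have key : ∀ W V : VectorField Ω, metric Ω (flat X W.1 J) (V.1 J) =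
      metric Ω ((nabla X W).1 J) (V.1 J) := fun W V ↦ by
    have h1 : flat X W.1 J = (nabla X W).1 J +
        (1 / 2 : ℝ) • (J.1 * (X.1 J * W.1 J + W.1 J * X.1 J)) := by
      rw [nabla_apply, sub_add_cancel]
    have h2 : IsSmoothField ((1 / 2 : ℝ) • (J.1 * (X.1 J * W.1 J + W.1 J * X.1 J))) :=
      (IsSmoothField.mul J.2.1 (IsSmoothField.add (IsSmoothField.mul (X.mem J).1 (W.mem J).1)
        (IsSmoothField.mul (W.mem J).1 (X.mem J).1))).const_smul _
    rw [h1, metric_add_left ((nabla X W).mem J).1 h2 (V.mem J).1,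
      metric_eq_zero (half_mul_comm J.mul_self (X.anticomm J) (W.anticomm J)) (V.anticomm J),
      add_zero]
  have h := hasDirDeriv_metric X Y Z J
  rw [key Y Z, metric_comm (Y.1 J), key Z Y, metric_comm _ (Y.1 J)] at h
  exact h

lemma isLeviCivita_nabla : IsLeviCivita (Ω := Ω) nabla :=
  { isConnection_nabla with
    torsion_free := isLieBracket_nabla
    metric := hasDirDeriv_metric_nabla }

lemma eq_nabla_of_isLeviCivita {D : VectorField Ω → VectorField Ω → VectorField Ω}
    (hD : IsLeviCivita D) : D = nabla := by
  have hsymm : ∀ X Y, D X Y - nabla X Y = D Y X - nabla Y X := fun X Y ↦ by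
    have h := (hD.torsion_free X Y).eq
    rw [sub_eq_sub_iff_sub_eq_sub]
    exact h
  have hskew : ∀ X Y Z J, metric Ω ((D X Y - nabla X Y).1 J) (Z.1 J) =
      -metric Ω ((D X Z - nabla X Z).1 J) (Y.1 J) := fun X Y Z J ↦ by
    have h1 := HasDirDeriv.eq_dirDeriv (X.mem J) (hD.metric X Y Z J)
    have h2 := HasDirDeriv.eq_dirDeriv (X.mem J) (hasDirDeriv_metric_nabla X Y Z J)
    change metric Ω ((D X Y).1 J - (nabla X Y).1 J) (Z.1 J) =
      -metric Ω ((D X Z).1 J - (nabla X Z).1 J) (Y.1 J)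
    rw [metric_sub_left ((D X Y).mem J).1 ((nabla X Y).mem J).1 (Z.mem J).1,
      metric_sub_left ((D X Z).mem J).1 ((nabla X Z).mem J).1 (Y.mem J).1,
      metric_comm ((D X Z).1 J), metric_comm ((nabla X Z).1 J)]
    linarith
  funext X Y
  refine VectorField.ext fun J ↦ ?_
  have hzero : ∀ Z : VectorField Ω, metric Ω ((D X Y - nabla X Y).1 J) (Z.1 J) = 0 := fun Z ↦ by
    have h1 := hskew X Y Z J
    rw [hsymm X Z, hskew Z X Y J, hsymm Z Y, hskew Y Z X J, hsymm Y X] at h1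
    linarith
  by_contra hne
  have h0 : (D X Y - nabla X Y).1 J ≠ 0 := sub_ne_zero.2 hne
  exact (metric_self_pos ((D X Y - nabla X Y).mem J) h0).ne' (hzero (D X Y - nabla X Y))

lemma hasDirDeriv_kahlerForm (X Y Z : VectorField Ω) (J : ACS Ω) :
    HasDirDeriv (fun J' ↦ kahlerForm J' (Y.1 J') (Z.1 J')) J (X.1 J)
      (kahlerForm J ((nabla X Y).1 J) (Z.1 J) + kahlerForm J (Y.1 J) ((nabla X Z).1 J)) := by
  have h := hasDirDeriv_metric_nabla X (complexStructure Y) Z J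
  rw [nabla_complexStructure] at h
  exact h

lemma kahlerForm_lieBracket (X Y Z : VectorField Ω) (J : ACS Ω) :
    kahlerForm J ((lieBracket X Y).1 J) (Z.1 J) =
      kahlerForm J ((nabla X Y).1 J) (Z.1 J) - kahlerForm J ((nabla Y X).1 J) (Z.1 J) := by
  have h : J.1 * (lieBracket X Y).1 J = J.1 * (nabla X Y).1 J - J.1 * (nabla Y X).1 J := by
    rw [lieBracket_eq]
    exact mul_sub _ _ _
  rw [kahlerForm, h, metric_sub_left (mul_mem_tangentAt J ((nabla X Y).mem J)).1
    (mul_mem_tangentAt J ((nabla Y X).mem J)).1 (Z.mem J).1]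
  rfl

variable (Ω) in
lemma isFormallyKahler : IsFormallyKahler Ω where
  bracket X Y := by
    rw [lieBracket_eq]
    exact isLieBracket_nabla X Y
  metric_add _ _ hA _ hB _ hC := metric_add_left hA.1 hB.1 hC.1
  metric_smul _ A _ B _ r := metric_smul_left r A B
  metric_symm _ A _ B _ := metric_comm A B
  metric_pos _ _ hA h0 := metric_self_pos hA h0
  metric_smooth := isSmoothFunction_metric
  complex_sq := complexStructure_complexStructure
  metric_complex _ _ hA B _ := metric_mul_mul hA B
  nijenhuis := nijenhuis_eq_zero
  closed X Y Z J := by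
    refine ⟨_, _, _, hasDirDeriv_kahlerForm X Y Z J, hasDirDeriv_kahlerForm Y Z X J,
      hasDirDeriv_kahlerForm Z X Y J, ?_⟩
    rw [kahlerForm_lieBracket, kahlerForm_lieBracket, kahlerForm_lieBracket,
      kahlerForm_swap (Y.mem J) ((nabla X Z).1 J), kahlerForm_swap (Z.mem J) ((nabla Y X).1 J),
      kahlerForm_swap (X.mem J) ((nabla Z Y).1 J)]
    ring

end CompatibleACS

namespace CompatibleACS

lemma smul_anticommutator {R : Type*} [Ring R] [Algebra ℝ R] (r : ℝ) (a b : R) :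
    r • a * b + b * r • a = r • (a * b + b * a) := by
  rw [smul_mul_assoc, mul_smul_comm, smul_add]

section minpoly

variable {V W : Type*} [AddCommGroup V] [Module ℝ V] [AddCommGroup W] [Module ℝ W]
  {T : Module.End ℝ V} {φ : V →ₗ[ℝ] W} {r : ℝ}

lemma map_aeval_apply (h : ∀ v, φ (T v) = r • φ v) (p : Polynomial ℝ) (v : V) :
    φ (Polynomial.aeval T p v) = p.eval r • φ v := by
  induction p using Polynomial.induction_on generalizing v with
  | C a => simp
  | add p q hp hq => rw [map_add, LinearMap.add_apply, map_add, hp, hq, Polynomial.eval_add, add_smul]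
  | monomial k a ih =>
    rw [pow_succ, ← mul_assoc, map_mul, Module.End.mul_apply, ih, Polynomial.aeval_X, h,
      Polynomial.eval_mul_X, smul_smul]

lemma minpoly_isRoot (h : ∀ v, φ (T v) = r • φ v) {v : V} (hv : φ v ≠ 0) :
    (minpoly ℝ T).IsRoot r := by
  have h1 := map_aeval_apply h (minpoly ℝ T) v
  rw [minpoly.aeval, LinearMap.zero_apply, map_zero] at h1
  exact (smul_eq_zero.1 h1.symm).resolve_right hv

end minpoly

variable {n : ℕ} {M : Type*} [TopologicalSpace M] [ChartedSpace (Model n) M]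

lemma endModel_eq_sum (a : EndModel n) :
    a = ∑ i, ContinuousLinearMap.smulRightL ℝ (Coord n) (Coord n)
      (EuclideanSpace.proj i : Model n →L[ℝ] ℝ) (a (EuclideanSpace.single i (1 : ℝ) : Model n)) := by
  refine ContinuousLinearMap.ext fun v ↦ ?_
  rw [_root_.sum_apply]
  have h : v = ∑ i, (WithLp.ofLp (v : Model n) i) • (EuclideanSpace.single i (1 : ℝ) : Model n) := by
    refine PiLp.ext (x := (v : Model n)) fun i ↦ ?_
    simp [Pi.single_apply]
  conv_lhs => rw [h]
  exact (map_sum a _ _).trans (Finset.sum_congr rfl fun i _ ↦ map_smul a _ _)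

lemma contMDiffAt_endModel {f : M → EndModel n} {x : M}
    (h : ∀ w, ContMDiffAt 𝓘(ℝ, Model n) 𝓘(ℝ, Coord n) ∞ (fun z ↦ f z w) x) :
    ContMDiffAt 𝓘(ℝ, Model n) 𝓘(ℝ, EndModel n) ∞ f x := by
  rw [show f = fun z ↦ _ from funext fun z ↦ endModel_eq_sum (f z)]
  refine contMDiffAt_finsetSum fun i _ ↦ ?_
  exact (ContinuousLinearMap.smulRightL ℝ (Coord n) (Coord n)
    (EuclideanSpace.proj i : Model n →L[ℝ] ℝ)).contDiff.contMDiff.contMDiffAt.comp x (h _)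

lemma infinite_image_bump {c : M} (hn : 0 < n) (χ : SmoothBumpFunction 𝓘(ℝ, Model n) c) :
    (χ '' Function.support χ).Infinite := by
  refine (Set.Ioo_infinite (zero_lt_one' ℝ)).mono fun v hv ↦ ?_
  let u : Model n := EuclideanSpace.single ⟨0, by omega⟩ 1
  have hu : ‖u‖ = 1 := by simp [u]
  let y₀ := extChartAt 𝓘(ℝ, Model n) c c
  have hdist : ∀ s : ℝ, dist (y₀ + s • u) y₀ = |s| := fun s ↦ by
    rw [dist_eq_norm, add_sub_cancel_left, norm_smul, hu, mul_one, Real.norm_eq_abs]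
  have hcont : ContinuousOn (fun s : ℝ ↦ χ.toContDiffBump (y₀ + s • u)) (Set.Icc 0 χ.rOut) :=
    (χ.toContDiffBump.continuous.comp (by fun_prop)).continuousOn
  obtain ⟨s, hs, hsv⟩ := intermediate_value_Icc' χ.rOut_pos.le hcont (show v ∈ Set.Icc _ _ by
    refine ⟨?_, ?_⟩
    · rw [χ.toContDiffBump.zero_of_le_dist (by rw [hdist]; exact le_abs_self _)]
      exact hv.1.le
    · rw [χ.toContDiffBump.one_of_mem_closedBall (by
        rw [Metric.mem_closedBall, hdist, abs_zero]; exact χ.rIn_pos.le)]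
      exact hv.2.le)
  have hlt : dist (y₀ + s • u) y₀ < χ.rOut := by
    by_contra! h
    exact hv.1.ne (hsv ▸ (χ.toContDiffBump.zero_of_le_dist h).symm)
  have hy : y₀ + s • u ∈ (extChartAt 𝓘(ℝ, Model n) c).target :=
    χ.ball_subset ⟨hlt, by simp⟩
  have hx := (extChartAt 𝓘(ℝ, Model n) c).map_target hy
  have hval : χ ((extChartAt 𝓘(ℝ, Model n) c).symm (y₀ + s • u)) = v := by
    rw [χ.eqOn_source (by rwa [extChartAt_source] at hx), Function.comp_apply,
      (extChartAt 𝓘(ℝ, Model n) c).right_inv hy]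
    exact hsv
  exact ⟨_, by rw [Function.mem_support, hval]; exact hv.1.ne', hval⟩

variable [IsManifold 𝓘(ℝ, Model n) ∞ M]

/-- Smooth vector fields on `M`. -/
def IsSmoothVector (V : ∀ x : M, Tan n x) : Prop :=
  ContMDiff 𝓘(ℝ, Model n) (𝓘(ℝ, Model n).prod 𝓘(ℝ, Model n)) ∞
    (fun z : M ↦ TotalSpace.mk' (Model n) (E := fun x : M ↦ Tan n x) z (V z))

lemma IsSmoothVector.apply {V : ∀ x : M, Tan n x} (hV : IsSmoothVector V) {J : EndField n M}
    (hJ : IsSmoothField J) : IsSmoothVector fun x ↦ J x (V x) :=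
  ContMDiff.clm_bundle_apply (F₂ := Model n) (E₂ := fun x : M ↦ Tan n x) hJ hV

lemma isSmoothField_of_apply {A : EndField n M}
    (h : ∀ (x : M) (w : Coord n), ContMDiffAt 𝓘(ℝ, Model n) (𝓘(ℝ, Model n).prod 𝓘(ℝ, Model n)) ∞
      (fun z : M ↦ TotalSpace.mk' (Model n) (E := fun x : M ↦ Tan n x) z (A z (ofCoord x z w))) x) :
    IsSmoothField A := by
  intro x
  refine (contMDiffAt_hom_bundle _).2 ⟨contMDiffAt_id, ?_⟩
  refine contMDiffAt_endModel fun w ↦ ?_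
  refine ((contMDiffAt_section _).1 (h x w)).congr_of_eventuallyEq ?_
  filter_upwards [(chartAt (Model n) x).open_source.mem_nhds (mem_chart_source _ x)] with z hz
  exact (trivializationAt (Model n) (TangentSpace 𝓘(ℝ, Model n)) x).continuousLinearMapAt_apply_of_mem
    ℝ hz _

variable {Ω : SymplecticForm n M}

/-- The tangent vector `Ω(V, J-) V - Ω(V, -) J V` to the space of compatible structures. -/
def rankTwo (J : ACS Ω) (V : ∀ x : M, Tan n x) : EndField n M := fun x ↦
  ((Ω.form x (V x)).comp (J.1 x)).smulRight (V x) - (Ω.form x (V x)).smulRight (J.1 x (V x))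

lemma rankTwo_apply (J : ACS Ω) (V : ∀ x : M, Tan n x) (x : M) (w : Tan n x) :
    rankTwo J V x w = Ω.form x (V x) (J.1 x w) • V x - Ω.form x (V x) w • J.1 x (V x) := rfl

lemma contMDiffAt_form {V W : ∀ x : M, Tan n x} {x : M}
    (hV : ContMDiffAt 𝓘(ℝ, Model n) (𝓘(ℝ, Model n).prod 𝓘(ℝ, Model n)) ∞
      (fun z : M ↦ TotalSpace.mk' (Model n) (E := fun x : M ↦ Tan n x) z (V z)) x)
    (hW : ContMDiffAt 𝓘(ℝ, Model n) (𝓘(ℝ, Model n).prod 𝓘(ℝ, Model n)) ∞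
      (fun z : M ↦ TotalSpace.mk' (Model n) (E := fun x : M ↦ Tan n x) z (W z)) x) :
    ContMDiffAt 𝓘(ℝ, Model n) 𝓘(ℝ, ℝ) ∞ (fun z ↦ Ω.form z (V z) (W z)) x :=
  (contMDiffAt_section _).1 (ContMDiffAt.clm_bundle_apply₂
    (F₃ := ℝ) (E₃ := Bundle.Trivial M ℝ) (Ω.smooth x) hV hW)

lemma isSmoothField_rankTwo (J : ACS Ω) {V : ∀ x : M, Tan n x} (hV : IsSmoothVector V) :
    IsSmoothField (rankTwo J V) := by
  refine isSmoothField_of_apply fun x w ↦ ?_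
  have h1 := (contMDiffOn_ofCoord x w).contMDiffAt
    ((chartAt (Model n) x).open_source.mem_nhds (mem_chart_source _ x))
  have h2 := ContMDiffAt.clm_bundle_apply (F₂ := Model n) (E₂ := fun x : M ↦ Tan n x)
    (J.2.1 x) h1
  exact ((contMDiffAt_form (Ω := Ω) (hV x) h2).smul_section (hV x)).sub_section
    ((contMDiffAt_form (Ω := Ω) (hV x) h1).smul_section (hV.apply J.2.1 x))

lemma rankTwo_mem (J : ACS Ω) {V : ∀ x : M, Tan n x} (hV : IsSmoothVector V) :
    rankTwo J V ∈ tangentAt J := by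
  refine mem_tangentAt_iff.2 ⟨isSmoothField_rankTwo J hV, ?_, ?_⟩
  · funext x
    refine ContinuousLinearMap.ext fun w ↦ ?_
    change rankTwo J V x (J.1 x w) = -(J.1 x (rankTwo J V x w))
    rw [rankTwo_apply, rankTwo_apply, J.apply_apply, map_sub, map_smul, map_smul, map_neg,
      J.apply_apply]
    module
  · intro x v w
    change Ω.form x (rankTwo J V x v) w = Ω.form x v (-(rankTwo J V x w))
    have h1 : Ω.form x (J.1 x (V x)) w = -Ω.form x (V x) (J.1 x w) := by
      rw [J.isAdj x (V x) w]
      simp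
    have h2 : Ω.form x v (J.1 x (V x)) = Ω.form x (V x) (J.1 x v) := by
      rw [Ω.skew, J.isAdj x (V x) v]
      simp
    have h3 := Ω.skew x v (V x)
    rw [rankTwo_apply, rankTwo_apply]
    simp only [map_sub, map_smul, map_neg, _root_.sub_apply, _root_.smul_apply, smul_eq_mul, h1, h2,
      h3]
    ring

lemma rankTwo_ne_zero (J : ACS Ω) {V : ∀ x : M, Tan n x} {x : M} (hx : V x ≠ 0) :
    ev x (rankTwo J V) ≠ 0 := by
  intro h
  have h1 : rankTwo J V x (V x) = 0 := congrArg (fun a : EndModel n ↦ a (V x)) h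
  rw [rankTwo_apply, Ω.alternating, zero_smul, sub_zero] at h1
  exact (smul_ne_zero (inn_self_pos J x hx).ne' hx) h1

lemma isSmoothVector_bump [T2Space M] {c : M} (χ : SmoothBumpFunction 𝓘(ℝ, Model n) c)
    (u : Model n) : IsSmoothVector fun z ↦ (χ z • ofCoord c z u : Model n) :=
  ContMDiffOn.smul_section_of_tsupport χ.contMDiff.contMDiffOn (chartAt (Model n) c).open_source
    χ.tsupport_subset_chartAt_source (contMDiffOn_ofCoord c u)

/-- Multiplication by a smooth function on `M`, acting on tangent vectors. -/
def mulFunction (J : ACS Ω) {f : M → ℝ} (hf : ContMDiff 𝓘(ℝ, Model n) 𝓘(ℝ, ℝ) ∞ f) :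
    Module.End ℝ (tangentAt J) where
  toFun A := ⟨fun x ↦ f x • A.1 x, by
    refine ⟨SmoothAlong.smul A.2.1 hf, ?_, fun x v w ↦ ?_⟩
    · funext x
      have h := congrFun A.2.2.1 x
      exact (smul_anticommutator (R := EndModel n) (f x) (ev x A.1) (ev x J.1)).trans
        ((congrArg (f x • ·) h).trans (smul_zero _))
    · have h := A.2.2.2 x v w
      simp only [_root_.smul_apply, map_smul, smul_eq_mul]
      rw [← mul_add, h, mul_zero]⟩
  map_add' A B := Subtype.ext (funext fun x ↦ smul_add _ _ _)
  map_smul' r A := Subtype.ext (funext fun x ↦ smul_comm (f x) r (A.1 x))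

lemma not_finiteDimensional_of_infinite {J : ACS Ω} {f : M → ℝ}
    (hf : ContMDiff 𝓘(ℝ, Model n) 𝓘(ℝ, ℝ) ∞ f) {A : EndField n M} (hA : A ∈ tangentAt J)
    (h : (f '' {x | ev x A ≠ 0}).Infinite) : ¬ FiniteDimensional ℝ (tangentAt J) := by
  intro hfin
  have hp : minpoly ℝ (mulFunction J hf) ≠ 0 :=
    minpoly.ne_zero (Algebra.IsIntegral.isIntegral (R := ℝ) (mulFunction J hf))
  refine h ((Multiset.finite_toSet (minpoly ℝ (mulFunction J hf)).roots).subset ?_)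
  rintro _ ⟨x, hx, rfl⟩
  exact (Polynomial.mem_roots hp).2
    (minpoly_isRoot (φ := (ev x).comp (tangentAt J).subtype) (fun _ ↦ rfl) (v := ⟨A, hA⟩) hx)

lemma not_finiteDimensional_tangentAt [T2Space M] (hn : 0 < n) (c : M) (J : ACS Ω) :
    ¬ FiniteDimensional ℝ (tangentAt J) := by
  obtain ⟨χ⟩ : Nonempty (SmoothBumpFunction 𝓘(ℝ, Model n) c) := inferInstance
  obtain ⟨u, hu⟩ : ∃ u : Model n, u ≠ 0 := ⟨EuclideanSpace.single ⟨0, by omega⟩ 1, by simp⟩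
  refine not_finiteDimensional_of_infinite χ.contMDiff (rankTwo_mem J (isSmoothVector_bump χ u))
    ((infinite_image_bump hn χ).mono (Set.image_mono fun x hx ↦ rankTwo_ne_zero J ?_))
  have h3 : toCoord c x (ofCoord c x u) = u :=
    congrArg (fun a : EndModel n ↦ a u) (toCoord_mul_ofCoord (χ.support_subset_source hx))
  have h4 : ofCoord c x u ≠ 0 := fun h ↦
    hu (h3.symm.trans ((congrArg (toCoord c x) h).trans (map_zero (toCoord c x))))
  exact smul_ne_zero hx h4

end CompatibleACS

end

theorem mainTheorem12 (n : ℕ) (M : Type*) [TopologicalSpace M]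
    [ChartedSpace (CompatibleACS.Model n) M]
    [IsManifold 𝓘(ℝ, CompatibleACS.Model n) ∞ M] [T2Space M] [CompactSpace M]
    (Ω : CompatibleACS.SymplecticForm n M) :
    -- the space of compatible almost complex structures is a formal Kähler manifold
    CompatibleACS.IsFormallyKahler Ω ∧
    -- it is infinite-dimensional if `M` is nonempty of positive dimension
    (0 < n → Nonempty M → ∀ J : CompatibleACS.ACS Ω,
      ¬ FiniteDimensional ℝ (CompatibleACS.tangentAt J)) ∧
    -- every tangent vector is the value of a vector field
    (∀ (J : CompatibleACS.ACS Ω), ∀ A ∈ CompatibleACS.tangentAt J,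
      ∃ X : CompatibleACS.VectorField Ω, X.1 J = A) ∧
    -- the metric has a unique Levi-Civita connection
    ∃ D : CompatibleACS.VectorField Ω → CompatibleACS.VectorField Ω → CompatibleACS.VectorField Ω,
      CompatibleACS.IsLeviCivita D ∧ (∀ D', CompatibleACS.IsLeviCivita D' → D' = D) ∧
      -- its curvature is `R(A, B)C = -¼ [[A, B], C]`
      (∀ (X Y Z : CompatibleACS.VectorField Ω) (J : CompatibleACS.ACS Ω),
        (CompatibleACS.curvature D X Y Z).1 J =
          (-(1 / 4) : ℝ) • ⁅⁅X.1 J, Y.1 J⁆, Z.1 J⁆) ∧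
      -- the complex structure is parallel
      (∀ X Y : CompatibleACS.VectorField Ω,
        D X (CompatibleACS.complexStructure Y) = CompatibleACS.complexStructure (D X Y)) ∧
      -- the curvature tensor is parallel
      ∀ W X Y Z : CompatibleACS.VectorField Ω,
        D W (CompatibleACS.curvature D X Y Z) =
          CompatibleACS.curvature D (D W X) Y Z + CompatibleACS.curvature D X (D W Y) Z +
            CompatibleACS.curvature D X Y (D W Z) :=
  ⟨CompatibleACS.isFormallyKahler Ω,
    fun hn ⟨c⟩ J ↦ CompatibleACS.not_finiteDimensional_tangentAt hn c J,
    fun _ _ hA ↦ ⟨CompatibleACS.extend hA, CompatibleACS.extend_apply hA⟩,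
    CompatibleACS.nabla, CompatibleACS.isLeviCivita_nabla,
    fun _ ↦ CompatibleACS.eq_nabla_of_isLeviCivita, CompatibleACS.curvature_nabla,
    CompatibleACS.nabla_complexStructure, CompatibleACS.nabla_curvature⟩
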